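/- **Setting (stochastic bandits with knapsacks).** There are $K$ arms, $d$ resources, $T$ rounds and a budget $0<B\le T$ for each resource. The outcome matrices $M_1,\dots,M_T$ are drawn i.i.d. from a fixed distribution; row $a$ of $M_t$ consists of a reward $r_t(a)\in[0,1]$ and consumptions $c_{t,i}(a)\in[0,1]$, $i\in[d]$. One resource is a *dummy resource*: every arm consumes exactly $B/T$ of it in every round. One arm is a *null arm*: it has reward $0$ and consumes $0$ of every resource other than the dummy resource. In each round an algorithm chooses an arm $a_t$, possibly at random, given the past, and observes only row $a_t$ of $M_t$. Let $\tau$ be the first round in which the total consumption $\sum_{t\le\tau}c_{t,i}(a_t)$ of some resource $i$ exceeds $B$, and $\tau=T$ if there is no such round; the total reward is $\mathrm{REW}=\sum_{t\le\tau}r_t(a_t)$. Let $\mathrm{OPT}_{\mathrm{DP}}$ be the supremum of $\mathbb E[\mathrm{REW}]$ over all (randomized, history-dependent) algorithms for the given instance. **Online learning.** An online learning algorithm with finite action set $A$ chooses in each round $t$ a distribution over $A$ as a function of the history (its past actions and past feedback) and draws $a_t$ from it. An adaptive adversary chooses a payoff vector $f_t\in[r_{\min},r_{\max}]^A$ as a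 deterministic function of $a_1,\dots,a_{t-1}$. The feedback is $f_t(a_t)$ (bandit feedback) or $f_t$ (full feedback). We say that the algorithm satisfies the regret bound $R$ at confidence level $\delta'$ if, against every such adversary, $\Pr\big[\max_{a\in A}\sum_{t\le T}f_t(a)-\sum_{t\le T}f_t(a_t)\le(r_{\max}-r_{\min})\,R\big]\ge 1-\delta'$. For costs, payoffs are the negated costs. **LagrangeBwK** (with parameters $B_0=B$, $T_0=T$) runs a primal algorithm $\mathrm{ALG}_1$ on the arms with bandit feedback and a dual algorithm $\mathrm{ALG}_2$ on the resources with full feedback. In round $t$ they independently draw an arm $a_t$ and a resource $i_t$, and arm $a_t$ is played. With $\mathcal L_t(a,i)=r_t(a)+1-\tfrac TB c_{t,i}(a)\in[r_{\min},r_{\max}]:=[1-\tfrac TB,2]$, $\mathrm{ALG}_1$ observes the reward $\mathcal L_t(a_t,i_t)$, and $\mathrm{ALG}_2$ observes the cost vector $(\mathcal L_t(a_t,i))_{i\in[d]}$. **EXP3.P and Hedge**, on payoffs (resp. costs) rescaled from $[r_{\min},r_{\max}]$ to $[0,1]$. EXP3.P with time horizon $T$ and failure probability $\delta$ has $\alpha=2\sqrt{\ln(KT/\delta)}$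 and $\gamma=\min\{\tfrac35,\,2\sqrt{\tfrac35 K\ln K/T}\}$; it starts with weights $w_1(j)=\exp(\tfrac{\alpha\gamma}3\sqrt{T/K})$, draws $a_t$ from $p_t(j)=(1-\gamma)w_t(j)/\sum_k w_t(k)+\gamma/K$, receives the rescaled reward $x_t$, and sets $w_{t+1}(j)=w_t(j)\exp\big(\tfrac{\gamma}{3K}\big(\tfrac{x_t}{p_t(j)}\mathbf 1_{\{a_t=j\}}+\tfrac{\alpha}{p_t(j)\sqrt{KT}}\big)\big)$. Hedge on $d$ actions draws an action with probabilities proportional to $\beta^{\text{(its total rescaled cost so far)}}$, where $\beta=1/(1+\sqrt{2\ln d/T})$. **Theorem.** There is an absolute constant $C>0$ such that the following holds for all $K,d,T\ge1$, every such instance and every $\delta\in(0,1)$. 1. If $\mathrm{ALG}_1$ is EXP3.P (with time horizon $T$ and failure probability $\delta$) and $\mathrm{ALG}_2$ is Hedge (with time horizon $T$), then with probability at least $1-\delta$, $$\mathrm{OPT}_{\mathrm{DP}}-\mathrm{REW}(\mathrm{LagrangeBwK})\le C\,\frac TB\sqrt{TK\log(dT/\delta)}.$$ 2. In general, if $\mathrm{ALG}_1$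 (with bandit feedback) and $\mathrm{ALG}_2$ (with full feedback) satisfy the regret bounds $R_{1,\delta/T}(T)$ and $R_{2,\delta/T}(T)$, respectively, at confidence level $\delta/T$, for rewards (resp. costs) in the range $[1-\tfrac TB,2]$, then with probability at least $1-C\,\delta T$, $$\mathrm{OPT}_{\mathrm{DP}}-\mathrm{REW}(\mathrm{LagrangeBwK})\le C\,\frac TB\Big(R_{1,\delta/T}(T)+R_{2,\delta/T}(T)+\sqrt{T\log(dT/\delta)}\Big).$$ -/

import Mathlib

open MeasureTheory

noncomputable section

namespace BwK

/-! ### Randomized sequential strategies -/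

/-- A (possibly randomized) strategy that repeatedly picks an action from `Fin n` and, after each
round, observes a feedback of type `F`. After `t` rounds the history `h : Fin t → Fin n × F` lists
the chosen action and the observed feedback of each past round, and `prob t h a` is the probability
with which the strategy then draws action `a`. -/
structure Strategy (n : ℕ) (F : Type) [MeasurableSpace F] where
  prob : (t : ℕ) → (Fin t → Fin n × F) → Fin n → ℝ
  measurable_prob : ∀ t a, Measurable fun h => prob t h a
  prob_nonneg : ∀ t h a, 0 ≤ prob t h a
  sum_prob : ∀ t h, ∑ a, prob t h a = 1

/-- The first `t` entries of a sequence of length `T`. -/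
def past {T : ℕ} {X : Type} (x : Fin T → X) (t : Fin T) : Fin (t : ℕ) → X :=
  fun s => x (Fin.castLE t.isLt.le s)

/-- The product over the rounds of the probabilities with which the strategy draws the actions
recorded in `h`, each given the records of the preceding rounds. -/
def Strategy.playProb {n T : ℕ} {F : Type} [MeasurableSpace F] (alg : Strategy n F)
    (h : Fin T → Fin n × F) : ℝ :=
  ∏ t : Fin T, alg.prob t (past h t) (h t).1

/-! ### Adversarial online learning -/

/-- Bandit feedback: only the payoff of the chosen action is observed. -/
def banditFeedback {n : ℕ} (f : Fin n → ℝ) (a : Fin n) : ℝ := f a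

/-- Full feedback: the entire payoff vector is observed. -/
def fullFeedback {n : ℕ} (f : Fin n → ℝ) (_ : Fin n) : Fin n → ℝ := f

/-- An adaptive adversary: the payoff vector of round `t` is a deterministic function of the
actions chosen in the rounds before `t`. (The past feedback is determined by these actions.) -/
abbrev Adversary (n T : ℕ) : Type := (t : Fin T) → (Fin (t : ℕ) → Fin n) → Fin n → ℝ

/-- The law of the sequence of actions drawn by `alg` against the adversary `f`. -/
def onlineLaw {n T : ℕ} {F : Type} [MeasurableSpace F] (obs : (Fin n → ℝ) → Fin n → F)
    (alg : Strategy n F) (f : Adversary n T) : Measure (Fin T → Fin n) :=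
  Measure.count.withDensity fun a =>
    ENNReal.ofReal (alg.playProb fun t => (a t, obs (f t (past a t)) (a t)))

/-- The regret after `T` rounds: payoff of the best fixed action minus payoff of the algorithm. -/
def regret {n T : ℕ} (f : Adversary n T) (a : Fin T → Fin n) : ℝ :=
  (⨆ b : Fin n, ∑ t, f t (past a t) b) - ∑ t, f t (past a t) (a t)

/-- High-probability regret bound at confidence level `δ`: against every adversary with payoffs in
`[lo, hi]`, the regret after `T` rounds is at most `(hi - lo) * R` with probability at least
`1 - δ`. -/
def HasRegretBound {n : ℕ} {F : Type} [MeasurableSpace F] (obs : (Fin n → ℝ) → Fin n → F)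
    (alg : Strategy n F) (T : ℕ) (lo hi δ R : ℝ) : Prop :=
  ∀ f : Adversary n T, (∀ t h a, f t h a ∈ Set.Icc lo hi) →
    1 - δ ≤ (onlineLaw obs alg f).real {a | regret f a ≤ (hi - lo) * R}

/-! ### Stochastic bandits with knapsacks -/

/-- An outcome matrix: row `a` consists of the reward `(M a).1` of arm `a` and of its consumption
`(M a).2 i` of each resource `i`. -/
abbrev OutcomeMatrix (K d : ℕ) : Type := Fin K → ℝ × (Fin d → ℝ)

/-- An instance of stochastic bandits with knapsacks with `K` arms, `d` resources, time horizon `T`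
and budget `B` for each resource, in which one resource is the dummy resource and one arm is the
null arm. The outcome matrix of each round is drawn independently from `D`. -/
structure Instance (K d T : ℕ) where
  B : ℝ
  B_pos : 0 < B
  B_le : B ≤ T
  D : Measure (OutcomeMatrix K d)
  isProb : IsProbabilityMeasure D
  reward_mem : ∀ᵐ M ∂D, ∀ a, (M a).1 ∈ Set.Icc (0 : ℝ) 1
  cons_mem : ∀ᵐ M ∂D, ∀ a i, (M a).2 i ∈ Set.Icc (0 : ℝ) 1
  dummy : Fin d
  dummy_cons : ∀ᵐ M ∂D, ∀ a, (M a).2 dummy = B / T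
  null : Fin K
  null_reward : ∀ᵐ M ∂D, (M null).1 = 0
  null_cons : ∀ᵐ M ∂D, ∀ i, i ≠ dummy → (M null).2 i = 0

namespace Instance

variable {K d T : ℕ}

/-- The law of the i.i.d. sequence of the outcome matrices of the `T` rounds. -/
def matLaw (I : Instance K d T) : Measure (Fin T → OutcomeMatrix K d) :=
  haveI := I.isProb
  Measure.pi fun _ => I.D

/-- The number of rounds that are played: the first round after which the total consumption of some
resource exceeds the budget `B`, or `T` if there is no such round. -/
def stopRound (I : Instance K d T) (M : Fin T → OutcomeMatrix K d) (a : Fin T → Fin K) : ℕ :=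
  sInf {n : ℕ | n = T ∨ ∃ i, I.B < ∑ t : Fin T, if (t : ℕ) < n then (M t (a t)).2 i else 0}

/-- The total reward, given the outcome matrices and the arms chosen in all rounds. -/
def REW (I : Instance K d T) (M : Fin T → OutcomeMatrix K d) (a : Fin T → Fin K) : ℝ :=
  ∑ t : Fin T, if (t : ℕ) < I.stopRound M a then (M t (a t)).1 else 0

/-- The joint law of the outcome matrices and of the chosen arms under a dynamic policy, which in
each round observes the outcome vector of the chosen arm: the matrices are drawn i.i.d., and, given
the matrices, `playProb` is the probability of each sequence of arms. -/
def policyLaw (I : Instance K d T) (π : Strategy K (ℝ × (Fin d → ℝ))) :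
    Measure ((Fin T → OutcomeMatrix K d) × (Fin T → Fin K)) :=
  (I.matLaw.prod Measure.count).withDensity fun ω =>
    ENNReal.ofReal (π.playProb fun t => (ω.2 t, ω.1 t (ω.2 t)))

/-- The expected total reward of the best dynamic policy. -/
def OPTDP (I : Instance K d T) : ℝ :=
  ⨆ π : Strategy K (ℝ × (Fin d → ℝ)), ∫ ω, I.REW ω.1 ω.2 ∂(I.policyLaw π)

end Instance

/-! ### The algorithm LagrangeBwK -/

/-- The payoff of the Lagrangian game, received as reward by the primal player (who chooses arm
`a`) and as cost by the dual player (who chooses resource `i`). -/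
def lagrangian {K d : ℕ} (B₀ T₀ : ℝ) (M : OutcomeMatrix K d) (a : Fin K) (i : Fin d) : ℝ :=
  (M a).1 + 1 - T₀ / B₀ * (M a).2 i

/-- The joint law of the outcome matrices, the arms and the resources chosen by LagrangeBwK.
In each round the primal algorithm draws an arm `a t` and the dual algorithm independently draws a
resource `i t`; then the former is told the payoff of `(a t, i t)` (bandit feedback), and the latter
the payoff vector `j ↦ -lagrangian (a t) j` (full feedback, payoffs being negated costs). -/
def lagrangeBwKLaw {K d T : ℕ} (I : Instance K d T) (B₀ T₀ : ℝ) (alg₁ : Strategy K ℝ)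
    (alg₂ : Strategy d (Fin d → ℝ)) :
    Measure ((Fin T → OutcomeMatrix K d) × (Fin T → Fin K) × (Fin T → Fin d)) :=
  (I.matLaw.prod Measure.count).withDensity fun ω =>
    ENNReal.ofReal
      ((alg₁.playProb fun t => (ω.2.1 t, lagrangian B₀ T₀ (ω.1 t) (ω.2.1 t) (ω.2.2 t))) *
        alg₂.playProb fun t => (ω.2.2 t, fun j => -lagrangian B₀ T₀ (ω.1 t) (ω.2.1 t) j))

/-! ### EXP3.P -/

/-- Normalized weights mixed with the uniform distribution. -/
def mixProb {K : ℕ} (γ : ℝ) (w : Fin K → ℝ) (j : Fin K) : ℝ :=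
  (1 - γ) * (w j / ∑ k, w k) + γ / K

/-- The weights of EXP3.P with parameters `α`, `γ` and horizon `T`, where the payoffs in `[lo, hi]`
are first rescaled to `[0, 1]`. -/
def exp3pWeight (K T : ℕ) (lo hi α γ : ℝ) : (t : ℕ) → (Fin t → Fin K × ℝ) → Fin K → ℝ
  | 0, _, _ => Real.exp (α * γ / 3 * √(T / K))
  | t + 1, h, j =>
    let w := exp3pWeight K T lo hi α γ t (Fin.init h)
    let p := mixProb γ w j
    let x := ((h (Fin.last t)).2 - lo) / (hi - lo)
    w j * Real.exp (γ / (3 * K) *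
      ((if (h (Fin.last t)).1 = j then x / p else 0) + α / (p * √(K * T))))

lemma exp3pWeight_pos (K T : ℕ) (lo hi α γ : ℝ) (t : ℕ) (h : Fin t → Fin K × ℝ) (j : Fin K) :
    0 < exp3pWeight K T lo hi α γ t h j := by
  induction t with
  | zero => exact Real.exp_pos _
  | succ t ih => exact mul_pos (ih _) (Real.exp_pos _)

lemma measurable_exp3pWeight (K T : ℕ) (lo hi α γ : ℝ) (t : ℕ) (j : Fin K) :
    Measurable fun h => exp3pWeight K T lo hi α γ t h j := by
  induction t generalizing j with
  | zero => exact measurable_const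
  | succ t ih =>
    have hinit : Measurable fun h : Fin (t + 1) → Fin K × ℝ => (Fin.init h : Fin t → Fin K × ℝ) :=
      measurable_pi_lambda _ fun s => measurable_pi_apply _
    have hw : ∀ k, Measurable fun h : Fin (t + 1) → Fin K × ℝ =>
        exp3pWeight K T lo hi α γ t (Fin.init h) k := fun k => (ih k).comp hinit
    have hp : Measurable fun h : Fin (t + 1) → Fin K × ℝ =>
        mixProb γ (exp3pWeight K T lo hi α γ t (Fin.init h)) j := by
      unfold mixProb
      exact (((hw j).div (Finset.measurable_sum _ fun k _ => hw k)).const_mul _).add_const _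
    have hl : Measurable fun h : Fin (t + 1) → Fin K × ℝ => h (Fin.last t) :=
      measurable_pi_apply _
    have hs : MeasurableSet {h : Fin (t + 1) → Fin K × ℝ | (h (Fin.last t)).1 = j} :=
      (measurable_fst.comp hl) (measurableSet_singleton j)
    simp only [exp3pWeight]
    refine (hw j).mul (Real.measurable_exp.comp ((Measurable.add ?_ ?_).const_mul _))
    · exact Measurable.ite hs
        ((((measurable_snd.comp hl).sub_const _).div_const _).div hp) measurable_const
    · exact (hp.mul_const _).const_div _

/-- EXP3.P for payoffs in `[lo, hi]`, with time horizon `T` and parameters `α`, `γ`. -/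
def exp3p (K T : ℕ) [NeZero K] (lo hi α γ : ℝ) (h0 : 0 ≤ γ) (h1 : γ ≤ 1) : Strategy K ℝ where
  prob t h := mixProb γ (exp3pWeight K T lo hi α γ t h)
  measurable_prob t a := by
    unfold mixProb
    exact (((measurable_exp3pWeight K T lo hi α γ t a).div (Finset.measurable_sum _ fun k _ =>
      measurable_exp3pWeight K T lo hi α γ t k)).const_mul _).add_const _
  prob_nonneg t h a := by
    have hw := fun k => (exp3pWeight_pos K T lo hi α γ t h k).le
    exact add_nonneg (mul_nonneg (sub_nonneg.2 h1)
      (div_nonneg (hw a) (Finset.sum_nonneg fun k _ => hw k))) (div_nonneg h0 (Nat.cast_nonneg K))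
  sum_prob t h := by
    have hK : (K : ℝ) ≠ 0 := Nat.cast_ne_zero.2 (NeZero.ne K)
    have hW : ∑ k, exp3pWeight K T lo hi α γ t h k ≠ 0 :=
      (Finset.sum_pos (fun k _ => exp3pWeight_pos K T lo hi α γ t h k)
        Finset.univ_nonempty).ne'
    simp only [mixProb, Finset.sum_add_distrib, ← Finset.mul_sum, ← Finset.sum_div, div_self hW,
      Finset.sum_const, Finset.card_univ, Fintype.card_fin, nsmul_eq_mul]
    field_simp
    ring

/-- The standard exploration parameter of EXP3.P. -/
def exp3pGamma (K T : ℕ) : ℝ := min (3 / 5) (2 * √(3 / 5 * (K * Real.log K / T)))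

/-- EXP3.P with its standard tuning for time horizon `T` and failure probability `δ`. -/
def exp3pTuned (K T : ℕ) [NeZero K] (δ lo hi : ℝ) : Strategy K ℝ :=
  exp3p K T lo hi (2 * √(Real.log (K * T / δ))) (exp3pGamma K T)
    (le_min (by norm_num) (by positivity)) ((min_le_left _ _).trans (by norm_num))

/-! ### Hedge -/

/-- The weights of Hedge with parameter `β`: each action's weight is multiplied in each round by
`β` to the power of its loss, where payoffs in `[lo, hi]` are converted to losses in `[0, 1]`. -/
def hedgeWeight {n : ℕ} (lo hi β : ℝ) (t : ℕ) (h : Fin t → Fin n × (Fin n → ℝ)) (j : Fin n) : ℝ :=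
  ∏ s, β ^ ((hi - (h s).2 j) / (hi - lo))

lemma hedgeWeight_pos {n : ℕ} (lo hi β : ℝ) (hβ : 0 < β) (t : ℕ)
    (h : Fin t → Fin n × (Fin n → ℝ)) (j : Fin n) : 0 < hedgeWeight lo hi β t h j :=
  Finset.prod_pos fun _ _ => Real.rpow_pos_of_pos hβ _

lemma measurable_hedgeWeight {n : ℕ} (lo hi β : ℝ) (t : ℕ) (j : Fin n) :
    Measurable fun h : Fin t → Fin n × (Fin n → ℝ) => hedgeWeight lo hi β t h j := by
  unfold hedgeWeight
  refine Finset.measurable_prod _ fun s _ => Measurable.pow measurable_const ?_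
  have : Measurable fun h : Fin t → Fin n × (Fin n → ℝ) => (h s).2 j :=
    (measurable_pi_apply j).comp (measurable_snd.comp (measurable_pi_apply s))
  exact (this.const_sub _).div_const _

/-- Hedge with full feedback, for payoffs in `[lo, hi]`, with parameter `β`. -/
def hedge (n : ℕ) [NeZero n] (lo hi β : ℝ) (hβ : 0 < β) : Strategy n (Fin n → ℝ) where
  prob t h j := hedgeWeight lo hi β t h j / ∑ k, hedgeWeight lo hi β t h k
  measurable_prob t a := (measurable_hedgeWeight lo hi β t a).div
    (Finset.measurable_sum _ fun k _ => measurable_hedgeWeight lo hi β t k)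
  prob_nonneg t h a := div_nonneg (hedgeWeight_pos lo hi β hβ t h a).le
    (Finset.sum_nonneg fun k _ => (hedgeWeight_pos lo hi β hβ t h k).le)
  sum_prob t h := by
    rw [← Finset.sum_div]
    exact div_self (Finset.sum_pos (fun k _ => hedgeWeight_pos lo hi β hβ t h k)
      Finset.univ_nonempty).ne'

/-- Hedge with its standard tuning `β = 1 / (1 + √(2 log n / T))` for time horizon `T`. -/
def hedgeTuned (n T : ℕ) [NeZero n] (lo hi : ℝ) : Strategy n (Fin n → ℝ) :=
  hedge n lo hi (1 / (1 + √(2 * Real.log n / T))) (by positivity)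

end BwK

end

/-!
LagrangeBwK is a zero-sum game between an arm player and a resource player with payoffs
`r + 1 - (T / B) * c`. The argument compares both players with fixed benchmarks up to the round `τ`
in which the budget runs out (`mul_sum_meanReward_sub_REW_le`).

* Let `x` be a mixture of arms that consumes each resource at a rate of at most `B / T` on average,
  and let `r` be its mean reward. Against every resource the mean payoff of `x` is at least `r`, so
  by its small regret the arm player earns about `τ * r` or more in the first `τ` rounds.
* At `τ` some resource has been consumed to the amount of at least `B`: one whose budget is exceeded
  or, if `τ = T`, the dummy resource. By its small regret the resource player pays at most about as
  much as against this resource, that is, at most `REW + τ - T`.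

As `r ≤ 1`, both facts together show that `REW` is at least about `T * r`. The best dynamic policy
earns at most `T * r + 2 * T / B` for a suitable `x` (`Instance.exists_mixture`): by Wald's identity
the expected reward and consumptions of a policy are linear in its expected numbers of plays, which,
scaled down and completed by the null arm, give `x`.

Three points need care. A regret bound is assumed at the horizon `T` only, but it is used at the
random round `τ`; an adversary that switches to zero payoffs makes it valid for each of the `T`
prefixes (`HasRegretBound.prefix`), at the cost of a union bound. It is assumed against
deterministic adversaries only, but each player faces a randomizing opponent; a worst-case
deterministic response is at least as bad (`exists_respond`, `HasRegretBound.game`). Finally, the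
payoffs of `x` have to be close to their means, which is an exponential supermartingale bound
(`concentration_fail`). All this is combined in `one_sub_le_lagrangeBwKLaw`.

The regret of Hedge follows from its total weight and the Azuma–Hoeffding inequality
(`hedgeTuned_hasRegretBound`). For EXP3.P the confidence terms make the payoff estimates of all arms
optimistic with high probability, and the total weight bounds the largest sum of estimates
(`exp3pTuned_hasRegretBound`). These bounds are proved when `T` is large compared with
`K * log (K * T / δ)`. Otherwise the claimed bound exceeds `T`, except for `T = d = 1`, where the
logarithm may be close to zero; there EXP3.P is uniform over the arms, and a best arm is drawn with
probability `1 / K` (`single_round`).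
-/

noncomputable section

namespace BwK

/-! ### Elementary inequalities for the exponential -/

/-- The exponential lies below its chord over `[-s, s]`. -/
lemma exp_mul_le_cosh_add {x : ℝ} (hx : |x| ≤ 1) (s : ℝ) :
    Real.exp (s * x) ≤ Real.cosh s + x * Real.sinh s := by
  obtain ⟨h1, h2⟩ := abs_le.1 hx
  obtain ⟨-, hc⟩ := convexOn_exp
  have h := hc (Set.mem_univ s) (Set.mem_univ (-s)) (a := (1 + x) / 2)
    (b := (1 - x) / 2) (by linarith) (by linarith) (by ring)
  simp only [smul_eq_mul] at h
  rw [Real.cosh_eq, Real.sinh_eq]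
  calc Real.exp (s * x) = Real.exp ((1 + x) / 2 * s + (1 - x) / 2 * -s) := by ring_nf
    _ ≤ _ := h
    _ = _ := by ring

lemma exp_le_one_add_sq {y : ℝ} (hy : y ≤ 1) : Real.exp y ≤ 1 + y + y ^ 2 := by
  rcases le_total (-1) y with h | h
  · have := abs_le.1 (Real.abs_exp_sub_one_sub_id_le (abs_le.2 ⟨h, hy⟩))
    linarith [this.2]
  · have : Real.exp y ≤ 1 := Real.exp_le_one_iff.2 (by linarith)
    nlinarith

/-! ### Sequential draws from a finite set -/

/-- The product of the conditional weights `w t (past x t) (x t)` along a sequence `x`. -/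
def chainProd {X : Type} {R : Type*} [CommMonoid R] (w : (t : ℕ) → (Fin t → X) → X → R) {T : ℕ}
    (x : Fin T → X) : R :=
  ∏ t : Fin T, w t (past x t) (x t)

/-- Append an entry to a sequence (the non-dependent version of `Fin.snoc`). -/
def append {X : Type} {n : ℕ} (x : Fin n → X) (y : X) : Fin (n + 1) → X :=
  Fin.snoc (α := fun _ => X) x y

section append

variable {X : Type} {n : ℕ} (x : Fin n → X) (y : X)

@[simp] lemma append_castSucc (t : Fin n) : append x y t.castSucc = x t :=
  Fin.snoc_castSucc (α := fun _ => X) y x t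

@[simp] lemma append_last : append x y (Fin.last n) = y :=
  Fin.snoc_last (α := fun _ => X) y x

lemma append_castLE {m : ℕ} (h : m ≤ n) (t : Fin m) :
    append x y (Fin.castLE (h.trans n.le_succ) t) = x (Fin.castLE h t) :=
  append_castSucc x y (Fin.castLE h t)

@[simp] lemma past_append_castSucc (t : Fin n) : past (append x y) t.castSucc = past x t :=
  funext fun s => append_castLE x y t.isLt.le s

@[simp] lemma past_append_last : past (append x y) (Fin.last n) = x :=
  funext fun s => append_castSucc x y s

@[simp] lemma chainProd_append {R : Type*} [CommMonoid R] (w : (t : ℕ) → (Fin t → X) → X → R) :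
    chainProd w (append x y) = chainProd w x * w n x y := by
  simp only [chainProd, Fin.prod_univ_castSucc, past_append_castSucc, append_castSucc,
    past_append_last, append_last]
  rfl

end append

lemma sum_append {R : Type*} {A : Type} [Fintype A] [AddCommMonoid R] {n : ℕ}
    (f : (Fin (n + 1) → A) → R) :
    ∑ a, f a = ∑ a : Fin n → A, ∑ x, f (append a x) := by
  rw [← (Fin.snocEquiv fun _ : Fin (n + 1) => A).sum_comp, Fintype.sum_prod_type,
    Finset.sum_comm]
  rfl

lemma chainProd_nonneg {X : Type} {w : (t : ℕ) → (Fin t → X) → X → ℝ}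
    (hw : ∀ t h x, 0 ≤ w t h x) {T : ℕ} (x : Fin T → X) : 0 ≤ chainProd w x :=
  Finset.prod_nonneg fun _ _ => hw _ _ _

/-- Under conditional probabilities, the total weight of the continuations of a sequence of length
`t₀` is the weight of the sequence itself. -/
lemma sum_chainProd_mul_prefix {A : Type} [Fintype A] {w : (t : ℕ) → (Fin t → A) → A → ℝ}
    (hw : ∀ t h, ∑ x, w t h x = 1) {t₀ T : ℕ} (hT : t₀ ≤ T) (φ : (Fin t₀ → A) → ℝ) :
    ∑ a : Fin T → A, chainProd w a * φ (fun s => a (Fin.castLE hT s)) =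
      ∑ a : Fin t₀ → A, chainProd w a * φ a := by
  induction T, hT using Nat.le_induction with
  | base => rfl
  | succ n hn ih =>
    rw [sum_append, ← ih]
    refine Finset.sum_congr rfl fun a _ => ?_
    have : ∀ x, (fun s => append a x (Fin.castLE (hn.trans n.le_succ) s)) =
        fun s => a (Fin.castLE hn s) := fun x => funext fun s => append_castLE a x hn s
    simp only [chainProd_append]
    calc _ = ∑ x, (chainProd w a * w n a x) * φ (fun s => a (Fin.castLE hn s)) :=
          Finset.sum_congr rfl fun x _ => by rw [← this x]
      _ = _ := by rw [← Finset.sum_mul, ← Finset.mul_sum, hw, mul_one]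

lemma sum_chainProd {A : Type} [Fintype A] {w : (t : ℕ) → (Fin t → A) → A → ℝ}
    (hw : ∀ t h, ∑ x, w t h x = 1) (T : ℕ) : ∑ a : Fin T → A, chainProd w a = 1 := by
  have h := sum_chainProd_mul_prefix hw (Nat.zero_le T) fun _ => 1
  simpa [chainProd] using h

lemma sum_chainProd_le_one {A : Type} [Fintype A] {w : (t : ℕ) → (Fin t → A) → A → ℝ}
    (h0 : ∀ t h x, 0 ≤ w t h x) (T : ℕ) (hw : ∀ t < T, ∀ h, ∑ x, w t h x ≤ 1) :
    ∑ a : Fin T → A, chainProd w a ≤ 1 := by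
  induction T with
  | zero => simp [chainProd]
  | succ n ih =>
    rw [sum_append]
    simp only [chainProd_append, ← Finset.mul_sum]
    refine (Finset.sum_le_sum fun a _ => ?_).trans (ih fun t ht => hw t (ht.trans n.lt_succ_self))
    exact mul_le_of_le_one_right (chainProd_nonneg h0 a) (hw n n.lt_succ_self a)

/-- Markov's inequality for an exponential supermartingale. -/
lemma sum_chainProd_exp_tail {A : Type} [Fintype A] {w : (t : ℕ) → (Fin t → A) → A → ℝ}
    (h0 : ∀ t h x, 0 ≤ w t h x) (g : (t : ℕ) → (Fin t → A) → A → ℝ) (T : ℕ)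
    (hw : ∀ t < T, ∀ h, ∑ x, w t h x * Real.exp (g t h x) ≤ 1) (z : ℝ) :
    ∑ a : Fin T → A, (if z < ∑ t : Fin T, g t (past a t) (a t) then chainProd w a else 0) ≤
      Real.exp (-z) := by
  have h1 := sum_chainProd_le_one (w := fun t h x => w t h x * Real.exp (g t h x))
    (fun t h x => mul_nonneg (h0 t h x) (Real.exp_pos _).le) T hw
  have h2 : ∀ a : Fin T → A, (if z < ∑ t : Fin T, g t (past a t) (a t) then chainProd w a else 0) ≤
      Real.exp (-z) * chainProd (fun t h x => w t h x * Real.exp (g t h x)) a := by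
    intro a
    have hn := chainProd_nonneg h0 a
    have : chainProd (fun t h x => w t h x * Real.exp (g t h x)) a =
        chainProd w a * Real.exp (∑ t : Fin T, g t (past a t) (a t)) := by
      rw [Real.exp_sum]; exact Finset.prod_mul_distrib
    rw [this]
    split_ifs with hz
    · rw [mul_left_comm, ← Real.exp_add]
      exact le_mul_of_one_le_right hn (Real.one_le_exp (by linarith))
    · positivity
  refine (Finset.sum_le_sum fun a _ => h2 a).trans ?_
  rw [← Finset.mul_sum]
  exact mul_le_of_le_one_right (Real.exp_pos _).le h1

/-! ### Worst-case responses -/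

/-- The actions of a player who responds deterministically to the past actions `a` of the other
player. -/
def respond {A I : Type} (g : (t : ℕ) → (Fin t → A) → I) {T : ℕ} (a : Fin T → A) : Fin T → I :=
  fun t => g t (past a t)

/-- Against a player who draws from `p`, no behavioral strategy `q` of the opponent makes an event
(or the expectation of `Φ`) more likely than the best deterministic response to the player's past
actions: in each round, the last one first, pick an action that maximizes the continuation value. -/
lemma exists_respond {A I : Type} [Fintype A] [Fintype I] [Nonempty I]
    {p : (t : ℕ) → (Fin t → A) → (Fin t → I) → A → ℝ}
    {q : (t : ℕ) → (Fin t → A) → (Fin t → I) → I → ℝ}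
    (hp : ∀ t a i x, 0 ≤ p t a i x) (hq : ∀ t a i x, 0 ≤ q t a i x)
    (hq1 : ∀ t a i, ∑ x, q t a i x = 1) (T : ℕ) (Φ : (Fin T → A) → (Fin T → I) → ℝ) :
    ∃ g : (t : ℕ) → (Fin t → A) → I,
      ∑ a : Fin T → A, ∑ i : Fin T → I, (∏ t : Fin T, p t (past a t) (past i t) (a t)) *
        (∏ t : Fin T, q t (past a t) (past i t) (i t)) * Φ a i ≤
      ∑ a : Fin T → A, (∏ t : Fin T, p t (past a t) (past (respond g a) t) (a t)) *
        Φ a (respond g a) := by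
  induction T with
  | zero =>
    refine ⟨fun _ _ => Classical.arbitrary I, le_of_eq ?_⟩
    simp only [Finset.univ_unique, Finset.sum_singleton, Finset.univ_eq_empty, Finset.prod_empty,
      one_mul]
    congr 2
    exact Subsingleton.elim _ _
  | succ n ih =>
    have hmax : ∀ (a : Fin n → A) (i : Fin n → I), ∃ y : I, ∀ y',
        ∑ x, p n a i x * Φ (append a x) (append i y') ≤
        ∑ x, p n a i x * Φ (append a x) (append i y) := fun a i => Finite.exists_max _
    choose γ hγ using hmax
    obtain ⟨g, hg⟩ := ih fun a i => ∑ x, p n a i x * Φ (append a x) (append i (γ a i))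
    set g' : (t : ℕ) → (Fin t → A) → I := Function.update g n fun a => γ a (respond g a) with hg'
    have hlt : ∀ t : Fin n, g' t = g t := fun t => Function.update_of_ne t.isLt.ne _ _
    have hr : ∀ (a : Fin n → A) (x : A),
        respond g' (append a x) = append (respond g a) (γ a (respond g a)) := by
      intro a x
      funext t
      refine Fin.lastCases ?_ (fun t => ?_) t
      · rw [append_last, respond, past_append_last]
        exact congrFun (Function.update_self n _ g) a
      · rw [append_castSucc, respond, past_append_castSucc]
        exact congrFun (hlt t) _
    refine ⟨g', ?_⟩
    rw [sum_append, sum_append]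
    calc _ = ∑ a : Fin n → A, ∑ i : Fin n → I, (∏ t : Fin n, p t (past a t) (past i t) (a t)) *
        (∏ t : Fin n, q t (past a t) (past i t) (i t)) *
          ∑ y, q n a i y * ∑ x, p n a i x * Φ (append a x) (append i y) := by
          refine Finset.sum_congr rfl fun a _ => ?_
          simp only [sum_append (A := I)]
          rw [Finset.sum_comm]
          refine Finset.sum_congr rfl fun i _ => ?_
          simp only [Finset.mul_sum]
          rw [Finset.sum_comm]
          refine Finset.sum_congr rfl fun y _ => Finset.sum_congr rfl fun x _ => ?_
          simp only [Fin.prod_univ_castSucc, past_append_castSucc, append_castSucc,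
            past_append_last, append_last, Fin.val_castSucc, Fin.val_last]
          ring
      _ ≤ ∑ a : Fin n → A, ∑ i : Fin n → I, (∏ t : Fin n, p t (past a t) (past i t) (a t)) *
        (∏ t : Fin n, q t (past a t) (past i t) (i t)) *
          ∑ x, p n a i x * Φ (append a x) (append i (γ a i)) := by
          refine Finset.sum_le_sum fun a _ => Finset.sum_le_sum fun i _ => ?_
          refine mul_le_mul_of_nonneg_left ?_ (mul_nonneg
            (Finset.prod_nonneg fun t _ => hp _ _ _ _) (Finset.prod_nonneg fun t _ => hq _ _ _ _))
          calc _ ≤ ∑ y, q n a i y * ∑ x, p n a i x * Φ (append a x) (append i (γ a i)) :=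
                Finset.sum_le_sum fun y _ => mul_le_mul_of_nonneg_left (hγ a i y) (hq _ _ _ _)
            _ = _ := by rw [← Finset.sum_mul, hq1, one_mul]
      _ ≤ _ := hg
      _ = _ := by
          refine Finset.sum_congr rfl fun a _ => ?_
          rw [Finset.mul_sum]
          refine Finset.sum_congr rfl fun x _ => ?_
          simp only [Fin.prod_univ_castSucc, past_append_castSucc, append_castSucc, hr,
            past_append_last, append_last, Fin.val_castSucc, Fin.val_last]
          ring

/-! ### Regret bounds for adaptive adversaries -/

/-- An adaptive adversary for an unlimited number of rounds. -/
abbrev Payoffs (n : ℕ) : Type := (t : ℕ) → (Fin t → Fin n) → Fin n → ℝ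

section online

variable {n : ℕ} {F : Type} (obs : (Fin n → ℝ) → Fin n → F)

/-- The actions and observed feedback of the past rounds. -/
def record (f : Payoffs n) {t : ℕ} (a : Fin t → Fin n) : Fin t → Fin n × F :=
  fun s => (a s, obs (f s (past a s)) (a s))

lemma record_append_castSucc (f : Payoffs n) {t : ℕ} (a : Fin t → Fin n) (x : Fin n) (s : Fin t) :
    record obs f (append a x) s.castSucc = record obs f a s := by
  simp only [record, append_castSucc, past_append_castSucc]
  rfl

lemma record_append_last (f : Payoffs n) {t : ℕ} (a : Fin t → Fin n) (x : Fin n) :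
    record obs f (append a x) (Fin.last t) = (x, obs (f t a) x) := by
  simp only [record, append_last, past_append_last]
  rfl

lemma init_record_append (f : Payoffs n) {t : ℕ} (a : Fin t → Fin n) (x : Fin n) :
    (Fin.init (record obs f (append a x)) : Fin t → Fin n × F) = record obs f a :=
  funext fun s => record_append_castSucc obs f a x s

variable [MeasurableSpace F] (alg : Strategy n F)

/-- The probability with which `alg` plays `x` in round `t`, as a function of its past actions. -/
def onlineProb (f : Payoffs n) (t : ℕ) (a : Fin t → Fin n) (x : Fin n) : ℝ :=
  alg.prob t (record obs f a) x

lemma onlineProb_nonneg (f : Payoffs n) (t : ℕ) (a : Fin t → Fin n) (x : Fin n) :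
    0 ≤ onlineProb obs alg f t a x :=
  alg.prob_nonneg _ _ _

lemma sum_onlineProb (f : Payoffs n) (t : ℕ) (a : Fin t → Fin n) :
    ∑ x, onlineProb obs alg f t a x = 1 :=
  alg.sum_prob _ _

open Classical in
lemma onlineLaw_real (f : Payoffs n) {T : ℕ} (S : Set (Fin T → Fin n)) :
    (onlineLaw obs alg fun t : Fin T => f t).real S =
      ∑ a, if a ∈ S then chainProd (onlineProb obs alg f) a else 0 := by
  have hS : MeasurableSet S := S.toFinite.measurableSet
  rw [measureReal_def, onlineLaw, withDensity_apply _ hS, ← lintegral_indicator hS,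
    lintegral_count, tsum_fintype, ENNReal.toReal_sum]
  · refine Finset.sum_congr rfl fun a _ => ?_
    by_cases ha : a ∈ S
    · rw [Set.indicator_of_mem ha, if_pos ha, ENNReal.toReal_ofReal]
      · rfl
      · exact chainProd_nonneg (onlineProb_nonneg obs alg f) a
    · rw [Set.indicator_of_notMem ha, if_neg ha, ENNReal.toReal_zero]
  · intro a _
    by_cases ha : a ∈ S
    · rw [Set.indicator_of_mem ha]; exact ENNReal.ofReal_ne_top
    · rw [Set.indicator_of_notMem ha]; exact ENNReal.zero_ne_top

open Classical in
/-- Reformulation of the regret bound: a finite sum bounds the probability of failure. -/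
lemma hasRegretBound_iff {T : ℕ} {lo hi δ R : ℝ} (hlh : lo ≤ hi) :
    HasRegretBound obs alg T lo hi δ R ↔ ∀ f : Payoffs n, (∀ t h a, f t h a ∈ Set.Icc lo hi) →
      ∑ a : Fin T → Fin n, (if (hi - lo) * R < regret (fun t : Fin T => f t) a then
        chainProd (onlineProb obs alg f) a else 0) ≤ δ := by
  have key : ∀ f : Payoffs n, (1 - δ ≤ (onlineLaw obs alg fun t : Fin T => f t).real
      {a | regret (fun t : Fin T => f t) a ≤ (hi - lo) * R}) ↔
      ∑ a : Fin T → Fin n, (if (hi - lo) * R < regret (fun t : Fin T => f t) a then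
        chainProd (onlineProb obs alg f) a else 0) ≤ δ := by
    intro f
    rw [onlineLaw_real]
    have h1 := sum_chainProd (sum_onlineProb obs alg f) T
    have h2 : ∑ a : Fin T → Fin n, chainProd (onlineProb obs alg f) a =
        ∑ a : Fin T → Fin n, (if a ∈ {a | regret (fun t : Fin T => f t) a ≤ (hi - lo) * R} then
          chainProd (onlineProb obs alg f) a else 0) +
        ∑ a : Fin T → Fin n, (if (hi - lo) * R < regret (fun t : Fin T => f t) a then
          chainProd (onlineProb obs alg f) a else 0) := by
      rw [← Finset.sum_add_distrib]
      refine Finset.sum_congr rfl fun a _ => ?_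
      by_cases h : regret (fun t : Fin T => f t) a ≤ (hi - lo) * R
      · simp [h]
      · simp [h, not_le.1 h]
    constructor <;> intro h <;> linarith
  constructor
  · intro h f hf
    exact (key f).1 (h (fun t => f t) fun t h a => hf t h a)
  · intro h f hf
    have hext : ∃ g : Payoffs n, (∀ t h a, g t h a ∈ Set.Icc lo hi) ∧
        f = fun t : Fin T => g t := by
      refine ⟨fun t h a => if ht : t < T then f ⟨t, ht⟩ h a else lo, fun t h a => ?_, ?_⟩
      · dsimp only
        split_ifs
        · exact hf _ _ _
        · exact ⟨le_rfl, hlh⟩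
      · funext t h a
        simp
    obtain ⟨g, hg, rfl⟩ := hext
    exact (key g).2 (h g hg)

lemma HasRegretBound.mono {T : ℕ} {lo hi δ δ' R : ℝ} (h : HasRegretBound obs alg T lo hi δ R)
    (hδ : δ ≤ δ') : HasRegretBound obs alg T lo hi δ' R :=
  fun f hf => (by linarith : 1 - δ' ≤ 1 - δ).trans (h f hf)

end online

lemma sum_fin_ite_lt {t₀ T : ℕ} (h : t₀ ≤ T) (g : ℕ → ℝ) :
    ∑ t : Fin T, (if (t : ℕ) < t₀ then g t else 0) = ∑ t : Fin t₀, g t := by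
  rw [Finset.sum_fin_eq_sum_range, Finset.sum_fin_eq_sum_range,
    ← Finset.sum_subset (Finset.range_mono h)]
  · refine Finset.sum_congr rfl fun t ht => ?_
    have := Finset.mem_range.1 ht
    simp [this, this.trans_le h]
  · intro t ht ht'
    simp at ht ht'
    simp [ht, ht'.not_gt]

open Classical in
/-- A regret bound for the horizon `T` yields one for every shorter horizon: an adversary may switch
to zero payoffs after `t₀` rounds, which does not affect the first `t₀` actions. -/
lemma HasRegretBound.prefix {n : ℕ} [NeZero n] {F : Type} [MeasurableSpace F]
    {obs : (Fin n → ℝ) → Fin n → F} {alg : Strategy n F} {T : ℕ} {lo hi δ R : ℝ}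
    (hreg : HasRegretBound obs alg T lo hi δ R) (hlo : lo ≤ 0) (hhi : 0 ≤ hi)
    {t₀ : ℕ} (ht₀ : t₀ ≤ T) (f : Payoffs n) (hf : ∀ t h a, f t h a ∈ Set.Icc lo hi) :
    ∑ a : Fin T → Fin n, (if ∃ b, (hi - lo) * R < ∑ t : Fin T, (if (t : ℕ) < t₀ then
      f t (past a t) b - f t (past a t) (a t) else 0) then chainProd (onlineProb obs alg f) a
        else 0) ≤ δ := by
  set f' : Payoffs n := fun t h a => if t < t₀ then f t h a else 0 with hf'
  have hφT : ∀ a : Fin T → Fin n, (∃ b, (hi - lo) * R < ∑ t : Fin T, (if (t : ℕ) < t₀ then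
      f t (past a t) b - f t (past a t) (a t) else 0)) ↔ ∃ b, (hi - lo) * R < ∑ t : Fin t₀,
      (f t (past (fun s => a (Fin.castLE ht₀ s)) t) b -
        f t (past (fun s => a (Fin.castLE ht₀ s)) t) (a (Fin.castLE ht₀ t))) := by
    intro a
    refine exists_congr fun b => ?_
    have h := sum_fin_ite_lt ht₀ fun t => if h : t < T then
      f t (past a ⟨t, h⟩) b - f t (past a ⟨t, h⟩) (a ⟨t, h⟩) else 0
    have h1 : ∀ t : Fin t₀, (t : ℕ) < T := fun t => t.isLt.trans_le ht₀
    simp only [Fin.is_lt, dite_true, Fin.eta, h1] at h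
    rw [h]
    rfl
  have hpre : ∀ (f : Payoffs n), ∑ a : Fin T → Fin n, (if ∃ b, (hi - lo) * R <
      ∑ t : Fin t₀, (f t (past (fun s => a (Fin.castLE ht₀ s)) t) b -
        f t (past (fun s => a (Fin.castLE ht₀ s)) t) (a (Fin.castLE ht₀ t))) then
          chainProd (onlineProb obs alg f) a else 0) =
      ∑ a : Fin t₀ → Fin n, (if ∃ b, (hi - lo) * R <
      ∑ t : Fin t₀, (f t (past a t) b - f t (past a t) (a t)) then
          chainProd (onlineProb obs alg f) a else 0) := by
    intro f
    have h := sum_chainProd_mul_prefix (sum_onlineProb obs alg f) ht₀ fun a =>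
      if ∃ b, (hi - lo) * R < ∑ t : Fin t₀, (f t (past a t) b - f t (past a t) (a t)) then 1 else 0
    simpa only [mul_ite, mul_one, mul_zero] using h
  have hff' : ∀ t : Fin t₀, f' t = f t := fun t => by
    funext h a
    simp [hf', t.isLt]
  have hchain : ∀ a : Fin t₀ → Fin n, chainProd (onlineProb obs alg f') a =
      chainProd (onlineProb obs alg f) a := by
    intro a
    refine Finset.prod_congr rfl fun t _ => ?_
    simp only [onlineProb]
    congr 1
    funext s
    simp only [record]
    rw [show f' s = f s from hff' (Fin.castLE t.isLt.le s)]
  have hb := (hasRegretBound_iff obs alg (hlo.trans hhi)).1 hreg f' fun t h a => by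
    simp only [hf']
    split_ifs
    · exact hf _ _ _
    · exact ⟨hlo, hhi⟩
  calc _ = ∑ a : Fin T → Fin n, (if ∃ b, (hi - lo) * R <
      ∑ t : Fin t₀, (f' t (past (fun s => a (Fin.castLE ht₀ s)) t) b -
        f' t (past (fun s => a (Fin.castLE ht₀ s)) t) (a (Fin.castLE ht₀ t))) then
          chainProd (onlineProb obs alg f') a else 0) := by
        simp only [hφT]
        rw [hpre f, hpre f']
        simp only [hff', hchain]
    _ ≤ ∑ a : Fin T → Fin n, (if (hi - lo) * R < regret (fun t : Fin T => f' t) a then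
        chainProd (onlineProb obs alg f') a else 0) := by
        refine Finset.sum_le_sum fun a _ => ?_
        have h0 := chainProd_nonneg (onlineProb_nonneg obs alg f') a
        by_cases h : ∃ b, (hi - lo) * R <
          ∑ t : Fin t₀, (f' t (past (fun s => a (Fin.castLE ht₀ s)) t) b -
          f' t (past (fun s => a (Fin.castLE ht₀ s)) t) (a (Fin.castLE ht₀ t)))
        · have h' := h
          simp only [hff'] at h'
          obtain ⟨b, hb⟩ := (hφT a).2 h'
          have : (hi - lo) * R < regret (fun t : Fin T => f' t) a := by
            refine hb.trans_le ?_
            calc _ = ∑ t : Fin T, f' t (past a t) b - ∑ t : Fin T, f' t (past a t) (a t) := by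
                  rw [← Finset.sum_sub_distrib]
                  refine Finset.sum_congr rfl fun t _ => ?_
                  simp only [hf']
                  split_ifs <;> simp
              _ ≤ _ := sub_le_sub_right (le_ciSup (f := fun b => ∑ t : Fin T, f' t (past a t) b)
                  (Finite.bddAbove_range _) b) _
          rw [if_pos h, if_pos this]
        · rw [if_neg h]
          split_ifs
          exacts [h0, le_rfl]
    _ ≤ δ := hb

/-! ### The regret of Hedge -/

/-- The Hoeffding bound for one round: the centered loss of a random action. -/
lemma sum_mul_exp_centered_le_one {A : Type} [Fintype A] {p ℓ : A → ℝ} (hp : ∀ x, 0 ≤ p x)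
    (hp1 : ∑ x, p x = 1) (hℓ : ∀ x, ℓ x ∈ Set.Icc (0 : ℝ) 1) (s : ℝ) :
    ∑ x, p x * Real.exp (s * (ℓ x - ∑ y, p y * ℓ y) - s ^ 2 / 2) ≤ 1 := by
  set m := ∑ y, p y * ℓ y with hm
  have hm0 : 0 ≤ m := Finset.sum_nonneg fun y _ => mul_nonneg (hp y) (hℓ y).1
  have hm1 : m ≤ 1 := by
    rw [← hp1]
    exact Finset.sum_le_sum fun y _ => mul_le_of_le_one_right (hp y) (hℓ y).2
  have h1 : ∑ x, p x * Real.exp (s * (ℓ x - m)) ≤ Real.cosh s := by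
    calc _ ≤ ∑ x, p x * (Real.cosh s + (ℓ x - m) * Real.sinh s) := by
          refine Finset.sum_le_sum fun x _ => mul_le_mul_of_nonneg_left
            (exp_mul_le_cosh_add ?_ s) (hp x)
          have := hℓ x
          exact abs_le.2 ⟨by linarith [this.1], by linarith [this.2]⟩
      _ = (∑ x, p x) * Real.cosh s + (∑ x, p x * ℓ x - (∑ x, p x) * m) * Real.sinh s := by
          simp only [Finset.sum_mul, ← Finset.sum_add_distrib, ← Finset.sum_sub_distrib]
          exact Finset.sum_congr rfl fun x _ => by ring
      _ = Real.cosh s := by rw [hp1, ← hm]; ring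
  calc _ = (∑ x, p x * Real.exp (s * (ℓ x - m))) * Real.exp (-(s ^ 2 / 2)) := by
        rw [Finset.sum_mul]
        refine Finset.sum_congr rfl fun x _ => ?_
        rw [sub_eq_add_neg, Real.exp_add]
        ring
    _ ≤ Real.exp (s ^ 2 / 2) * Real.exp (-(s ^ 2 / 2)) := by
        gcongr
        exact h1.trans (Real.cosh_le_exp_half_sq s)
    _ = 1 := by rw [← Real.exp_add]; simp

section hedge

variable {n : ℕ} (lo hi β : ℝ) (f : Payoffs n)

lemma hedgeWeight_append {t : ℕ} (a : Fin t → Fin n) (x j : Fin n) :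
    hedgeWeight lo hi β (t + 1) (record fullFeedback f (append a x)) j =
      hedgeWeight lo hi β t (record fullFeedback f a) j * β ^ ((hi - f t a j) / (hi - lo)) := by
  simp only [hedgeWeight, Fin.prod_univ_castSucc, record_append_castSucc, record_append_last]
  rfl

lemma hedgeWeight_record (hβ : 0 < β) {T : ℕ} (a : Fin T → Fin n) (j : Fin n) :
    hedgeWeight lo hi β T (record fullFeedback f a) j =
      β ^ (∑ t : Fin T, (hi - f t (past a t) j) / (hi - lo)) := by
  exact (Real.rpow_sum_of_pos hβ _ _).symm

/-- The total weight of Hedge decreases exponentially in its expected losses. -/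
lemma sum_hedgeWeight_le [NeZero n] {lo hi β : ℝ} {f : Payoffs n} (hβ : 0 < β)
    (hlh : lo < hi) (hf : ∀ t h a, f t h a ∈ Set.Icc lo hi) (T : ℕ) (a : Fin T → Fin n) :
    ∑ j, hedgeWeight lo hi β T (record fullFeedback f a) j ≤
      n * Real.exp (-(1 - β) * ∑ t : Fin T, ∑ j,
        onlineProb fullFeedback (hedge n lo hi β hβ) f t (past a t) j *
          ((hi - f t (past a t) j) / (hi - lo))) := by
  induction T with
  | zero => simp [hedgeWeight]
  | succ T ih =>
    obtain ⟨a, x, rfl⟩ : ∃ a' x, a = append a' x :=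
      ⟨Fin.init a, a (Fin.last T), (Fin.snoc_init_self a).symm⟩
    have hw := fun j => hedgeWeight_pos lo hi β hβ T (record fullFeedback f a) j
    have hW : 0 < ∑ j, hedgeWeight lo hi β T (record fullFeedback f a) j :=
      Finset.sum_pos (fun j _ => hw j) Finset.univ_nonempty
    simp only [hedgeWeight_append, Fin.sum_univ_castSucc, past_append_castSucc, past_append_last,
      Fin.val_castSucc, Fin.val_last]
    rw [mul_add, Real.exp_add, ← mul_assoc]
    set m := ∑ j, onlineProb fullFeedback (hedge n lo hi β hβ) f T a j *
      ((hi - f T a j) / (hi - lo)) with hm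
    calc _ ≤ ∑ j, hedgeWeight lo hi β T (record fullFeedback f a) j *
          (1 - (1 - β) * ((hi - f T a j) / (hi - lo))) := by
          refine Finset.sum_le_sum fun j _ => mul_le_mul_of_nonneg_left ?_ (hw j).le
          have h1 : 0 ≤ (hi - f T a j) / (hi - lo) :=
            div_nonneg (by linarith [(hf T a j).2]) (by linarith)
          have h2 : (hi - f T a j) / (hi - lo) ≤ 1 :=
            (div_le_one (by linarith)).2 (by linarith [(hf T a j).1])
          have := rpow_one_add_le_one_add_mul_self (s := β - 1) (by linarith) h1 h2
          rw [add_sub_cancel] at this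
          linarith
      _ = (∑ j, hedgeWeight lo hi β T (record fullFeedback f a) j) * (1 - (1 - β) * m) := by
          have : (∑ j, hedgeWeight lo hi β T (record fullFeedback f a) j) * m =
              ∑ j, hedgeWeight lo hi β T (record fullFeedback f a) j *
                ((hi - f T a j) / (hi - lo)) := by
            rw [hm, Finset.mul_sum]
            refine Finset.sum_congr rfl fun j _ => ?_
            rw [← mul_assoc]
            congr 1
            exact mul_div_cancel₀ _ hW.ne'
          rw [mul_sub, mul_one, mul_left_comm, this, Finset.mul_sum, ← Finset.sum_sub_distrib]
          exact Finset.sum_congr rfl fun j _ => by ring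
      _ ≤ (∑ j, hedgeWeight lo hi β T (record fullFeedback f a) j) * Real.exp (-(1 - β) * m) := by
          refine mul_le_mul_of_nonneg_left ?_ hW.le
          have := Real.add_one_le_exp (-(1 - β) * m)
          linarith
      _ ≤ _ := mul_le_mul_of_nonneg_right (ih a) (Real.exp_pos _).le

/-- The expected losses of Hedge, along any sequence of actions, exceed the losses of any action
`b` only by a factor and an additive term. -/
lemma hedge_expected_loss_le [NeZero n] {lo hi s : ℝ} {f : Payoffs n} (hs : 0 ≤ s)
    (hβ : 0 < 1 / (1 + s)) (hlh : lo < hi) (hf : ∀ t h a, f t h a ∈ Set.Icc lo hi) (T : ℕ)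
    (a : Fin T → Fin n) (b : Fin n) :
    s * ∑ t : Fin T, ∑ j,
        onlineProb fullFeedback (hedge n lo hi (1 / (1 + s)) hβ) f t (past a t) j *
          ((hi - f t (past a t) j) / (hi - lo)) ≤
      (1 + s) * (Real.log n + s * ∑ t : Fin T, (hi - f t (past a t) b) / (hi - lo)) := by
  set Λ := ∑ t : Fin T, ∑ j,
        onlineProb fullFeedback (hedge n lo hi (1 / (1 + s)) hβ) f t (past a t) j *
          ((hi - f t (past a t) j) / (hi - lo)) with hΛ
  set Lb := ∑ t : Fin T, (hi - f t (past a t) b) / (hi - lo) with hLb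
  have hLb0 : 0 ≤ Lb := Finset.sum_nonneg fun t _ =>
    div_nonneg (by linarith [(hf t (past a t) b).2]) (by linarith)
  have h1s : 0 < 1 + s := by linarith
  have hn : (0 : ℝ) < n := Nat.cast_pos.2 (Nat.pos_of_ne_zero (NeZero.ne n))
  have h1 := sum_hedgeWeight_le hβ hlh hf T a
  have h2 : (1 / (1 + s)) ^ Lb ≤ n * Real.exp (-(1 - 1 / (1 + s)) * Λ) := by
    rw [hLb, ← hedgeWeight_record _ _ _ _ hβ]
    exact (Finset.single_le_sum (fun j _ => (hedgeWeight_pos lo hi _ hβ T _ j).le)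
      (Finset.mem_univ b)).trans h1
  have h3 := Real.log_le_log (Real.rpow_pos_of_pos hβ _) h2
  rw [Real.log_rpow hβ, Real.log_mul hn.ne' (Real.exp_pos _).ne', Real.log_exp, one_div,
    Real.log_inv] at h3
  have h4 : Real.log (1 + s) ≤ s := by linarith [Real.log_le_sub_one_of_pos h1s]
  have h5 : (1 + s) * (1 - (1 + s)⁻¹) = s := by field_simp; ring
  have h6 : (1 - (1 + s)⁻¹) * Λ ≤ Real.log n + s * Lb := by
    nlinarith [mul_le_mul_of_nonneg_left h4 hLb0]
  calc s * Λ = (1 + s) * ((1 - (1 + s)⁻¹) * Λ) := by rw [← mul_assoc, h5]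
    _ ≤ _ := mul_le_mul_of_nonneg_left h6 h1s.le

end hedge

lemma regret_fin_one {T : ℕ} (f : Adversary 1 T) (a : Fin T → Fin 1) : regret f a = 0 := by
  rw [regret, ciSup_unique, sub_eq_zero]
  exact Finset.sum_congr rfl fun t _ => congrArg _ (Subsingleton.elim _ _)

lemma hasRegretBound_fin_one {F : Type} [MeasurableSpace F] (obs : (Fin 1 → ℝ) → Fin 1 → F)
    (alg : Strategy 1 F) {T : ℕ} {lo hi δ R : ℝ} (hlh : lo ≤ hi) (hδ : 0 ≤ δ) (hR : 0 ≤ R) :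
    HasRegretBound obs alg T lo hi δ R := by
  classical
  refine (hasRegretBound_iff obs alg hlh).2 fun f _ => ?_
  refine (Finset.sum_nonpos fun a _ => ?_).trans hδ
  rw [regret_fin_one, if_neg (not_lt.2 (mul_nonneg (sub_nonneg.2 hlh) hR))]

/-- The regret bound of Hedge: the expected regret is controlled by the weights and the deviation
of the actual losses by the Azuma–Hoeffding inequality. -/
lemma hedgeTuned_hasRegretBound {n T : ℕ} [NeZero n] {lo hi Q : ℝ} (hlh : lo < hi) (hQ : 0 < Q)
    (hn : Real.log n ≤ Q) (hQT : Q ≤ T) :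
    HasRegretBound fullFeedback (hedgeTuned n T lo hi) T lo hi (Real.exp (-Q))
      (5 * √(T * Q)) := by
  classical
  have hn1 : 1 ≤ n := Nat.one_le_iff_ne_zero.2 (NeZero.ne n)
  rcases hn1.eq_or_lt with rfl | hn2
  · exact hasRegretBound_fin_one _ _ hlh.le (Real.exp_pos _).le (by positivity)
  have hT : (0 : ℝ) < T := hQ.trans_le hQT
  have hlog : 0 < Real.log n := Real.log_pos (by exact_mod_cast hn2)
  refine (hasRegretBound_iff _ _ hlh.le).2 fun f hf => ?_
  set s := √(2 * Real.log n / T) with hs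
  have hs0 : 0 < s := Real.sqrt_pos.2 (by positivity)
  have hs2 : s ^ 2 = 2 * Real.log n / T := Real.sq_sqrt (by positivity)
  set u := √(2 * Q / T) with hu
  have hu0 : 0 < u := Real.sqrt_pos.2 (by positivity)
  have hu2 : u ^ 2 = 2 * Q / T := Real.sq_sqrt (by positivity)
  have hsu : s ≤ u := Real.sqrt_le_sqrt (by gcongr)
  set S := √(T * Q) with hS
  have hS0 : 0 < S := Real.sqrt_pos.2 (by positivity)
  have hS2 : S ^ 2 = T * Q := Real.sq_sqrt (by positivity)
  -- `u * T = √2 * S`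
  have huT : u * T ≤ 3 / 2 * S := by
    refine abs_le_of_sq_le_sq' ?_ (by positivity) |>.2
    rw [mul_pow, mul_pow, hu2, hS2]
    have : 2 * Q / T * (T : ℝ) ^ 2 = 2 * (T * Q) := by field_simp
    rw [this]
    nlinarith [mul_pos hT hQ]
  have hQS : Q ≤ S := by
    refine abs_le_of_sq_le_sq' ?_ hS0.le |>.2
    rw [hS2]; nlinarith
  set P := onlineProb fullFeedback (hedgeTuned n T lo hi) f with hP
  set ℓ : (t : ℕ) → (Fin t → Fin n) → Fin n → ℝ := fun t h j => (hi - f t h j) / (hi - lo) with hℓ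
  have hℓ01 : ∀ t h j, ℓ t h j ∈ Set.Icc (0 : ℝ) 1 := fun t h j =>
    ⟨div_nonneg (by linarith [(hf t h j).2]) (by linarith),
      (div_le_one (by linarith)).2 (by linarith [(hf t h j).1])⟩
  have htail := sum_chainProd_exp_tail (w := P) (onlineProb_nonneg _ _ _)
    (fun t h x => u * (ℓ t h x - ∑ j, P t h j * ℓ t h j) - u ^ 2 / 2) T
    (fun t _ h => sum_mul_exp_centered_le_one (onlineProb_nonneg _ _ _ _ _)
      (sum_onlineProb _ _ _ _ _) (hℓ01 t h) u) Q
  refine le_trans (Finset.sum_le_sum fun a _ => ?_) htail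
  have h0 := chainProd_nonneg (onlineProb_nonneg fullFeedback (hedgeTuned n T lo hi) f) a
  by_cases hz : Q < ∑ t : Fin T, (u * (ℓ t (past a t) (a t) -
      ∑ j, P t (past a t) j * ℓ t (past a t) j) - u ^ 2 / 2)
  · rw [if_pos hz]
    split_ifs
    exacts [le_rfl, h0]
  rw [if_neg hz, if_neg]
  rw [not_lt] at hz ⊢
  set Λ := ∑ t : Fin T, ∑ j, P t (past a t) j * ℓ t (past a t) j with hΛ
  set LA := ∑ t : Fin T, ℓ t (past a t) (a t) with hLA
  have hdev : LA ≤ Λ + u * T := by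
    rw [Finset.sum_sub_distrib, ← Finset.mul_sum, Finset.sum_sub_distrib, Finset.sum_const,
      Finset.card_univ, Fintype.card_fin, nsmul_eq_mul] at hz
    have : Q = u ^ 2 / 2 * T := by rw [hu2]; field_simp
    have h' : u * (LA - Λ) ≤ u * (u * T) := by nlinarith
    linarith [le_of_mul_le_mul_left h' hu0]
  have hΛb : ∀ b, Λ ≤ ∑ t : Fin T, ℓ t (past a t) b + 7 / 2 * S := by
    intro b
    have h := hedge_expected_loss_le hs0.le (by positivity) hlh hf T a b
    have hLb : ∑ t : Fin T, ℓ t (past a t) b ≤ T := by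
      calc _ ≤ ∑ t : Fin T, (1 : ℝ) := Finset.sum_le_sum fun t _ => (hℓ01 _ _ _).2
        _ = T := by simp
    change s * Λ ≤ (1 + s) * (Real.log n + s * ∑ t : Fin T, ℓ t (past a t) b) at h
    set Lb := ∑ t : Fin T, ℓ t (past a t) b
    have h1 : Real.log n = s * (s * T / 2) := by
      rw [← mul_div_assoc, ← mul_assoc, ← sq, hs2]; field_simp
    have h2 : s * Λ ≤ s * (Lb + (s * T / 2 + s * T + Real.log n)) := by
      have : s * (s * Lb) ≤ s * (s * T) := by gcongr
      calc _ ≤ _ := h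
        _ = Real.log n + s * Real.log n + s * Lb + s * (s * Lb) := by ring
        _ ≤ s * (s * T / 2) + s * Real.log n + s * Lb + s * (s * T) := by linarith
        _ = _ := by ring
    have h3 := le_of_mul_le_mul_left h2 hs0
    have h4 : s * T ≤ u * T := by gcongr
    linarith
  rw [regret, sub_le_iff_le_add]
  refine ciSup_le fun b => ?_
  have h1 : ∀ x : Fin T → Fin n, ∑ t : Fin T, f t (past a t) (x t) =
      T * hi - (hi - lo) * ∑ t : Fin T, ℓ t (past a t) (x t) := by
    intro x
    rw [Finset.mul_sum]
    have : ∀ t : Fin T, (hi - lo) * ℓ t (past a t) (x t) = hi - f t (past a t) (x t) := fun t =>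
      mul_div_cancel₀ _ (by linarith)
    simp only [this, Finset.sum_sub_distrib, Finset.sum_const, Finset.card_univ, Fintype.card_fin,
      nsmul_eq_mul]
    ring
  have h2 := h1 fun _ => b
  rw [h2, h1 a]
  have h3 : LA ≤ ∑ t : Fin T, ℓ t (past a t) b + 5 * S := by linarith [hΛb b]
  nlinarith [mul_le_mul_of_nonneg_left h3 (sub_nonneg.2 hlh.le)]

/-! ### The regret of EXP3.P -/

section mixProb

variable {K : ℕ} {γ : ℝ} {w : Fin K → ℝ}

lemma div_le_mixProb (hw : ∀ j, 0 < w j) (hγ1 : γ ≤ 1) (j : Fin K) :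
    γ / K ≤ mixProb γ w j := by
  have : 0 ≤ (1 - γ) * (w j / ∑ k, w k) :=
    mul_nonneg (by linarith) (div_nonneg (hw j).le (Finset.sum_nonneg fun k _ => (hw k).le))
  rw [mixProb]
  linarith

lemma mixProb_pos [NeZero K] (hw : ∀ j, 0 < w j) (hγ : 0 < γ) (hγ1 : γ ≤ 1) (j : Fin K) :
    0 < mixProb γ w j :=
  (div_pos hγ (Nat.cast_pos.2 (Nat.pos_of_ne_zero (NeZero.ne K)))).trans_le
    (div_le_mixProb hw hγ1 j)

lemma mul_div_sum_le_mixProb (hγ : 0 ≤ γ) (j : Fin K) :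
    (1 - γ) * (w j / ∑ k, w k) ≤ mixProb γ w j := by
  have : 0 ≤ γ / (K : ℝ) := by positivity
  rw [mixProb]
  linarith

end mixProb

/-- The optimistic payoff estimate of EXP3.P for arm `j` when arm `x` is played, has payoff `v` and
the arms are drawn from `p`: the importance-weighted payoff plus a confidence term. -/
def optEstimate {K : ℕ} (p : Fin K → ℝ) (b : ℝ) (x : Fin K) (v : ℝ) (j : Fin K) : ℝ :=
  (if x = j then v / p j else 0) + b / p j

/-- Growth of the total weight in one round of EXP3.P. -/
lemma sum_mul_exp_optEstimate_le {K : ℕ} [NeZero K] {γ b v : ℝ} {w : Fin K → ℝ}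
    (hw : ∀ j, 0 < w j) (hγ : 0 < γ) (hγ1 : γ ≤ 3 / 5) (hb : 0 ≤ b) (hb1 : b ≤ 1) (hv : 0 ≤ v)
    (hv1 : v ≤ 1) (x : Fin K) :
    ∑ j, w j * Real.exp (γ / (3 * K) * optEstimate (mixProb γ w) b x v j) ≤
      (∑ j, w j) * Real.exp (γ / (3 * K) / (1 - γ) * (v + K * b +
        2 * (γ / (3 * K)) * (v / mixProb γ w x + b ^ 2 * K ^ 2 / γ))) := by
  have hK : (0 : ℝ) < K := Nat.cast_pos.2 (Nat.pos_of_ne_zero (NeZero.ne K))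
  set p := mixProb γ w with hp
  have hp0 : ∀ j, 0 < p j := mixProb_pos hw hγ (by linarith)
  have hpγ : ∀ j, 1 / p j ≤ K / γ := fun j => by
    rw [div_le_div_iff₀ (hp0 j) hγ]
    have := (div_le_iff₀ hK).1 (div_le_mixProb (γ := γ) hw (by linarith) j)
    linarith
  set η := γ / (3 * K) with hη
  have hη0 : 0 < η := by positivity
  have hηp : ∀ j, η * (1 / p j) ≤ 1 / 3 := fun j => by
    calc η * (1 / p j) ≤ η * (K / γ) := mul_le_mul_of_nonneg_left (hpγ j) hη0.le
      _ = 1 / 3 := by rw [hη]; field_simp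
  set W := ∑ j, w j with hW
  have hW0 : 0 < W := Finset.sum_pos (fun j _ => hw j) Finset.univ_nonempty
  have h1γ : 0 < 1 - γ := by linarith
  set g : Fin K → ℝ := fun j => if x = j then v / p j else 0 with hg
  have hg0 : ∀ j, 0 ≤ g j := fun j => by
    simp only [hg]; split_ifs
    exacts [div_nonneg hv (hp0 j).le, le_rfl]
  have hg1 : ∀ j, g j ≤ 1 / p j := fun j => by
    simp only [hg]; split_ifs
    exacts [div_le_div_of_nonneg_right hv1 (hp0 j).le, (one_div_pos.2 (hp0 j)).le]
  have hb' : ∀ j, b / p j ≤ 1 / p j := fun j => div_le_div_of_nonneg_right hb1 (hp0 j).le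
  have hb0 : ∀ j, 0 ≤ b / p j := fun j => div_nonneg hb (hp0 j).le
  have hstep : ∀ j, Real.exp (η * (g j + b / p j)) ≤
      1 + η * (g j + b / p j + 2 * η * (g j ^ 2 + (b / p j) ^ 2)) := by
    intro j
    have h1 : η * (g j + b / p j) ≤ 1 := by
      have h2 : η * g j ≤ η * (1 / p j) := mul_le_mul_of_nonneg_left (hg1 j) hη0.le
      have h3 : η * (b / p j) ≤ η * (1 / p j) := mul_le_mul_of_nonneg_left (hb' j) hη0.le
      linarith [hηp j]
    refine (exp_le_one_add_sq h1).trans ?_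
    nlinarith [mul_nonneg (sq_nonneg η) (sq_nonneg (g j - b / p j))]
  set z : Fin K → ℝ := fun j => η * (g j + b / p j + 2 * η * (g j ^ 2 + (b / p j) ^ 2)) with hz
  have hz0 : ∀ j, 0 ≤ z j := fun j => by
    have := hg0 j; have := hb0 j; positivity
  have hpz : ∑ j, p j * z j ≤ η * (v + K * b + 2 * η * (v / p x + b ^ 2 * K ^ 2 / γ)) := by
    have e1 : ∑ j, p j * g j = v := by
      simp only [hg, mul_ite, mul_zero, Finset.sum_ite_eq, Finset.mem_univ, if_true]
      exact mul_div_cancel₀ _ (hp0 x).ne'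
    have e2 : ∑ j, p j * (b / p j) = K * b := by
      simp only [mul_div_cancel₀ _ (hp0 _).ne', Finset.sum_const, Finset.card_univ,
        Fintype.card_fin, nsmul_eq_mul]
    have e3 : ∑ j, p j * g j ^ 2 ≤ v / p x := by
      have : ∀ j, p j * g j ^ 2 = if x = j then v ^ 2 / p j else 0 := fun j => by
        simp only [hg]
        split_ifs
        · have := (hp0 j).ne'
          field_simp
        · simp
      simp only [this, Finset.sum_ite_eq, Finset.mem_univ, if_true]
      exact div_le_div_of_nonneg_right (by nlinarith) (hp0 x).le
    have e4 : ∑ j, p j * (b / p j) ^ 2 ≤ b ^ 2 * K ^ 2 / γ := by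
      calc ∑ j, p j * (b / p j) ^ 2 = ∑ j, b ^ 2 * (1 / p j) :=
            Finset.sum_congr rfl fun j _ => by
              have := (hp0 j).ne'
              field_simp
        _ ≤ ∑ _j : Fin K, b ^ 2 * (K / γ) :=
            Finset.sum_le_sum fun j _ => mul_le_mul_of_nonneg_left (hpγ j) (sq_nonneg b)
        _ = _ := by
            simp only [Finset.sum_const, Finset.card_univ, Fintype.card_fin, nsmul_eq_mul]
            ring
    calc ∑ j, p j * z j = η * (∑ j, p j * g j + ∑ j, p j * (b / p j) +
          2 * η * (∑ j, p j * g j ^ 2 + ∑ j, p j * (b / p j) ^ 2)) := by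
          simp only [mul_add, Finset.mul_sum, ← Finset.sum_add_distrib]
          exact Finset.sum_congr rfl fun j _ => by simp only [hz]; ring
      _ ≤ _ := by rw [e1, e2]; gcongr
  have hwp : ∀ j, w j ≤ W / (1 - γ) * p j := fun j => by
    have := mul_div_sum_le_mixProb (w := w) hγ.le j
    rw [← hp, ← hW, mul_div_assoc', div_le_iff₀ hW0] at this
    rw [div_mul_eq_mul_div, le_div_iff₀ h1γ]
    linarith
  calc _ ≤ ∑ j, w j * (1 + z j) :=
        Finset.sum_le_sum fun j _ => mul_le_mul_of_nonneg_left (hstep j) (hw j).le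
    _ = W + ∑ j, w j * z j := by simp only [mul_add, mul_one, Finset.sum_add_distrib, hW]
    _ ≤ W + ∑ j, W / (1 - γ) * p j * z j := by
        gcongr with j
        exacts [hz0 j, hwp j]
    _ = W * (1 + (∑ j, p j * z j) / (1 - γ)) := by
        simp only [mul_assoc, ← Finset.mul_sum]; ring
    _ ≤ W * (1 + η * (v + K * b + 2 * η * (v / p x + b ^ 2 * K ^ 2 / γ)) / (1 - γ)) := by
        gcongr
    _ ≤ _ := by
        refine mul_le_mul_of_nonneg_left ?_ hW0.le
        rw [add_comm]
        refine (Real.add_one_le_exp _).trans (le_of_eq ?_)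
        congr 1
        ring

/-- For each arm, the sum of the optimistic estimates is unlikely to be much smaller than the sum
of the payoffs. -/
lemma sum_mul_exp_underestimate_le_one {A : Type} [Fintype A] [DecidableEq A] {p v : A → ℝ}
    (hp : ∀ x, 0 < p x) (hp1 : ∑ x, p x = 1) {j : A} (hv : 0 ≤ v j) (hv1 : v j ≤ 1) {b : ℝ}
    (hb : 0 ≤ b) (hb1 : b ≤ 1) :
    ∑ x, p x * Real.exp (b * (v j - ((if x = j then v x / p j else 0) + b / p j))) ≤ 1 := by
  have hpj := hp j
  have h1 : ∀ x, p x * Real.exp (b * (v j - ((if x = j then v x / p j else 0) + b / p j))) ≤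
      p x * (1 + b * (v j - (if x = j then v j / p j else 0)) +
        b ^ 2 * (v j - (if x = j then v j / p j else 0)) ^ 2) * Real.exp (-(b ^ 2 / p j)) := by
    intro x
    have e : (if x = j then v x / p j else 0) = if x = j then v j / p j else 0 := by
      split_ifs with h
      exacts [by rw [h], rfl]
    have h0 : 0 ≤ if x = j then v j / p j else 0 := by
      split_ifs
      exacts [div_nonneg hv hpj.le, le_rfl]
    rw [e, mul_assoc]
    refine mul_le_mul_of_nonneg_left ?_ (hp x).le
    rw [show b * (v j - ((if x = j then v j / p j else 0) + b / p j)) =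
      b * (v j - (if x = j then v j / p j else 0)) + -(b ^ 2 / p j) by ring, Real.exp_add]
    refine mul_le_mul_of_nonneg_right ?_ (Real.exp_pos _).le
    rw [← mul_pow]
    exact exp_le_one_add_sq (by nlinarith)
  have e1 : ∑ x, p x * (if x = j then v j / p j else 0) = v j := by
    simp only [mul_ite, mul_zero, Finset.sum_ite_eq', Finset.mem_univ, if_true]
    exact mul_div_cancel₀ _ hpj.ne'
  have e2 : ∑ x, p x * (if x = j then v j / p j else 0) ^ 2 = v j ^ 2 / p j := by
    simp only [ite_pow, mul_ite, mul_zero, ne_eq, OfNat.ofNat_ne_zero, not_false_eq_true, zero_pow,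
      Finset.sum_ite_eq', Finset.mem_univ, if_true]
    field_simp
  refine (Finset.sum_le_sum fun x _ => h1 x).trans ?_
  rw [← Finset.sum_mul]
  have h2 : ∑ x, p x * (1 + b * (v j - (if x = j then v j / p j else 0)) +
        b ^ 2 * (v j - (if x = j then v j / p j else 0)) ^ 2) ≤ Real.exp (b ^ 2 / p j) := by
    calc _ = (∑ x, p x) * (1 + b * v j + b ^ 2 * v j ^ 2) -
          (b + 2 * b ^ 2 * v j) * ∑ x, p x * (if x = j then v j / p j else 0) +
          b ^ 2 * ∑ x, p x * (if x = j then v j / p j else 0) ^ 2 := by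
          simp only [Finset.sum_mul, Finset.mul_sum, ← Finset.sum_add_distrib,
            ← Finset.sum_sub_distrib]
          exact Finset.sum_congr rfl fun x _ => by ring
      _ = 1 + b ^ 2 * (v j ^ 2 / p j) - b ^ 2 * v j ^ 2 := by rw [hp1, e1, e2]; ring
      _ ≤ 1 + b ^ 2 * (1 / p j) := by
          have : b ^ 2 * (v j ^ 2 / p j) ≤ b ^ 2 * (1 / p j) := by
            gcongr
            nlinarith
          nlinarith [sq_nonneg (b * v j)]
      _ ≤ _ := by
          have := Real.add_one_le_exp (b ^ 2 / p j)
          rw [mul_one_div]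
          linarith
  calc _ ≤ Real.exp (b ^ 2 / p j) * Real.exp (-(b ^ 2 / p j)) :=
        mul_le_mul_of_nonneg_right h2 (Real.exp_pos _).le
    _ = 1 := by rw [← Real.exp_add]; simp

section exp3p

variable {K : ℕ} (T₀ : ℕ) (lo hi α γ : ℝ) (f : Payoffs K)

lemma exp3pWeight_append {t : ℕ} (a : Fin t → Fin K) (x j : Fin K) :
    exp3pWeight K T₀ lo hi α γ (t + 1) (record banditFeedback f (append a x)) j =
      exp3pWeight K T₀ lo hi α γ t (record banditFeedback f a) j * Real.exp (γ / (3 * K) *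
        optEstimate (mixProb γ (exp3pWeight K T₀ lo hi α γ t (record banditFeedback f a)))
          (α / √(K * T₀)) x ((f t a x - lo) / (hi - lo)) j) := by
  rw [exp3pWeight, init_record_append, record_append_last, optEstimate, div_div α, mul_comm (√_)]
  rfl

/-- The estimate that EXP3.P adds in round `t` for arm `j` if it plays arm `x`. -/
def roundEstimate (t : ℕ) (a : Fin t → Fin K) (x j : Fin K) : ℝ :=
  optEstimate (mixProb γ (exp3pWeight K T₀ lo hi α γ t (record banditFeedback f a)))
    (α / √(K * T₀)) x ((f t a x - lo) / (hi - lo)) j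

lemma exp3pWeight_eq (T : ℕ) (a : Fin T → Fin K) (j : Fin K) :
    exp3pWeight K T₀ lo hi α γ T (record banditFeedback f a) j =
      Real.exp (α * γ / 3 * √(T₀ / K)) * Real.exp (γ / (3 * K) *
        ∑ t : Fin T, roundEstimate T₀ lo hi α γ f t (past a t) (a t) j) := by
  induction T with
  | zero => simp [exp3pWeight]
  | succ T ih =>
    obtain ⟨a, x, rfl⟩ : ∃ a' x, a = append a' x :=
      ⟨Fin.init a, a (Fin.last T), (Fin.snoc_init_self a).symm⟩
    simp only [exp3pWeight_append, Fin.sum_univ_castSucc, past_append_castSucc, past_append_last,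
      append_castSucc, append_last, Fin.val_castSucc, Fin.val_last, ih]
    rw [mul_assoc, ← Real.exp_add, mul_add]
    rfl

variable {T₀ lo hi α γ f}

/-- The total weight of EXP3.P along a sequence of actions. -/
lemma sum_exp3pWeight_le [NeZero K] (hlh : lo < hi) (hf : ∀ t h a, f t h a ∈ Set.Icc lo hi)
    (hγ : 0 < γ) (hγ1 : γ ≤ 3 / 5) (hb : 0 ≤ α / √(K * T₀)) (hb1 : α / √(K * T₀) ≤ 1) (T : ℕ)
    (a : Fin T → Fin K) :
    ∑ j, exp3pWeight K T₀ lo hi α γ T (record banditFeedback f a) j ≤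
      K * Real.exp (α * γ / 3 * √(T₀ / K)) * Real.exp (γ / (3 * K) / (1 - γ) *
        ∑ t : Fin T, ((f t (past a t) (a t) - lo) / (hi - lo) + K * (α / √(K * T₀)) +
          2 * (γ / (3 * K)) * (((f t (past a t) (a t) - lo) / (hi - lo)) /
            mixProb γ (exp3pWeight K T₀ lo hi α γ t (record banditFeedback f (past a t))) (a t) +
            (α / √(K * T₀)) ^ 2 * K ^ 2 / γ))) := by
  induction T with
  | zero => simp [exp3pWeight]
  | succ T ih =>
    obtain ⟨a, x, rfl⟩ : ∃ a' x, a = append a' x :=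
      ⟨Fin.init a, a (Fin.last T), (Fin.snoc_init_self a).symm⟩
    have hw := fun j => exp3pWeight_pos K T₀ lo hi α γ T (record banditFeedback f a) j
    have h1 : 0 ≤ (f T a x - lo) / (hi - lo) :=
      div_nonneg (by linarith [(hf T a x).1]) (by linarith)
    have h2 : (f T a x - lo) / (hi - lo) ≤ 1 :=
      (div_le_one (by linarith)).2 (by linarith [(hf T a x).2])
    simp only [exp3pWeight_append, Fin.sum_univ_castSucc, past_append_castSucc, past_append_last,
      append_castSucc, append_last, Fin.val_castSucc, Fin.val_last]
    refine (sum_mul_exp_optEstimate_le hw hγ hγ1 hb hb1 h1 h2 x).trans ?_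
    refine (mul_le_mul_of_nonneg_right (ih a) (Real.exp_pos _).le).trans (le_of_eq ?_)
    rw [mul_assoc, ← Real.exp_add, ← mul_add]

end exp3p

/-- The regret of EXP3.P is small along every sequence of actions for which the optimistic
estimates do not underestimate the total payoffs by much. -/
lemma exp3p_regret_le {K T : ℕ} [NeZero K] {lo hi α γ : ℝ} {f : Payoffs K} (hlh : lo < hi)
    (hf : ∀ t h a, f t h a ∈ Set.Icc lo hi) (hγ : 0 < γ) (hγ1 : γ ≤ 3 / 5)
    (hb : 0 < α / √(K * T)) (hb1 : α / √(K * T) ≤ 1) {D : ℝ} (hD : 0 ≤ D) (a : Fin T → Fin K)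
    (hunder : ∀ j, ∑ t : Fin T, (f t (past a t) j - lo) / (hi - lo) ≤
      ∑ t : Fin T, roundEstimate T lo hi α γ f t (past a t) (a t) j + D) (j : Fin K) :
    ∑ t : Fin T, (f t (past a t) j - lo) / (hi - lo) -
        ∑ t : Fin T, (f t (past a t) (a t) - lo) / (hi - lo) ≤
      5 / 3 * (γ * T) + 3 * (K * Real.log K) / γ + 5 / 3 * (K * (α / √(K * T)) * T) + D := by
  have hK : (0 : ℝ) < K := Nat.cast_pos.2 (Nat.pos_of_ne_zero (NeZero.ne K))
  have hK1 : (1 : ℝ) ≤ K := Nat.one_le_cast.2 (Nat.pos_of_ne_zero (NeZero.ne K))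
  set b := α / √(K * T) with hbdef
  set v : (t : Fin T) → Fin K → ℝ := fun t j => (f t (past a t) j - lo) / (hi - lo) with hv
  have hv0 : ∀ t j, 0 ≤ v t j := fun t j =>
    div_nonneg (by linarith [(hf t (past a t) j).1]) (by linarith)
  have hv1 : ∀ t j, v t j ≤ 1 := fun t j =>
    (div_le_one (by linarith)).2 (by linarith [(hf t (past a t) j).2])
  set p : (t : Fin T) → Fin K → ℝ := fun t =>
    mixProb γ (exp3pWeight K T lo hi α γ t (record banditFeedback f (past a t))) with hp
  have hp0 : ∀ t j, 0 < p t j := fun t j =>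
    mixProb_pos (fun j => exp3pWeight_pos K T lo hi α γ _ _ j) hγ (by linarith) j
  set e : (t : Fin T) → Fin K → ℝ := fun t j => roundEstimate T lo hi α γ f t (past a t) (a t) j
    with he
  have he' : ∀ t j, e t j = (if a t = j then v t (a t) / p t j else 0) + b / p t j :=
    fun t j => rfl
  have he0 : ∀ t j, 0 ≤ e t j := fun t j => by
    rw [he']
    have h1 := hp0 t j
    have h2 := hv0 t (a t)
    split_ifs <;> positivity
  set U : Fin K → ℝ := fun j => ∑ t, e t j with hU
  obtain ⟨m, hm⟩ := Finite.exists_max U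
  set G := ∑ t, v t (a t) with hG
  set V := ∑ t, v t (a t) / p t (a t) with hV
  have hVU : V ≤ K * U m := by
    calc V ≤ ∑ t, ∑ j, e t j := by
          refine Finset.sum_le_sum fun t _ => ?_
          refine le_trans ?_ (Finset.single_le_sum (fun j _ => he0 t j) (Finset.mem_univ (a t)))
          rw [he', if_pos rfl]
          exact le_add_of_nonneg_right (div_nonneg hb.le (hp0 t (a t)).le)
      _ = ∑ j, U j := Finset.sum_comm
      _ ≤ ∑ _j : Fin K, U m := Finset.sum_le_sum fun j _ => hm j
      _ = K * U m := by simp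
  have hU0 : 0 ≤ U m := Finset.sum_nonneg fun t _ => he0 t m
  set η := γ / (3 * K) with hη
  have hη0 : 0 < η := by positivity
  have h1γ : 0 < 1 - γ := by linarith
  have hlogK : 0 ≤ Real.log K := Real.log_nonneg hK1
  have h1 : η * U m ≤ Real.log K + η / (1 - γ) *
      (G + T * (K * b) + 2 * η * (V + T * (b ^ 2 * K ^ 2 / γ))) := by
    have h2 := sum_exp3pWeight_le hlh hf hγ hγ1 hb.le hb1 T a
    have h3 := (Finset.single_le_sum (f := fun j =>
      exp3pWeight K T lo hi α γ T (record banditFeedback f a) j)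
      (fun j _ => (exp3pWeight_pos K T lo hi α γ T _ j).le) (Finset.mem_univ m)).trans h2
    rw [exp3pWeight_eq, mul_comm (K : ℝ) (Real.exp _), mul_assoc (Real.exp _)] at h3
    have h4 := Real.log_le_log (Real.exp_pos _) (le_of_mul_le_mul_left h3 (Real.exp_pos _))
    rw [Real.log_exp, Real.log_mul hK.ne' (Real.exp_pos _).ne', Real.log_exp] at h4
    refine h4.trans (le_of_eq ?_)
    congr 2
    simp only [Finset.sum_add_distrib, ← Finset.mul_sum, Finset.sum_const, Finset.card_univ,
      Fintype.card_fin, nsmul_eq_mul]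
    rw [mul_left_comm (K : ℝ) (T : ℝ)]
  have h2 : (1 - γ) * U m ≤ 3 * (K * Real.log K) / γ +
      (G + T * (K * b) + 2 * η * (V + T * (b ^ 2 * K ^ 2 / γ))) := by
    set Z := G + T * (K * b) + 2 * η * (V + T * (b ^ 2 * K ^ 2 / γ))
    have h3 := mul_le_mul_of_nonneg_left h1 (div_pos h1γ hη0).le
    have e1 : (1 - γ) / η * (η * U m) = (1 - γ) * U m := by field_simp
    have e2 : (1 - γ) / η * (Real.log K + η / (1 - γ) * Z) = (1 - γ) / η * Real.log K + Z := by
      field_simp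
    have e3 : (1 - γ) / η * Real.log K ≤ 3 * (K * Real.log K) / γ := by
      calc (1 - γ) / η * Real.log K ≤ 1 / η * Real.log K := by gcongr; linarith
        _ = 3 * (K * Real.log K) / γ := by rw [hη]; field_simp
    linarith
  have h3 : 2 * η * V ≤ 2 / 3 * γ * U m := by
    calc 2 * η * V ≤ 2 * η * (K * U m) := by gcongr
      _ = 2 / 3 * γ * U m := by rw [hη]; field_simp
  have h4 : 2 * η * (T * (b ^ 2 * K ^ 2 / γ)) ≤ 2 / 3 * (K * b * T) := by
    calc 2 * η * (T * (b ^ 2 * K ^ 2 / γ)) = 2 / 3 * (K * b * T) * b := by rw [hη]; field_simp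
      _ ≤ _ := mul_le_of_le_one_right (by positivity) hb1
  have h5 : ∑ t, v t j ≤ U m + D := (hunder j).trans (by linarith [hm j])
  have h6 : ∑ t, v t j ≤ T := by
    calc _ ≤ ∑ _t : Fin T, (1 : ℝ) := Finset.sum_le_sum fun t _ => hv1 t j
      _ = T := by simp
  have h7 : (1 - 5 / 3 * γ) * ∑ t, v t j ≤ (1 - 5 / 3 * γ) * (U m + D) :=
    mul_le_mul_of_nonneg_left h5 (by linarith)
  have h8 : γ * ∑ t, v t j ≤ γ * T := mul_le_mul_of_nonneg_left h6 hγ.le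
  have h9 : 0 ≤ γ * D := by positivity
  change ∑ t, v t j - G ≤ _
  nlinarith

open Classical in
/-- The regret bound of EXP3.P. The confidence terms make the estimates optimistic with a failure
probability that is small even after a union bound over the arms. -/
lemma exp3pTuned_hasRegretBound {K T : ℕ} [NeZero K] {δ lo hi : ℝ} (hδ : 0 < δ) (hδ1 : δ < 1)
    (hT : 0 < T) (hKT : 8 * (K * Real.log (K * T / δ)) ≤ T) (hlh : lo < hi) :
    HasRegretBound banditFeedback (exp3pTuned K T δ lo hi) T lo hi ((δ / T) ^ 2)
      (10 * √(K * T * Real.log (K * T / δ))) := by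
  have hK1 : 1 ≤ K := Nat.one_le_iff_ne_zero.2 (NeZero.ne K)
  rcases hK1.eq_or_lt with rfl | hK2
  · exact hasRegretBound_fin_one _ _ hlh.le (by positivity) (by positivity)
  have hK : (0 : ℝ) < K := Nat.cast_pos.2 hK1
  have hK1' : (1 : ℝ) ≤ K := Nat.one_le_cast.2 hK1
  have hT0 : (0 : ℝ) < T := Nat.cast_pos.2 hT
  have hT1 : (1 : ℝ) ≤ T := Nat.one_le_cast.2 hT
  set Q := Real.log (K * T / δ) with hQ
  have hlogK : 0 < Real.log K := Real.log_pos (by exact_mod_cast hK2)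
  have hlogQ : Real.log K ≤ Q := by
    refine Real.log_le_log hK ?_
    rw [le_div_iff₀ hδ]
    nlinarith
  have hQ0 : 0 < Q := hlogK.trans_le hlogQ
  set S := √(K * T * Q) with hS
  have hS0 : 0 < S := Real.sqrt_pos.2 (by positivity)
  have hS2 : S ^ 2 = K * T * Q := Real.sq_sqrt (by positivity)
  set γ := exp3pGamma K T with hγdef
  have hγeq : γ = 2 * √(3 / 5 * (K * Real.log K / T)) := by
    refine min_eq_right ?_
    have : √(3 / 5 * (K * Real.log K / T)) ≤ 3 / 10 := by
      refine Real.sqrt_le_iff.2 ⟨by norm_num, ?_⟩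
      have : K * Real.log K / T ≤ 1 / 8 := by
        rw [div_le_iff₀ hT0]
        nlinarith
      linarith
    linarith
  have hγ0 : 0 < γ := by rw [hγeq]; positivity
  have hγ1 : γ ≤ 3 / 5 := min_le_left _ _
  have hγ2 : γ ^ 2 = 12 / 5 * (K * Real.log K / T) := by
    rw [hγeq, mul_pow, Real.sq_sqrt (by positivity)]
    ring
  set α := 2 * √Q with hα
  set b := α / √(K * T) with hb
  have hKT0 : 0 < √(K * T : ℝ) := Real.sqrt_pos.2 (by positivity)
  have hKT2 : √(K * T : ℝ) ^ 2 = K * T := Real.sq_sqrt (by positivity)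
  have hQs0 : 0 < √Q := Real.sqrt_pos.2 hQ0
  have hQs2 : √Q ^ 2 = Q := Real.sq_sqrt hQ0.le
  have hSQ : S = √(K * T : ℝ) * √Q := Real.sqrt_mul (by positivity) _
  have hb0 : 0 < b := by positivity
  have hb1 : b ≤ 1 := by
    refine (div_le_one hKT0).2 (abs_le_of_sq_le_sq' ?_ hKT0.le).2
    rw [hα, mul_pow, hQs2, hKT2]
    nlinarith
  have hbS : K * b * T = 2 * S := by
    calc K * b * T = α * (K * T / √(K * T : ℝ)) := by rw [hb]; ring
      _ = α * √(K * T : ℝ) := by rw [Real.div_sqrt]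
      _ = _ := by rw [hSQ, hα]; ring
  have hDS : 2 * Q / b = S := by
    rw [hb, hα, hSQ, div_div_eq_mul_div, ← hQs2, Real.sqrt_sq hQs0.le]
    field_simp
  have hγT : γ * T ≤ 8 / 5 * S := by
    refine (abs_le_of_sq_le_sq' ?_ (by positivity)).2
    have e : γ ^ 2 * (T : ℝ) ^ 2 = 12 / 5 * (K * T * Real.log K) := by
      rw [hγ2]; field_simp
    have : K * T * Real.log K ≤ K * T * Q := mul_le_mul_of_nonneg_left hlogQ (by positivity)
    rw [mul_pow, mul_pow, e, hS2]
    nlinarith [mul_pos (mul_pos hK hT0) hQ0]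
  have hγK : 3 * (K * Real.log K) / γ = 5 / 4 * (γ * T) := by
    rw [div_eq_iff hγ0.ne']
    have : γ ^ 2 * T = 12 / 5 * (K * Real.log K) := by rw [hγ2]; field_simp
    linarith
  refine (hasRegretBound_iff _ _ hlh.le).2 fun f hf => ?_
  set P := onlineProb banditFeedback (exp3pTuned K T δ lo hi) f with hP
  have hPpos : ∀ t h x, 0 < P t h x := fun t h x =>
    mixProb_pos (fun j => exp3pWeight_pos K T lo hi α γ _ _ j) hγ0 (by linarith) x
  set v : (t : ℕ) → (Fin t → Fin K) → Fin K → ℝ := fun t h j => (f t h j - lo) / (hi - lo) with hv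
  have hv0 : ∀ t h j, 0 ≤ v t h j := fun t h j =>
    div_nonneg (by linarith [(hf t h j).1]) (by linarith)
  have hv1 : ∀ t h j, v t h j ≤ 1 := fun t h j =>
    (div_le_one (by linarith)).2 (by linarith [(hf t h j).2])
  set g : Fin K → (t : ℕ) → (Fin t → Fin K) → Fin K → ℝ := fun j t h x =>
    b * (v t h j - roundEstimate T lo hi α γ f t h x j) with hg
  have htail : ∀ j, ∑ a : Fin T → Fin K,
      (if 2 * Q < ∑ t : Fin T, g j t (past a t) (a t) then chainProd P a else 0) ≤
        Real.exp (-(2 * Q)) := fun j =>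
    sum_chainProd_exp_tail (fun t h x => (hPpos t h x).le) (g j) T (fun t _ h =>
      sum_mul_exp_underestimate_le_one (hPpos t h) (sum_onlineProb _ _ _ _ _) (hv0 t h j)
        (hv1 t h j) hb0.le hb1) (2 * Q)
  have hfail : ∑ _j : Fin K, Real.exp (-(2 * Q)) ≤ (δ / T) ^ 2 := by
    have e : Real.exp (-(2 * Q)) = (δ / (K * T)) ^ 2 := by
      rw [show -(2 * Q) = -Q + -Q by ring, Real.exp_add, Real.exp_neg, hQ,
        Real.exp_log (by positivity), inv_div, sq]
    rw [e, Finset.sum_const, Finset.card_univ, Fintype.card_fin, nsmul_eq_mul]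
    have : (K : ℝ) * (δ / (K * T)) ^ 2 = (δ / T) ^ 2 * (1 / K) := by field_simp
    rw [this]
    exact mul_le_of_le_one_right (by positivity) ((div_le_one hK).2 hK1')
  refine le_trans ?_ ((Finset.sum_le_sum fun j _ => htail j).trans hfail)
  rw [Finset.sum_comm]
  refine Finset.sum_le_sum fun a _ => ?_
  have h0 := chainProd_nonneg (fun t h x => (hPpos t h x).le) a
  have hnn : ∀ j, 0 ≤ if 2 * Q < ∑ t : Fin T, g j t (past a t) (a t) then chainProd P a else 0 :=
    fun j => by split_ifs; exacts [h0, le_rfl]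
  by_cases hbad : ∃ j, 2 * Q < ∑ t : Fin T, g j t (past a t) (a t)
  · obtain ⟨j, hj⟩ := hbad
    refine le_trans ?_ (Finset.single_le_sum (fun j _ => hnn j) (Finset.mem_univ j))
    rw [if_pos hj]
    split_ifs
    exacts [le_rfl, h0]
  push Not at hbad
  rw [if_neg]
  · exact Finset.sum_nonneg fun j _ => hnn j
  rw [not_lt, regret, sub_le_iff_le_add]
  refine ciSup_le fun j => ?_
  have hunder : ∀ j, ∑ t : Fin T, v t (past a t) j ≤
      ∑ t : Fin T, roundEstimate T lo hi α γ f t (past a t) (a t) j + S := by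
    intro j
    have h := hbad j
    rw [← Finset.mul_sum, ← le_div_iff₀' hb0, hDS, Finset.sum_sub_distrib] at h
    linarith
  have hreg := exp3p_regret_le hlh hf hγ0 hγ1 hb0 hb1 hS0.le a hunder j
  change ∑ t : Fin T, v t (past a t) j - ∑ t : Fin T, v t (past a t) (a t) ≤ _ at hreg
  have h1 : ∀ x : Fin T → Fin K, ∑ t : Fin T, f t (past a t) (x t) =
      T * lo + (hi - lo) * ∑ t : Fin T, v t (past a t) (x t) := by
    intro x
    rw [Finset.mul_sum]
    have : ∀ t : Fin T, (hi - lo) * v t (past a t) (x t) = f t (past a t) (x t) - lo := fun t =>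
      mul_div_cancel₀ _ (by linarith)
    simp only [this, Finset.sum_sub_distrib, Finset.sum_const, Finset.card_univ, Fintype.card_fin,
      nsmul_eq_mul]
    ring
  have h2 := h1 fun _ => j
  rw [h2, h1 a]
  have h3 : ∑ t : Fin T, v t (past a t) j - ∑ t : Fin T, v t (past a t) (a t) ≤ 10 * S := by
    rw [hγK, hbS] at hreg
    linarith
  nlinarith [mul_le_mul_of_nonneg_left h3 (sub_nonneg.2 hlh.le)]

/-! ### Sequential draws against an i.i.d. environment -/

section process

variable {Y Z : Type} [MeasurableSpace Y] [Fintype Z]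

/-- The integral of `Φ` over the outcomes `m` and the actions `z` of `n` rounds, where the outcomes
are drawn independently from `D` and `P t (past m t) (past z t)` are the probabilities of the
actions in round `t`. -/
def drawLIntegral (D : Measure Y)
    (P : (t : ℕ) → (Fin t → Y) → (Fin t → Z) → Z → ENNReal) (n : ℕ)
    (Φ : (Fin n → Y) → (Fin n → Z) → ENNReal) : ENNReal :=
  ∫⁻ m, ∑ z : Fin n → Z, (∏ t : Fin n, P t (past m t) (past z t) (z t)) * Φ m z
    ∂Measure.pi fun _ : Fin n => D

variable {D : Measure Y} {P : (t : ℕ) → (Fin t → Y) → (Fin t → Z) → Z → ENNReal}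

lemma measurable_past {X : Type} [MeasurableSpace X] {n : ℕ} (t : Fin n) :
    Measurable fun m : Fin n → X => past m t :=
  measurable_pi_lambda _ fun _ => measurable_pi_apply _

lemma measurable_append {X : Type} [MeasurableSpace X] {n : ℕ} :
    Measurable fun p : X × (Fin n → X) => append p.2 p.1 := by
  refine measurable_pi_lambda _ fun t => ?_
  refine Fin.lastCases ?_ (fun t => ?_) t
  · simpa using measurable_fst
  · simp only [append_castSucc]
    exact (measurable_pi_apply t).comp measurable_snd

omit [Fintype Z] in
lemma measurable_prod_prob (hP : ∀ t z y, Measurable fun m => P t m z y) {n : ℕ}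
    (z : Fin n → Z) :
    Measurable fun m : Fin n → Y => ∏ t : Fin n, P t (past m t) (past z t) (z t) :=
  Finset.measurable_prod _ fun t _ => (hP _ _ _).comp (measurable_past t)

lemma lintegral_pi_succ [IsProbabilityMeasure D] {n : ℕ} {f : (Fin (n + 1) → Y) → ENNReal}
    (hf : Measurable f) :
    ∫⁻ m, f m ∂Measure.pi (fun _ : Fin (n + 1) => D) =
      ∫⁻ m, ∫⁻ x, f (append m x) ∂D ∂Measure.pi (fun _ : Fin n => D) := by
  have h := measurePreserving_piFinSuccAbove (fun _ : Fin (n + 1) => D) (Fin.last n)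
  rw [← h.symm.lintegral_comp hf, lintegral_prod_symm]
  · simp only [MeasurableEquiv.piFinSuccAbove, Fin.insertNthEquiv]
    refine lintegral_congr fun m => lintegral_congr fun x => congrArg f ?_
    exact Fin.insertNth_last' x m
  · exact (hf.comp h.symm.measurable).aemeasurable

/-- Integrate out the last round. -/
lemma drawLIntegral_succ [IsProbabilityMeasure D] (hP : ∀ t z y, Measurable fun m => P t m z y)
    {n : ℕ} {Φ : (Fin (n + 1) → Y) → (Fin (n + 1) → Z) → ENNReal}
    (hΦ : ∀ z, Measurable fun m => Φ m z) :
    drawLIntegral D P (n + 1) Φ = drawLIntegral D P n fun m z =>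
      ∑ y, P n m z y * ∫⁻ x, Φ (append m x) (append z y) ∂D := by
  have happ : ∀ m : Fin n → Y, Measurable fun x => append m x := fun m =>
    measurable_append.comp (measurable_id.prodMk measurable_const)
  rw [drawLIntegral, lintegral_pi_succ]
  · refine lintegral_congr fun m => ?_
    simp only [sum_append (A := Z)]
    rw [lintegral_finsetSum']
    · refine Finset.sum_congr rfl fun z _ => ?_
      rw [lintegral_finsetSum', Finset.mul_sum]
      · refine Finset.sum_congr rfl fun y _ => ?_
        rw [← mul_assoc, ← lintegral_const_mul (f := fun x => Φ (append m x) (append z y)) _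
          ((hΦ _).comp (happ m))]
        refine lintegral_congr fun x => ?_
        simp only [Fin.prod_univ_castSucc, past_append_castSucc, append_castSucc,
          past_append_last, append_last, Fin.val_castSucc, Fin.val_last]
      · exact fun y _ => (((measurable_prod_prob hP _).mul (hΦ _)).comp (happ m)).aemeasurable
    · exact fun z _ => (Finset.measurable_sum _ fun y _ =>
        ((measurable_prod_prob hP _).mul (hΦ _)).comp (happ m)).aemeasurable
  · exact Finset.measurable_sum _ fun z _ => (measurable_prod_prob hP z).mul (hΦ z)

lemma drawLIntegral_mono {n : ℕ} {Φ Ψ : (Fin n → Y) → (Fin n → Z) → ENNReal}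
    (h : ∀ m z, Φ m z ≤ Ψ m z) : drawLIntegral D P n Φ ≤ drawLIntegral D P n Ψ :=
  lintegral_mono fun m => Finset.sum_le_sum fun z _ => mul_le_mul_right (h m z) _

lemma drawLIntegral_const_mul (hP : ∀ t z y, Measurable fun m => P t m z y) {n : ℕ} (c : ENNReal)
    {Φ : (Fin n → Y) → (Fin n → Z) → ENNReal} (hΦ : ∀ z, Measurable fun m => Φ m z) :
    drawLIntegral D P n (fun m z => c * Φ m z) = c * drawLIntegral D P n Φ := by
  rw [drawLIntegral, drawLIntegral, ← lintegral_const_mul]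
  · refine lintegral_congr fun m => ?_
    rw [Finset.mul_sum]
    exact Finset.sum_congr rfl fun z _ => mul_left_comm _ _ _
  · exact Finset.measurable_sum _ fun z _ => (measurable_prod_prob hP z).mul (hΦ z)

lemma drawLIntegral_add (hP : ∀ t z y, Measurable fun m => P t m z y) {n : ℕ}
    {Φ : (Fin n → Y) → (Fin n → Z) → ENNReal} (Ψ : (Fin n → Y) → (Fin n → Z) → ENNReal)
    (hΦ : ∀ z, Measurable fun m => Φ m z) :
    drawLIntegral D P n (fun m z => Φ m z + Ψ m z) =
      drawLIntegral D P n Φ + drawLIntegral D P n Ψ := by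
  rw [drawLIntegral, drawLIntegral, drawLIntegral, ← lintegral_add_left]
  · simp only [mul_add, Finset.sum_add_distrib]
  · exact Finset.measurable_sum _ fun z _ => (measurable_prod_prob hP z).mul (hΦ z)

lemma drawLIntegral_finsetSum (hP : ∀ t z y, Measurable fun m => P t m z y) {n : ℕ} {ι : Type*}
    (s : Finset ι) {Φ : ι → (Fin n → Y) → (Fin n → Z) → ENNReal}
    (hΦ : ∀ i z, Measurable fun m => Φ i m z) :
    drawLIntegral D P n (fun m z => ∑ i ∈ s, Φ i m z) = ∑ i ∈ s, drawLIntegral D P n (Φ i) := by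
  classical
  induction s using Finset.induction_on with
  | empty => simp [drawLIntegral]
  | insert i s hi ih =>
    simp only [Finset.sum_insert hi]
    rw [drawLIntegral_add hP _ (hΦ i), ih]

lemma drawLIntegral_one [IsProbabilityMeasure D] (hP : ∀ t z y, Measurable fun m => P t m z y)
    (hP1 : ∀ t m z, ∑ y, P t m z y = 1) (n : ℕ) :
    drawLIntegral D P n (fun _ _ => 1) = 1 := by
  induction n with
  | zero => simp [drawLIntegral]
  | succ n ih =>
    rw [drawLIntegral_succ hP fun _ => measurable_const]
    simpa [hP1] using ih

/-- The tail bound for an exponential supermartingale. -/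
lemma drawLIntegral_exp_tail [IsProbabilityMeasure D]
    (hP : ∀ t z y, Measurable fun m => P t m z y)
    (g : (t : ℕ) → (Fin t → Y) → (Fin t → Z) → Y → Z → ℝ)
    (hg : ∀ t z y, Measurable fun p : Y × (Fin t → Y) => g t p.2 z p.1 y)
    (hgP : ∀ t m z, ∑ y, P t m z y * ∫⁻ x, ENNReal.ofReal (Real.exp (g t m z x y)) ∂D ≤ 1)
    (n : ℕ) (c : ℝ) :
    drawLIntegral D P n (fun m z =>
      if c < ∑ t : Fin n, g t (past m t) (past z t) (m t) (z t) then 1 else 0) ≤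
      ENNReal.ofReal (Real.exp (-c)) := by
  have hmeas : ∀ (n : ℕ) (z : Fin n → Z), Measurable fun m : Fin n → Y =>
      ENNReal.ofReal (Real.exp (∑ t : Fin n, g t (past m t) (past z t) (m t) (z t))) := by
    intro n z
    refine (Real.measurable_exp.comp (Finset.measurable_sum _ fun t _ => ?_)).ennreal_ofReal
    exact (hg t (past z t) (z t)).comp ((measurable_pi_apply t).prodMk (measurable_past t))
  have h1 : drawLIntegral D P n (fun m z => ENNReal.ofReal (Real.exp
      (∑ t : Fin n, g t (past m t) (past z t) (m t) (z t)))) ≤ 1 := by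
    induction n with
    | zero => simp [drawLIntegral]
    | succ n ih =>
      rw [drawLIntegral_succ hP (hmeas (n + 1))]
      refine le_trans (drawLIntegral_mono fun m z => ?_) ih
      simp only [Fin.sum_univ_castSucc, past_append_castSucc, append_castSucc,
        past_append_last, append_last, Fin.val_castSucc, Fin.val_last]
      set s := ∑ t : Fin n, g t (past m t) (past z t) (m t) (z t)
      have hgm : ∀ y, Measurable fun x => ENNReal.ofReal (Real.exp (g n m z x y)) := fun y =>
        (Real.measurable_exp.comp ((hg n z y).comp
          (measurable_id.prodMk measurable_const))).ennreal_ofReal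
      calc _ = ∑ y, ENNReal.ofReal (Real.exp s) *
            (P n m z y * ∫⁻ x, ENNReal.ofReal (Real.exp (g n m z x y)) ∂D) := by
            refine Finset.sum_congr rfl fun y _ => ?_
            rw [mul_left_comm, ← lintegral_const_mul _ (hgm y)]
            simp only [Real.exp_add, ENNReal.ofReal_mul (Real.exp_pos _).le]
        _ ≤ _ := by
            rw [← Finset.mul_sum]
            exact mul_le_of_le_one_right' (hgP n m z)
  calc _ ≤ drawLIntegral D P n (fun m z => ENNReal.ofReal (Real.exp (-c)) * ENNReal.ofReal (Real.exp
      (∑ t : Fin n, g t (past m t) (past z t) (m t) (z t)))) := by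
        refine drawLIntegral_mono fun m z => ?_
        split_ifs with h
        · rw [← ENNReal.ofReal_mul (Real.exp_pos _).le, ← Real.exp_add, ← ENNReal.ofReal_one]
          exact ENNReal.ofReal_le_ofReal (Real.one_le_exp (by linarith))
        · exact zero_le
    _ ≤ _ := by
        rw [drawLIntegral_const_mul hP _ (hmeas n)]
        exact mul_le_of_le_one_right' h1

/-- The outcome of a round is independent of the past and of the action, so that a payoff `φ`
collected as long as the predictable condition `ψ` holds may be replaced by its mean. -/
lemma drawLIntegral_sum_mean [IsProbabilityMeasure D]
    (hP : ∀ t z y, Measurable fun m => P t m z y) (hP1 : ∀ t m z, ∑ y, P t m z y = 1)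
    {ψ : (t : ℕ) → (Fin t → Y) → (Fin t → Z) → ENNReal} (hψ : ∀ t z, Measurable fun m => ψ t m z)
    {φ : Y → Z → ENNReal} (hφ : ∀ y, Measurable fun x => φ x y) (n : ℕ) :
    drawLIntegral D P n (fun m z => ∑ t : Fin n, ψ t (past m t) (past z t) * φ (m t) (z t)) =
      drawLIntegral D P n (fun m z =>
        ∑ t : Fin n, ψ t (past m t) (past z t) * ∫⁻ x, φ x (z t) ∂D) := by
  have hterm : ∀ (φ : Y → Z → ENNReal), (∀ y, Measurable fun x => φ x y) →
      ∀ (n : ℕ) (z : Fin n → Z), Measurable fun m : Fin n → Y =>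
        ∑ t : Fin n, ψ t (past m t) (past z t) * φ (m t) (z t) := fun φ hφ n z =>
    Finset.measurable_sum _ fun t _ => ((hψ _ _).comp (measurable_past t)).mul
      ((hφ _).comp (measurable_pi_apply t))
  have hstep : ∀ (φ : Y → Z → ENNReal), (∀ y, Measurable fun x => φ x y) → ∀ n : ℕ,
      drawLIntegral D P (n + 1)
        (fun m z => ∑ t : Fin (n + 1), ψ t (past m t) (past z t) * φ (m t) (z t)) =
      drawLIntegral D P n
        (fun m z => ∑ t : Fin n, ψ t (past m t) (past z t) * φ (m t) (z t)) +
      drawLIntegral D P n (fun m z => ∑ y, P n m z y * (ψ n m z * ∫⁻ x, φ x y ∂D)) := by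
    intro φ hφ n
    rw [drawLIntegral_succ hP (hterm φ hφ (n + 1)), ← drawLIntegral_add hP _ (hterm φ hφ n)]
    congr 1
    funext m z
    simp only [Fin.sum_univ_castSucc, past_append_castSucc, append_castSucc,
      past_append_last, append_last, Fin.val_castSucc, Fin.val_last]
    calc _ = ∑ y, (P n m z y * (∑ t : Fin n, ψ t (past m t) (past z t) * φ (m t) (z t)) +
          P n m z y * (ψ n m z * ∫⁻ x, φ x y ∂D)) := by
          refine Finset.sum_congr rfl fun y _ => ?_
          rw [lintegral_add_left measurable_const, lintegral_const_mul _ (hφ y), mul_add]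
          simp
      _ = _ := by rw [Finset.sum_add_distrib, ← Finset.sum_mul, hP1, one_mul]
  induction n with
  | zero => simp [drawLIntegral]
  | succ n ih =>
    rw [hstep φ hφ, hstep (fun _ y => ∫⁻ x, φ x y ∂D) (fun _ => measurable_const), ih]
    simp

end process

/-- Integration with respect to a density over pairs of random outcomes and finitely many
actions. -/
lemma lintegral_prod_count_withDensity {Y W : Type} [MeasurableSpace Y] [Fintype W]
    [MeasurableSpace W] [DiscreteMeasurableSpace W] (μ : Measure Y) [SFinite μ]
    {f g : Y × W → ENNReal} (hf : ∀ w, Measurable fun y => f (y, w))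
    (hg : ∀ w, Measurable fun y => g (y, w)) :
    ∫⁻ ω, g ω ∂(μ.prod Measure.count).withDensity f = ∫⁻ y, ∑ w, f (y, w) * g (y, w) ∂μ := by
  have hf' : Measurable f := measurable_from_prod_countable_left hf
  have hg' : Measurable g := measurable_from_prod_countable_left hg
  rw [lintegral_withDensity_eq_lintegral_mul _ hf' hg', lintegral_prod _ (hf'.mul hg').aemeasurable]
  simp only [lintegral_count, tsum_fintype, Pi.mul_apply]

/-! ### Regret in a repeated game against a randomizing opponent -/

open Classical in
/-- A regret bound against deterministic adaptive adversaries also holds in a repeated game, at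
every round `t₀`, against an opponent who randomizes depending on the whole history. -/
lemma HasRegretBound.game {n k : ℕ} [NeZero n] [NeZero k] {F : Type} [MeasurableSpace F]
    {obs : (Fin n → ℝ) → Fin n → F} {alg : Strategy n F} {T : ℕ} {lo hi δ R : ℝ}
    (hreg : HasRegretBound obs alg T lo hi δ R) (hlo : lo ≤ 0) (hhi : 0 ≤ hi)
    {t₀ : ℕ} (ht₀ : t₀ ≤ T) {L : ℕ → Fin n → Fin k → ℝ} (hL : ∀ t b i, L t b i ∈ Set.Icc lo hi)
    {q : (t : ℕ) → (Fin t → Fin n) → (Fin t → Fin k) → Fin k → ℝ}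
    (hq : ∀ t a i x, 0 ≤ q t a i x) (hq1 : ∀ t a i, ∑ x, q t a i x = 1) :
    ∑ a : Fin T → Fin n, ∑ i : Fin T → Fin k,
      alg.playProb (fun t => (a t, obs (fun b => L t b (i t)) (a t))) *
        (∏ t : Fin T, q t (past a t) (past i t) (i t)) *
        (if ∃ b, (hi - lo) * R < ∑ t : Fin T, (if (t : ℕ) < t₀ then
          L t b (i t) - L t (a t) (i t) else 0) then 1 else 0) ≤ δ := by
  obtain ⟨g, hg⟩ := exists_respond
    (p := fun t a i x => alg.prob t (fun s => (a s, obs (fun b => L s b (i s)) (a s))) x)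
    (fun t a i x => alg.prob_nonneg _ _ _) hq hq1 T fun a i =>
      if ∃ b, (hi - lo) * R < ∑ t : Fin T, (if (t : ℕ) < t₀ then
          L t b (i t) - L t (a t) (i t) else 0) then 1 else 0
  refine hg.trans ?_
  have h := hreg.prefix hlo hhi ht₀ (fun t h b => L t b (g t h)) fun t h b => hL _ _ _
  refine le_trans (le_of_eq (Finset.sum_congr rfl fun a _ => ?_)) h
  rw [mul_ite, mul_one, mul_zero]
  rfl

/-! ### The law of LagrangeBwK -/

lemma one_le_div_B {K d T : ℕ} (I : Instance K d T) : 1 ≤ T / I.B :=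
  (one_le_div I.B_pos).2 I.B_le

namespace Instance

variable {K d T : ℕ} (I : Instance K d T)

lemma isProbabilityMeasure_matLaw : IsProbabilityMeasure I.matLaw := by
  have := I.isProb
  unfold matLaw
  infer_instance

/-- The properties that almost every outcome matrix has. -/
structure Regular (M : OutcomeMatrix K d) : Prop where
  reward : ∀ a, (M a).1 ∈ Set.Icc (0 : ℝ) 1
  cons : ∀ a i, (M a).2 i ∈ Set.Icc (0 : ℝ) 1
  dummy : ∀ a, (M a).2 I.dummy = I.B / T

lemma ae_regular : ∀ᵐ M ∂I.D, I.Regular M := by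
  filter_upwards [I.reward_mem, I.cons_mem, I.dummy_cons] with M h1 h2 h3
  exact ⟨h1, h2, h3⟩

lemma ae_matLaw_regular : ∀ᵐ M ∂I.matLaw, ∀ t, I.Regular (M t) := by
  have := I.isProb
  exact ae_all_iff.2 fun t =>
    (Measure.quasiMeasurePreserving_eval (fun _ : Fin T => I.D) t).ae I.ae_regular

variable {I}

lemma Regular.lagrangian_mem {M : OutcomeMatrix K d} (hM : I.Regular M) (a : Fin K) (i : Fin d) :
    lagrangian I.B T M a i ∈ Set.Icc (1 - T / I.B) 2 := by
  have h1 := hM.reward a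
  have h2 := hM.cons a i
  have h3 : (0 : ℝ) ≤ T / I.B := zero_le_one.trans (one_le_div_B I)
  have h4 := mul_le_mul_of_nonneg_left h2.2 h3
  have h5 := mul_nonneg h3 h2.1
  constructor <;> rw [lagrangian] <;> linarith [h1.1, h1.2]

end Instance

lemma measurable_reward {K d : ℕ} (a : Fin K) :
    Measurable fun M : OutcomeMatrix K d => (M a).1 :=
  measurable_fst.comp (measurable_pi_apply a)

lemma measurable_cons {K d : ℕ} (a : Fin K) (i : Fin d) :
    Measurable fun M : OutcomeMatrix K d => (M a).2 i :=
  (measurable_pi_apply i).comp (measurable_snd.comp (measurable_pi_apply a))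

lemma measurable_lagrangian {K d : ℕ} (B₀ T₀ : ℝ) (a : Fin K) (i : Fin d) :
    Measurable fun M : OutcomeMatrix K d => lagrangian B₀ T₀ M a i :=
  ((measurable_reward a).add_const 1).sub ((measurable_cons a i).const_mul _)

section law

variable {K d T : ℕ} (I : Instance K d T) (alg₁ : Strategy K ℝ) (alg₂ : Strategy d (Fin d → ℝ))

/-- The probability with which the two players of LagrangeBwK draw an arm and a resource. -/
def lagrangeProb (t : ℕ) (m : Fin t → OutcomeMatrix K d) (z : Fin t → Fin K × Fin d)
    (y : Fin K × Fin d) : ENNReal :=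
  ENNReal.ofReal (alg₁.prob t (fun s => ((z s).1, lagrangian I.B T (m s) (z s).1 (z s).2)) y.1 *
    alg₂.prob t (fun s => ((z s).2, fun j => -lagrangian I.B T (m s) (z s).1 j)) y.2)

lemma measurable_lagrangeProb (t : ℕ) (z : Fin t → Fin K × Fin d) (y : Fin K × Fin d) :
    Measurable fun m => lagrangeProb I alg₁ alg₂ t m z y := by
  refine (((alg₁.measurable_prob t y.1).comp (measurable_pi_lambda _ fun s => ?_)).mul
    ((alg₂.measurable_prob t y.2).comp (measurable_pi_lambda _ fun s => ?_))).ennreal_ofReal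
  · exact measurable_const.prodMk ((measurable_lagrangian _ _ _ _).comp (measurable_pi_apply s))
  · exact measurable_const.prodMk (measurable_pi_lambda _ fun j =>
      ((measurable_lagrangian _ _ _ _).comp (measurable_pi_apply s)).neg)

lemma sum_lagrangeProb (t : ℕ) (m : Fin t → OutcomeMatrix K d) (z : Fin t → Fin K × Fin d) :
    ∑ y, lagrangeProb I alg₁ alg₂ t m z y = 1 := by
  simp only [lagrangeProb]
  rw [← ENNReal.ofReal_sum_of_nonneg fun y _ =>
    mul_nonneg (alg₁.prob_nonneg _ _ _) (alg₂.prob_nonneg _ _ _), Fintype.sum_prod_type]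
  simp only [← Finset.mul_sum, alg₂.sum_prob, mul_one, alg₁.sum_prob, ENNReal.ofReal_one]

/-- The density of the law of LagrangeBwK. -/
def lagrangeDensity (M : Fin T → OutcomeMatrix K d) (a : Fin T → Fin K) (i : Fin T → Fin d) : ℝ :=
  (alg₁.playProb fun t => (a t, lagrangian I.B T (M t) (a t) (i t))) *
    alg₂.playProb fun t => (i t, fun j => -lagrangian I.B T (M t) (a t) j)

lemma Strategy.playProb_nonneg {n T : ℕ} {F : Type} [MeasurableSpace F] (alg : Strategy n F)
    (h : Fin T → Fin n × F) : 0 ≤ alg.playProb h :=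
  Finset.prod_nonneg fun _ _ => alg.prob_nonneg _ _ _

lemma Strategy.measurable_playProb {n T : ℕ} {F X : Type} [MeasurableSpace F] [MeasurableSpace X]
    (alg : Strategy n F) {a : Fin T → Fin n} {u : X → Fin T → F}
    (hu : ∀ t, Measurable fun x => u x t) :
    Measurable fun x => alg.playProb fun t => (a t, u x t) :=
  Finset.measurable_prod _ fun t _ => (alg.measurable_prob t (a t)).comp
    (measurable_pi_lambda _ fun _ => measurable_const.prodMk (hu _))

lemma lagrangeDensity_nonneg (M : Fin T → OutcomeMatrix K d) (a : Fin T → Fin K)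
    (i : Fin T → Fin d) : 0 ≤ lagrangeDensity I alg₁ alg₂ M a i :=
  mul_nonneg (alg₁.playProb_nonneg _) (alg₂.playProb_nonneg _)

lemma measurable_lagrangeDensity (a : Fin T → Fin K) (i : Fin T → Fin d) :
    Measurable fun M => lagrangeDensity I alg₁ alg₂ M a i := by
  have hL : ∀ (t : Fin T) (b : Fin K) (j : Fin d), Measurable fun M : Fin T → OutcomeMatrix K d =>
      lagrangian I.B T (M t) b j := fun t b j =>
    (measurable_lagrangian I.B T b j).comp (measurable_pi_apply t)
  have h1 := alg₁.measurable_playProb (a := a) fun t => hL t (a t) (i t)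
  have h2 := alg₂.measurable_playProb (a := i)
    (u := fun (M : Fin T → OutcomeMatrix K d) t j => -lagrangian I.B T (M t) (a t) j)
    fun t => measurable_pi_lambda _ fun j => (hL t (a t) j).neg
  exact h1.mul h2

lemma lintegral_lagrangeBwKLaw
    {g : (Fin T → OutcomeMatrix K d) × (Fin T → Fin K) × (Fin T → Fin d) → ENNReal}
    (hg : ∀ w, Measurable fun M => g (M, w)) :
    ∫⁻ ω, g ω ∂lagrangeBwKLaw I I.B T alg₁ alg₂ =
      ∫⁻ M, ∑ w : (Fin T → Fin K) × (Fin T → Fin d),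
        ENNReal.ofReal (lagrangeDensity I alg₁ alg₂ M w.1 w.2) * g (M, w) ∂I.matLaw := by
  have := I.isProbabilityMeasure_matLaw
  exact lintegral_prod_count_withDensity I.matLaw
    (fun w => (measurable_lagrangeDensity I alg₁ alg₂ w.1 w.2).ennreal_ofReal) hg

lemma lintegral_lagrangeBwKLaw_eq_drawLIntegral
    {g : (Fin T → OutcomeMatrix K d) × (Fin T → Fin K) × (Fin T → Fin d) → ENNReal}
    (hg : ∀ w, Measurable fun M => g (M, w)) :
    ∫⁻ ω, g ω ∂lagrangeBwKLaw I I.B T alg₁ alg₂ =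
      drawLIntegral I.D (lagrangeProb I alg₁ alg₂) T
        fun m z => g (m, (fun t => (z t).1), fun t => (z t).2) := by
  rw [lintegral_lagrangeBwKLaw I alg₁ alg₂ hg, drawLIntegral]
  refine lintegral_congr fun M => ?_
  rw [← (Equiv.arrowProdEquivProdArrow (Fin T) (fun _ => Fin K) fun _ => Fin d).sum_comp]
  refine Finset.sum_congr rfl fun z _ => ?_
  congr 1
  simp only [lagrangeProb]
  rw [← ENNReal.ofReal_prod_of_nonneg fun t _ =>
    mul_nonneg (alg₁.prob_nonneg _ _ _) (alg₂.prob_nonneg _ _ _), Finset.prod_mul_distrib]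
  rfl

lemma isProbabilityMeasure_lagrangeBwKLaw :
    IsProbabilityMeasure (lagrangeBwKLaw I I.B T alg₁ alg₂) := by
  have := I.isProb
  refine ⟨?_⟩
  rw [← lintegral_one, lintegral_lagrangeBwKLaw_eq_drawLIntegral _ _ _ fun _ => measurable_const]
  exact drawLIntegral_one (measurable_lagrangeProb I alg₁ alg₂) (sum_lagrangeProb I alg₁ alg₂) T

lemma ae_lagrangeBwKLaw {p : (Fin T → OutcomeMatrix K d) → Prop} (hp : ∀ᵐ M ∂I.matLaw, p M) :
    ∀ᵐ ω ∂lagrangeBwKLaw I I.B T alg₁ alg₂, p ω.1 := by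
  have := I.isProbabilityMeasure_matLaw
  exact (withDensity_absolutelyContinuous _ _).ae_le (Measure.quasiMeasurePreserving_fst.ae hp)

open Classical in
/-- An event that has probability at most `δ` for almost every choice of the outcome matrices has
probability at most `δ`. -/
lemma lagrangeBwKLaw_real_le
    {S : (Fin T → OutcomeMatrix K d) → (Fin T → Fin K) → (Fin T → Fin d) → Prop}
    (hS : ∀ a i, MeasurableSet {M | S M a i}) {δ : ℝ}
    (h : ∀ᵐ M ∂I.matLaw, ∑ a : Fin T → Fin K, ∑ i : Fin T → Fin d,
      lagrangeDensity I alg₁ alg₂ M a i * (if S M a i then 1 else 0) ≤ δ) :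
    lagrangeBwKLaw I I.B T alg₁ alg₂ {ω | S ω.1 ω.2.1 ω.2.2} ≤ ENNReal.ofReal δ := by
  have := I.isProbabilityMeasure_matLaw
  set E : Set ((Fin T → OutcomeMatrix K d) × (Fin T → Fin K) × (Fin T → Fin d)) :=
    {ω | S ω.1 ω.2.1 ω.2.2} with hE
  have hind : ∀ w, Measurable fun M => E.indicator (fun _ => (1 : ENNReal)) (M, w) := fun w =>
    measurable_const.indicator (hS w.1 w.2)
  have hSm : MeasurableSet E := (measurable_indicator_const_iff (1 : ENNReal)).1
    (measurable_from_prod_countable_left hind)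
  have hlaw := lintegral_lagrangeBwKLaw I alg₁ alg₂ hind
  rw [lintegral_indicator_const hSm, one_mul] at hlaw
  rw [hlaw]
  calc _ ≤ ∫⁻ _M, ENNReal.ofReal δ ∂I.matLaw := by
        refine lintegral_mono_ae ?_
        filter_upwards [h] with M hM
        refine le_trans (le_of_eq ?_) (ENNReal.ofReal_le_ofReal hM)
        rw [← Fintype.sum_prod_type', ENNReal.ofReal_sum_of_nonneg]
        · refine Finset.sum_congr rfl fun w _ => ?_
          rw [ENNReal.ofReal_mul (lagrangeDensity_nonneg _ _ _ _ _ _)]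
          congr 1
          by_cases hw : S M w.1 w.2 <;> simp [hE, hw]
        · intro w _
          have := lagrangeDensity_nonneg I alg₁ alg₂ M w.1 w.2
          split_ifs <;> simp [this]
    _ = _ := by simp

end law

/-! ### Failure probabilities -/

section fail

variable {K d T : ℕ} [NeZero K] [NeZero d] {I : Instance K d T} {alg₁ : Strategy K ℝ}
  {alg₂ : Strategy d (Fin d → ℝ)}

omit [NeZero K] [NeZero d] in
lemma measurable_sum_ite_lagrangian (t₀ : ℕ) (a a' : Fin T → Fin K) (i i' : Fin T → Fin d) :
    Measurable fun M : Fin T → OutcomeMatrix K d => ∑ t : Fin T, if (t : ℕ) < t₀ then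
      lagrangian I.B T (M t) (a t) (i t) - lagrangian I.B T (M t) (a' t) (i' t) else 0 := by
  refine Finset.measurable_sum _ fun t _ => ?_
  split_ifs
  · exact ((measurable_lagrangian I.B T _ _).comp (measurable_pi_apply t)).sub
      ((measurable_lagrangian I.B T _ _).comp (measurable_pi_apply t))
  · exact measurable_const

/-- In LagrangeBwK the regret of the primal player after `t₀` rounds exceeds its bound with
probability at most `δ`: given the outcome matrices, the dual player is a randomizing opponent. -/
lemma primal_regret_fail {δ R : ℝ}
    (hreg : HasRegretBound banditFeedback alg₁ T (1 - T / I.B) 2 δ R) {t₀ : ℕ} (ht₀ : t₀ ≤ T) :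
    lagrangeBwKLaw I I.B T alg₁ alg₂ {ω | ∃ b, (1 + T / I.B) * R < ∑ t : Fin T,
      if (t : ℕ) < t₀ then lagrangian I.B T (ω.1 t) b (ω.2.2 t) -
        lagrangian I.B T (ω.1 t) (ω.2.1 t) (ω.2.2 t) else 0} ≤ ENNReal.ofReal δ := by
  classical
  have h1B := one_le_div_B I
  refine lagrangeBwKLaw_real_le I alg₁ alg₂ (S := fun M a i => ∃ b, (1 + T / I.B) * R <
    ∑ t : Fin T, if (t : ℕ) < t₀ then lagrangian I.B T (M t) b (i t) -
        lagrangian I.B T (M t) (a t) (i t) else 0) (fun a i => ?_) ?_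
  · simp only [Set.ofPred_exists]
    exact MeasurableSet.iUnion fun b => measurableSet_lt measurable_const
      (measurable_sum_ite_lagrangian t₀ (fun _ => b) a i i)
  filter_upwards [I.ae_matLaw_regular] with M hM
  have h := hreg.game (by linarith) (by norm_num) ht₀ (k := d)
    (L := fun t => if ht : t < T then lagrangian I.B T (M ⟨t, ht⟩) else 0)
    (fun t b i => by
      split_ifs
      · exact (hM _).lagrangian_mem b i
      · exact ⟨by simpa using h1B, by simp⟩)
    (q := fun t a i => alg₂.prob t fun s => (i s, fun j =>
      if hs : (s : ℕ) < T then -lagrangian I.B T (M ⟨s, hs⟩) (a s) j else 0))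
    (fun _ _ _ _ => alg₂.prob_nonneg _ _ _) fun _ _ _ => alg₂.sum_prob _ _
  simp only [Fin.is_lt, dite_true, Fin.eta] at h
  rw [show (2 : ℝ) - (1 - T / I.B) = 1 + T / I.B by ring] at h
  refine le_trans (le_of_eq (Finset.sum_congr rfl fun a _ => Finset.sum_congr rfl fun i _ => ?_)) h
  congr 1
  · simp only [lagrangeDensity]
    congr 1
    refine Finset.prod_congr rfl fun t _ => ?_
    congr 1
    funext s
    have hs : (s : ℕ) < T := s.isLt.trans t.isLt
    simp only [hs, dite_true]
    rfl
  · congr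

/-- The counterpart of `primal_regret_fail` for the dual player. -/
lemma dual_regret_fail {δ R : ℝ}
    (hreg : HasRegretBound fullFeedback alg₂ T (-2) (T / I.B - 1) δ R) {t₀ : ℕ} (ht₀ : t₀ ≤ T) :
    lagrangeBwKLaw I I.B T alg₁ alg₂ {ω | ∃ j, (1 + T / I.B) * R < ∑ t : Fin T,
      if (t : ℕ) < t₀ then lagrangian I.B T (ω.1 t) (ω.2.1 t) (ω.2.2 t) -
        lagrangian I.B T (ω.1 t) (ω.2.1 t) j else 0} ≤ ENNReal.ofReal δ := by
  classical
  have h1B := one_le_div_B I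
  refine lagrangeBwKLaw_real_le I alg₁ alg₂ (S := fun M a i => ∃ j, (1 + T / I.B) * R <
    ∑ t : Fin T, if (t : ℕ) < t₀ then lagrangian I.B T (M t) (a t) (i t) -
        lagrangian I.B T (M t) (a t) j else 0) (fun a i => ?_) ?_
  · simp only [Set.ofPred_exists]
    exact MeasurableSet.iUnion fun j => measurableSet_lt measurable_const
      (measurable_sum_ite_lagrangian t₀ a a i fun _ => j)
  filter_upwards [I.ae_matLaw_regular] with M hM
  have h := hreg.game (by linarith) (by linarith) ht₀ (k := K)
    (L := fun t j a => if ht : t < T then -lagrangian I.B T (M ⟨t, ht⟩) a j else 0)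
    (fun t j a => by
      split_ifs
      · have := (hM ⟨t, ‹_›⟩).lagrangian_mem a j
        exact ⟨by linarith [this.2], by linarith [this.1]⟩
      · exact ⟨by norm_num, by linarith⟩)
    (q := fun t i a => alg₁.prob t fun s => (a s,
      if hs : (s : ℕ) < T then lagrangian I.B T (M ⟨s, hs⟩) (a s) (i s) else 0))
    (fun _ _ _ _ => alg₁.prob_nonneg _ _ _) fun _ _ _ => alg₁.sum_prob _ _
  simp only [Fin.is_lt, dite_true, Fin.eta] at h
  rw [show T / I.B - 1 - -2 = 1 + T / I.B by ring] at h
  rw [Finset.sum_comm]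
  refine le_trans (le_of_eq (Finset.sum_congr rfl fun i _ => Finset.sum_congr rfl fun a _ => ?_)) h
  congr 1
  · simp only [lagrangeDensity]
    rw [mul_comm]
    congr 1
    refine Finset.prod_congr rfl fun t _ => ?_
    congr 1
    funext s
    have hs : (s : ℕ) < T := s.isLt.trans t.isLt
    simp only [hs, dite_true]
    rfl
  · simp only [neg_sub_neg]
    congr

/-- The Hoeffding bound for one centered and bounded random variable. -/
lemma lintegral_exp_centered_le_one {Y : Type} [MeasurableSpace Y] {D : Measure Y}
    [IsProbabilityMeasure D] {X : Y → ℝ} (hX : Measurable X) (hX1 : ∀ᵐ x ∂D, |X x| ≤ 1)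
    (hX0 : ∫ x, X x ∂D = 0) (s : ℝ) :
    ∫⁻ x, ENNReal.ofReal (Real.exp (s * X x - s ^ 2 / 2)) ∂D ≤ 1 := by
  have hint : Integrable X D :=
    (integrable_const (1 : ℝ)).mono' hX.aestronglyMeasurable hX1
  have hint2 : Integrable (fun x => Real.cosh s + X x * Real.sinh s) D :=
    (integrable_const _).add (hint.mul_const _)
  calc _ = ENNReal.ofReal (Real.exp (-(s ^ 2 / 2))) *
        ∫⁻ x, ENNReal.ofReal (Real.exp (s * X x)) ∂D := by
        rw [← lintegral_const_mul]
        · refine lintegral_congr fun x => ?_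
          rw [← ENNReal.ofReal_mul (Real.exp_pos _).le, ← Real.exp_add]
          ring_nf
        · exact (Real.measurable_exp.comp (hX.const_mul s)).ennreal_ofReal
    _ ≤ ENNReal.ofReal (Real.exp (-(s ^ 2 / 2))) *
        ∫⁻ x, ENNReal.ofReal (Real.cosh s + X x * Real.sinh s) ∂D := by
        refine mul_le_mul_right (lintegral_mono_ae ?_) _
        filter_upwards [hX1] with x hx
        exact ENNReal.ofReal_le_ofReal (exp_mul_le_cosh_add hx s)
    _ = ENNReal.ofReal (Real.exp (-(s ^ 2 / 2))) * ENNReal.ofReal (Real.cosh s) := by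
        rw [← ofReal_integral_eq_lintegral_ofReal hint2]
        · rw [integral_add (integrable_const _) (hint.mul_const _), integral_mul_const, hX0]
          simp
        · filter_upwards [hX1] with x hx
          exact (Real.exp_pos _).le.trans (exp_mul_le_cosh_add hx s)
    _ ≤ 1 := by
        rw [← ENNReal.ofReal_mul (Real.exp_pos _).le, ← ENNReal.ofReal_one]
        refine ENNReal.ofReal_le_ofReal ?_
        calc _ ≤ Real.exp (-(s ^ 2 / 2)) * Real.exp (s ^ 2 / 2) := by
              gcongr; exact Real.cosh_le_exp_half_sq s
          _ = 1 := by rw [← Real.exp_add]; simp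

/-- The Lagrangian payoff of a mixture `x` of arms. -/
def mixLagrangian {K d : ℕ} (B₀ T₀ : ℝ) (x : Fin K → ℝ) (M : OutcomeMatrix K d) (i : Fin d) : ℝ :=
  ∑ b, x b * lagrangian B₀ T₀ M b i

omit [NeZero K] [NeZero d] in
/-- The payoffs of a fixed mixture `x` of arms against the resources chosen by the dual player are
unlikely to fall far below their conditional means. The stake `s` is arbitrary, and the centered
payoffs are normalized by the width `1 + T / B` of their range. -/
lemma concentration_fail {x : Fin K → ℝ} (hx : ∀ b, 0 ≤ x b) (hx1 : ∑ b, x b = 1) (t₀ : ℕ)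
    (s c : ℝ) :
    lagrangeBwKLaw I I.B T alg₁ alg₂ {ω | c < ∑ t : Fin T, if (t : ℕ) < t₀ then
      s * (((∫ M, mixLagrangian I.B T x M (ω.2.2 t) ∂I.D) -
        mixLagrangian I.B T x (ω.1 t) (ω.2.2 t)) / (1 + T / I.B)) - s ^ 2 / 2 else 0} ≤
      ENNReal.ofReal (Real.exp (-c)) := by
  classical
  have := I.isProb
  have h1B := one_le_div_B I
  have hmix : ∀ i : Fin d, Measurable fun M => mixLagrangian I.B T x M i := fun i =>
    Finset.measurable_sum _ fun b _ => (measurable_lagrangian _ _ b i).const_mul _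
  have hrange : ∀ i : Fin d, ∀ᵐ M ∂I.D, mixLagrangian I.B T x M i ∈ Set.Icc (1 - T / I.B) 2 := by
    intro i
    filter_upwards [I.ae_regular] with M hM
    constructor
    · calc 1 - T / I.B = ∑ b, x b * (1 - T / I.B) := by rw [← Finset.sum_mul, hx1, one_mul]
        _ ≤ _ := Finset.sum_le_sum fun b _ =>
          mul_le_mul_of_nonneg_left (hM.lagrangian_mem b i).1 (hx b)
    · calc _ ≤ ∑ b, x b * 2 := Finset.sum_le_sum fun b _ =>
          mul_le_mul_of_nonneg_left (hM.lagrangian_mem b i).2 (hx b)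
        _ = 2 := by rw [← Finset.sum_mul, hx1, one_mul]
  have hint : ∀ i : Fin d, Integrable (fun M => mixLagrangian I.B T x M i) I.D := fun i =>
    Integrable.of_mem_Icc _ _ (hmix i).aemeasurable (hrange i)
  set g : ℕ → OutcomeMatrix K d → Fin d → ℝ := fun t M i => if t < t₀ then
      s * (((∫ M, mixLagrangian I.B T x M i ∂I.D) -
        mixLagrangian I.B T x M i) / (1 + T / I.B)) - s ^ 2 / 2 else 0 with hg
  have hgm : ∀ t i, Measurable fun M => g t M i := by
    intro t i
    simp only [hg]
    split_ifs
    · exact ((((hmix i).const_sub _).div_const _).const_mul _).sub_const _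
    · exact measurable_const
  have hgP : ∀ t m z, ∑ y, lagrangeProb I alg₁ alg₂ t m z y *
      ∫⁻ M, ENNReal.ofReal (Real.exp (g t M y.2)) ∂I.D ≤ 1 := by
    intro t m z
    rw [← sum_lagrangeProb I alg₁ alg₂ t m z]
    refine Finset.sum_le_sum fun y _ => mul_le_of_le_one_right' ?_
    simp only [hg]
    by_cases ht : t < t₀
    · simp only [ht, if_true]
      refine lintegral_exp_centered_le_one (((hmix y.2).const_sub _).div_const _) ?_ ?_ s
      · have hmean : (∫ M, mixLagrangian I.B T x M y.2 ∂I.D) ∈ Set.Icc (1 - T / I.B) 2 := by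
          have h1 := integral_mono_ae (integrable_const _) (hint y.2)
            ((hrange y.2).mono fun M h => h.1)
          have h2 := integral_mono_ae (hint y.2) (integrable_const _)
            ((hrange y.2).mono fun M h => h.2)
          simp only [integral_const, probReal_univ, one_smul] at h1 h2
          exact ⟨h1, h2⟩
        filter_upwards [hrange y.2] with M hM
        rw [abs_div, abs_of_pos (by linarith : 0 < 1 + T / I.B), div_le_one (by linarith), abs_le]
        exact ⟨by linarith [hM.2, hmean.1], by linarith [hM.1, hmean.2]⟩
      · rw [integral_div, integral_sub (integrable_const _) (hint y.2)]
        simp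
    · simp [ht]
  have htail := drawLIntegral_exp_tail (measurable_lagrangeProb I alg₁ alg₂)
    (fun t _ _ M y => g t M y.2) (fun t _ y => (hgm t y.2).comp measurable_fst) hgP T c
  have hind : ∀ w : (Fin T → Fin K) × (Fin T → Fin d), MeasurableSet
      {M : Fin T → OutcomeMatrix K d | c < ∑ t : Fin T, g t (M t) (w.2 t)} := fun w =>
    measurableSet_lt measurable_const (Finset.measurable_sum _ fun t _ =>
      (hgm t _).comp (measurable_pi_apply t))
  set E : Set ((Fin T → OutcomeMatrix K d) × (Fin T → Fin K) × (Fin T → Fin d)) :=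
    {ω | c < ∑ t : Fin T, g t (ω.1 t) (ω.2.2 t)} with hE
  have hindm : ∀ w, Measurable fun M => E.indicator (fun _ => (1 : ENNReal)) (M, w) := fun w =>
    measurable_const.indicator (hind w)
  have hEm : MeasurableSet E := (measurable_indicator_const_iff (1 : ENNReal)).1
    (measurable_from_prod_countable_left hindm)
  have hlaw := lintegral_lagrangeBwKLaw_eq_drawLIntegral I alg₁ alg₂ hindm
  rw [lintegral_indicator_const hEm, one_mul] at hlaw
  change lagrangeBwKLaw I I.B T alg₁ alg₂ E ≤ _
  rw [hlaw]
  refine le_trans (drawLIntegral_mono fun m z => le_of_eq ?_) htail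
  rw [Set.indicator_apply]
  rfl

end fail

/-! ### The stopping round -/

lemma sum_past_ite_lt {T : ℕ} (f : Fin T → ℝ) (t : Fin T) {n : ℕ} (hn : n ≤ t) :
    ∑ s : Fin t, (if (s : ℕ) < n then past f t s else 0) =
      ∑ s : Fin T, if (s : ℕ) < n then f s else 0 := by
  set g : ℕ → ℝ := fun s => if h : s < T then f ⟨s, h⟩ else 0 with hg
  have h1 : ∀ s : Fin T, f s = g s := fun s => by simp [hg]
  have h2 : ∀ s : Fin t, past f t s = g s := fun s => by
    rw [past, h1]
    rfl
  simp only [h1, h2]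
  rw [sum_fin_ite_lt hn, sum_fin_ite_lt (hn.trans t.isLt.le)]

namespace Instance

variable {K d T : ℕ} (I : Instance K d T)

/-- No resource has run out of budget during the rounds of the history. -/
def Running (t : ℕ) (m : Fin t → OutcomeMatrix K d) (a : Fin t → Fin K) : Prop :=
  ∀ n ≤ t, ∀ i, ∑ s : Fin t, (if (s : ℕ) < n then (m s (a s)).2 i else 0) ≤ I.B

lemma measurableSet_running (t : ℕ) (a : Fin t → Fin K) :
    MeasurableSet {m | I.Running t m a} := by
  simp only [Running, Set.ofPred_forall]
  refine MeasurableSet.iInter fun n => MeasurableSet.iInter fun _ => MeasurableSet.iInter fun i =>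
    measurableSet_le (Finset.measurable_sum _ fun s _ => ?_) measurable_const
  split_ifs
  · exact (measurable_cons (a s) i).comp (measurable_pi_apply s)
  · exact measurable_const

variable (M : Fin T → OutcomeMatrix K d) (a : Fin T → Fin K)

lemma stopRound_le : I.stopRound M a ≤ T :=
  Nat.sInf_le (Or.inl rfl)

lemma stopRound_eq_or :
    I.stopRound M a = T ∨ ∃ i, I.B < ∑ t : Fin T,
      if (t : ℕ) < I.stopRound M a then (M t (a t)).2 i else 0 :=
  Nat.sInf_mem (s := {n : ℕ | n = T ∨ ∃ i, I.B < ∑ t : Fin T,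
    if (t : ℕ) < n then (M t (a t)).2 i else 0}) ⟨T, Or.inl rfl⟩

lemma sum_cons_le_of_lt_stopRound {n : ℕ} (hn : n < I.stopRound M a) (i : Fin d) :
    ∑ t : Fin T, (if (t : ℕ) < n then (M t (a t)).2 i else 0) ≤ I.B := by
  have h := Nat.notMem_of_lt_sInf hn
  exact not_lt.1 fun hi => h (Or.inr ⟨i, hi⟩)

lemma T_pos (I : Instance K d T) : 0 < T :=
  Nat.cast_pos.1 (I.B_pos.trans_le I.B_le)

lemma stopRound_pos : 0 < I.stopRound M a := by
  refine Nat.pos_of_ne_zero fun h => ?_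
  rcases I.stopRound_eq_or M a with h' | ⟨i, hi⟩
  · exact I.T_pos.ne (h.symm.trans h')
  · simp only [h, not_lt_zero, if_false, Finset.sum_const_zero] at hi
    exact hi.not_gt I.B_pos

lemma running_past_iff (t : Fin T) :
    I.Running t (past M t) (past a t) ↔ (t : ℕ) < I.stopRound M a := by
  have key : ∀ n ≤ (t : ℕ), ∀ i, ∑ s : Fin t, (if (s : ℕ) < n then
      (past M t s (past a t s)).2 i else 0) =
      ∑ s : Fin T, if (s : ℕ) < n then (M s (a s)).2 i else 0 := fun n hn i =>
    sum_past_ite_lt (fun s => (M s (a s)).2 i) t hn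
  constructor
  · intro h
    by_contra hlt
    rw [not_lt] at hlt
    rcases I.stopRound_eq_or M a with h' | ⟨i, hi⟩
    · exact (h' ▸ hlt).not_gt t.isLt
    · have := h _ hlt i
      rw [key _ hlt] at this
      exact hi.not_ge this
  · intro h n hn i
    rw [key n hn]
    exact I.sum_cons_le_of_lt_stopRound M a (hn.trans_lt h) i

/-- The budget is exceeded by at most the consumption of one round. -/
lemma sum_cons_stopRound_le (hM : ∀ t, I.Regular (M t)) (i : Fin d) :
    ∑ t : Fin T, (if (t : ℕ) < I.stopRound M a then (M t (a t)).2 i else 0) ≤ I.B + 1 := by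
  have hpos := I.stopRound_pos M a
  have hle := I.stopRound_le M a
  set τ := I.stopRound M a with hτ
  have h1 := I.sum_cons_le_of_lt_stopRound M a (n := τ - 1) (by omega) i
  have h2 : ∀ t : Fin T, (if (t : ℕ) < τ then (M t (a t)).2 i else 0) ≤
      (if (t : ℕ) < τ - 1 then (M t (a t)).2 i else 0) +
        if t = ⟨τ - 1, by omega⟩ then 1 else 0 := by
    intro t
    have hc := (hM t).cons (a t) i
    rcases lt_trichotomy (t : ℕ) (τ - 1) with h | h | h
    · rw [if_pos (by omega), if_pos h]
      split_ifs <;> linarith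
    · rw [if_pos (by omega), if_neg (by omega), if_pos (Fin.ext h)]
      linarith [hc.2]
    · rw [if_neg (by omega), if_neg (by omega), if_neg fun h' => by rw [h'] at h; simp at h]
      simp
  calc _ ≤ _ := Finset.sum_le_sum fun t _ => h2 t
    _ ≤ _ := by
      rw [Finset.sum_add_distrib, Finset.sum_ite_eq' Finset.univ, if_pos (Finset.mem_univ _)]
      linarith

lemma REW_nonneg {M : Fin T → OutcomeMatrix K d} (hM : ∀ t, I.Regular (M t))
    (a : Fin T → Fin K) : 0 ≤ I.REW M a :=
  Finset.sum_nonneg fun t _ => by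
    split_ifs
    exacts [((hM t).reward (a t)).1, le_rfl]

lemma measurable_ite_stopRound {f : OutcomeMatrix K d → ℝ} (hf : Measurable f) (t : Fin T)
    (a : Fin T → Fin K) :
    Measurable fun M => if (t : ℕ) < I.stopRound M a then f (M t) else 0 := by
  have hset : MeasurableSet {M | (t : ℕ) < I.stopRound M a} := by
    have h := (measurable_past t) (I.measurableSet_running t (past a t))
    rwa [show (fun m => past m t) ⁻¹' {m | I.Running t m (past a t)} =
      {M | (t : ℕ) < I.stopRound M a} from Set.ext fun M => I.running_past_iff M a t] at h
  exact Measurable.ite hset (hf.comp (measurable_pi_apply t)) measurable_const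

lemma measurable_REW (a : Fin T → Fin K) : Measurable fun M => I.REW M a :=
  Finset.measurable_sum _ fun t _ => I.measurable_ite_stopRound (measurable_reward (a t)) t a

/-! ### The value of the best dynamic policy -/

/-- The expected reward of an arm. -/
def meanReward (b : Fin K) : ℝ := ∫ M, (M b).1 ∂I.D

/-- The expected consumption of a resource by an arm. -/
def meanCons (b : Fin K) (i : Fin d) : ℝ := ∫ M, (M b).2 i ∂I.D

lemma integrable_reward (b : Fin K) : Integrable (fun M => (M b).1) I.D := by
  have := I.isProb
  exact Integrable.of_mem_Icc 0 1 (measurable_reward b).aemeasurable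
    (I.reward_mem.mono fun M h => h b)

lemma integrable_cons (b : Fin K) (i : Fin d) : Integrable (fun M => (M b).2 i) I.D := by
  have := I.isProb
  exact Integrable.of_mem_Icc 0 1 (measurable_cons b i).aemeasurable
    (I.cons_mem.mono fun M h => h b i)

lemma meanReward_nonneg (b : Fin K) : 0 ≤ I.meanReward b :=
  integral_nonneg_of_ae (I.reward_mem.mono fun _ h => (h b).1)

lemma meanReward_le_one (b : Fin K) : I.meanReward b ≤ 1 := by
  have := I.isProb
  have h := integral_mono_ae (I.integrable_reward b) (integrable_const 1)
    (I.reward_mem.mono fun _ h => (h b).2)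
  exact h.trans (by simp)

lemma meanReward_null : I.meanReward I.null = 0 :=
  integral_eq_zero_of_ae I.null_reward

lemma meanCons_null {i : Fin d} (hi : i ≠ I.dummy) : I.meanCons I.null i = 0 :=
  integral_eq_zero_of_ae (I.null_cons.mono fun _ h => h i hi)

lemma meanCons_dummy (b : Fin K) : I.meanCons b I.dummy = I.B / T := by
  have := I.isProb
  rw [meanCons, integral_congr_ae (I.dummy_cons.mono fun M h => h b)]
  simp

section policy

variable (π : Strategy K (ℝ × (Fin d → ℝ)))

/-- The probability with which a policy draws an arm, given the past outcomes and arms. -/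
def policyProb (π : Strategy K (ℝ × (Fin d → ℝ))) (t : ℕ) (m : Fin t → OutcomeMatrix K d)
    (z : Fin t → Fin K) (y : Fin K) : ENNReal :=
  ENNReal.ofReal (π.prob t (fun s => (z s, m s (z s))) y)

lemma measurable_policyProb (t : ℕ) (z : Fin t → Fin K) (y : Fin K) :
    Measurable fun m => policyProb π t m z y :=
  ((π.measurable_prob t y).comp (measurable_pi_lambda _ fun s => measurable_const.prodMk
    ((measurable_pi_apply (z s)).comp (measurable_pi_apply s)))).ennreal_ofReal

lemma sum_policyProb (t : ℕ) (m : Fin t → OutcomeMatrix K d) (z : Fin t → Fin K) :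
    ∑ y, policyProb π t m z y = 1 := by
  simp only [policyProb]
  rw [← ENNReal.ofReal_sum_of_nonneg fun y _ => π.prob_nonneg _ _ _, π.sum_prob,
    ENNReal.ofReal_one]

lemma lintegral_policyLaw {g : (Fin T → OutcomeMatrix K d) × (Fin T → Fin K) → ENNReal}
    (hg : ∀ w, Measurable fun M => g (M, w)) :
    ∫⁻ ω, g ω ∂I.policyLaw π = drawLIntegral I.D (policyProb π) T fun m z => g (m, z) := by
  have := I.isProbabilityMeasure_matLaw
  have hdens : ∀ w : Fin T → Fin K, Measurable fun M : Fin T → OutcomeMatrix K d =>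
      ENNReal.ofReal (π.playProb fun t => (w t, M t (w t))) := fun w =>
    (π.measurable_playProb fun t => (measurable_pi_apply (w t)).comp
      (measurable_pi_apply t)).ennreal_ofReal
  rw [policyLaw, lintegral_prod_count_withDensity I.matLaw
    (f := fun ω : (Fin T → OutcomeMatrix K d) × (Fin T → Fin K) =>
      ENNReal.ofReal (π.playProb fun t => (ω.2 t, ω.1 t (ω.2 t)))) hdens hg,
    drawLIntegral]
  refine lintegral_congr fun M => Finset.sum_congr rfl fun z _ => ?_
  congr 1
  exact ENNReal.ofReal_prod_of_nonneg fun t _ => π.prob_nonneg _ _ _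

lemma isProbabilityMeasure_policyLaw : IsProbabilityMeasure (I.policyLaw π) := by
  have := I.isProb
  refine ⟨?_⟩
  rw [← lintegral_one, lintegral_policyLaw _ _ fun _ => measurable_const]
  exact drawLIntegral_one (measurable_policyProb π) (sum_policyProb π) T

lemma ae_policyLaw_regular : ∀ᵐ ω ∂I.policyLaw π, ∀ t, I.Regular (ω.1 t) := by
  have := I.isProbabilityMeasure_matLaw
  exact (withDensity_absolutelyContinuous _ _).ae_le
    (Measure.quasiMeasurePreserving_fst.ae I.ae_matLaw_regular)

open Classical in
/-- The expected number of rounds in which a policy plays arm `b` before it stops. -/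
def occupation (b : Fin K) : ENNReal :=
  drawLIntegral I.D (policyProb π) T fun m z => ∑ t : Fin T,
    (if I.Running t (past m t) (past z t) then 1 else 0) * if z t = b then 1 else 0

lemma sum_occupation_le : ∑ b, I.occupation π b ≤ T := by
  classical
  have := I.isProb
  have hm : ∀ (b : Fin K) (z : Fin T → Fin K), Measurable fun m : Fin T → OutcomeMatrix K d =>
      ∑ t : Fin T, (if I.Running t (past m t) (past z t) then (1 : ENNReal) else 0) *
        if z t = b then 1 else 0 := fun b z =>
    Finset.measurable_sum _ fun t _ => (Measurable.ite ((measurable_past t)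
      (I.measurableSet_running t (past z t))) measurable_const measurable_const).mul_const _
  simp only [occupation]
  rw [← drawLIntegral_finsetSum (measurable_policyProb π) _ hm]
  calc _ ≤ drawLIntegral I.D (policyProb π) T fun _ _ => T * 1 := by
        refine drawLIntegral_mono fun m z => ?_
        rw [Finset.sum_comm]
        calc _ ≤ ∑ _t : Fin T, (1 : ENNReal) := by
              refine Finset.sum_le_sum fun t _ => ?_
              rw [← Finset.mul_sum, Finset.sum_ite_eq, if_pos (Finset.mem_univ _), mul_one]
              split_ifs <;> simp
          _ = _ := by simp
    _ = T := by
        rw [drawLIntegral_const_mul (measurable_policyProb π) _ fun _ => measurable_const,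
          drawLIntegral_one (measurable_policyProb π) (sum_policyProb π), mul_one]

lemma occupation_ne_top (b : Fin K) : I.occupation π b ≠ ⊤ :=
  ne_top_of_le_ne_top (ENNReal.natCast_ne_top T)
    ((Finset.single_le_sum (fun _ _ => zero_le) (Finset.mem_univ b)).trans
      (I.sum_occupation_le π))

/-- Wald's identity: a quantity collected until the policy stops has the expectation given by the
occupation numbers and the means. -/
lemma lintegral_sum_lt_stopRound {φ : OutcomeMatrix K d → Fin K → ℝ}
    (hφ : ∀ b, Measurable fun M => φ M b) (hφ1 : ∀ b, ∀ᵐ M ∂I.D, φ M b ∈ Set.Icc (0 : ℝ) 1) :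
    ∫⁻ ω, ∑ t : Fin T, (if (t : ℕ) < I.stopRound ω.1 ω.2 then
      ENNReal.ofReal (φ (ω.1 t) (ω.2 t)) else 0) ∂I.policyLaw π =
      ENNReal.ofReal (∑ b, (I.occupation π b).toReal * ∫ M, φ M b ∂I.D) := by
  classical
  have := I.isProb
  have hrun : ∀ (t : ℕ) (z : Fin t → Fin K), Measurable fun m =>
      if I.Running t m z then (1 : ENNReal) else 0 := fun t z =>
    Measurable.ite (I.measurableSet_running t z) measurable_const measurable_const
  have hmean : ∀ b, ∫⁻ M, ENNReal.ofReal (φ M b) ∂I.D = ENNReal.ofReal (∫ M, φ M b ∂I.D) :=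
    fun b => (ofReal_integral_eq_lintegral_ofReal
      (Integrable.of_mem_Icc 0 1 (hφ b).aemeasurable (hφ1 b)) ((hφ1 b).mono fun M h => h.1)).symm
  have hmean0 : ∀ b, 0 ≤ ∫ M, φ M b ∂I.D := fun b =>
    integral_nonneg_of_ae ((hφ1 b).mono fun M h => h.1)
  have hrw : ∀ (M : Fin T → OutcomeMatrix K d) (z : Fin T → Fin K), ∑ t : Fin T,
      (if (t : ℕ) < I.stopRound M z then ENNReal.ofReal (φ (M t) (z t)) else 0) = ∑ t : Fin T,
      (if I.Running t (past M t) (past z t) then 1 else 0) * ENNReal.ofReal (φ (M t) (z t)) := by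
    intro M z
    refine Finset.sum_congr rfl fun t _ => ?_
    simp only [running_past_iff, ite_mul, one_mul, zero_mul]
  rw [lintegral_policyLaw]
  · simp only [hrw]
    rw [drawLIntegral_sum_mean (measurable_policyProb π) (sum_policyProb π)
      (ψ := fun t m z => if I.Running t m z then 1 else 0) hrun
      (φ := fun M b => ENNReal.ofReal (φ M b)) fun b => (hφ b).ennreal_ofReal]
    have hexp : ∀ (m : Fin T → OutcomeMatrix K d) (z : Fin T → Fin K), ∑ t : Fin T,
        (if I.Running t (past m t) (past z t) then 1 else 0) *
          ∫⁻ M, ENNReal.ofReal (φ M (z t)) ∂I.D =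
        ∑ b, ENNReal.ofReal (∫ M, φ M b ∂I.D) * ∑ t : Fin T,
          (if I.Running t (past m t) (past z t) then 1 else 0) * if z t = b then 1 else 0 := by
      intro m z
      simp only [Finset.mul_sum]
      rw [Finset.sum_comm]
      refine Finset.sum_congr rfl fun t _ => ?_
      simp only [mul_ite, mul_one, mul_zero, Finset.sum_ite_eq, Finset.mem_univ, if_true, hmean,
        ite_mul, one_mul, zero_mul]
    have hm : ∀ (b : Fin K) (z : Fin T → Fin K), Measurable fun m : Fin T → OutcomeMatrix K d =>
      ∑ t : Fin T, (if I.Running t (past m t) (past z t) then (1 : ENNReal) else 0) *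
        if z t = b then 1 else 0 := fun b z =>
      Finset.measurable_sum _ fun t _ => ((hrun t (past z t)).comp (measurable_past t)).mul_const _
    simp only [hexp]
    rw [drawLIntegral_finsetSum (measurable_policyProb π) _ fun b z => (hm b z).const_mul _,
      ENNReal.ofReal_sum_of_nonneg fun b _ => mul_nonneg ENNReal.toReal_nonneg (hmean0 b)]
    refine Finset.sum_congr rfl fun b _ => ?_
    rw [drawLIntegral_const_mul (measurable_policyProb π) _ (hm b), mul_comm,
      ENNReal.ofReal_mul ENNReal.toReal_nonneg, ENNReal.ofReal_toReal (I.occupation_ne_top π b)]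
    rfl
  · intro w
    simp only [hrw]
    exact Finset.measurable_sum _ fun t _ => ((hrun t (past w t)).comp (measurable_past t)).mul
      ((hφ (w t)).comp (measurable_pi_apply t)).ennreal_ofReal

lemma integral_REW : ∫ ω, I.REW ω.1 ω.2 ∂I.policyLaw π =
    ∑ b, (I.occupation π b).toReal * I.meanReward b := by
  have hreg := I.ae_policyLaw_regular π
  rw [integral_eq_lintegral_of_nonneg_ae (hreg.mono fun ω h => I.REW_nonneg h ω.2)
    (measurable_from_prod_countable_left I.measurable_REW).aestronglyMeasurable]
  have h := I.lintegral_sum_lt_stopRound π measurable_reward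
    fun b => I.reward_mem.mono fun M h => h b
  rw [lintegral_congr_ae (g := fun ω => ∑ t : Fin T, if (t : ℕ) < I.stopRound ω.1 ω.2 then
      ENNReal.ofReal ((ω.1 t (ω.2 t)).1) else 0), h, ENNReal.toReal_ofReal]
  · rfl
  · exact Finset.sum_nonneg fun b _ =>
      mul_nonneg ENNReal.toReal_nonneg (I.meanReward_nonneg b)
  · filter_upwards [hreg] with ω hω
    rw [REW, ENNReal.ofReal_sum_of_nonneg]
    · refine Finset.sum_congr rfl fun t _ => ?_
      split_ifs <;> simp
    · intro t _
      split_ifs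
      exacts [((hω t).reward _).1, le_rfl]

lemma sum_occupation_mul_meanCons_le (i : Fin d) :
    ∑ b, (I.occupation π b).toReal * I.meanCons b i ≤ I.B + 1 := by
  have := I.isProbabilityMeasure_policyLaw π
  have h := I.lintegral_sum_lt_stopRound π (fun b => measurable_cons b i)
    fun b => I.cons_mem.mono fun M h => h b i
  have hB : 0 ≤ I.B + 1 := by linarith [I.B_pos]
  rw [← ENNReal.ofReal_le_ofReal_iff hB]
  refine h.symm.le.trans ?_
  calc _ ≤ ∫⁻ _ω, ENNReal.ofReal (I.B + 1) ∂I.policyLaw π := by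
        refine lintegral_mono_ae ?_
        filter_upwards [I.ae_policyLaw_regular π] with ω hω
        refine le_trans (le_of_eq ?_) (ENNReal.ofReal_le_ofReal
          (I.sum_cons_stopRound_le ω.1 ω.2 hω i))
        rw [ENNReal.ofReal_sum_of_nonneg]
        · refine Finset.sum_congr rfl fun t _ => ?_
          split_ifs <;> simp
        · intro t _
          split_ifs
          exacts [((hω t).cons _ i).1, le_rfl]
    _ = _ := by simp

lemma sum_toReal_occupation_le : ∑ b, (I.occupation π b).toReal ≤ T := by
  rw [← ENNReal.toReal_sum fun b _ => I.occupation_ne_top π b]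
  exact (ENNReal.toReal_mono (ENNReal.natCast_ne_top T) (I.sum_occupation_le π)).trans (by simp)

/-- Every policy yields a mixture of arms that respects all budgets on average and earns almost the
same reward. Scaling its occupation numbers down makes up for the overshoot of the budget in the
last round, and the null arm is played for the rest of the time. -/
lemma exists_mixture_of_policy : ∃ x : Fin K → ℝ, (∀ b, 0 ≤ x b) ∧ ∑ b, x b = 1 ∧
    (∀ i, ∑ b, x b * I.meanCons b i ≤ I.B / T) ∧
    ∫ ω, I.REW ω.1 ω.2 ∂I.policyLaw π ≤ T * ∑ b, x b * I.meanReward b + T / I.B := by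
  classical
  have hB := I.B_pos
  have hT : (0 : ℝ) < T := hB.trans_le I.B_le
  set y : Fin K → ℝ := fun b => (I.occupation π b).toReal with hy
  have hy0 : ∀ b, 0 ≤ y b := fun b => ENNReal.toReal_nonneg
  have hyT : ∑ b, y b ≤ T := I.sum_toReal_occupation_le π
  set N : ℝ := T * (1 + 1 / I.B) with hN
  have hN0 : 0 < N := by positivity
  have hTN : (T : ℝ) ≤ N := le_mul_of_one_le_right hT.le (by
    have : 0 < 1 / I.B := by positivity
    linarith)
  have hyN : ∑ b, y b / N ≤ 1 := by
    rw [← Finset.sum_div]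
    exact (div_le_one hN0).2 (hyT.trans hTN)
  have hsum : ∀ f : Fin K → ℝ, ∑ b, (y b / N + if b = I.null then 1 - ∑ b, y b / N else 0) * f b =
      (∑ b, y b * f b) / N + (1 - ∑ b, y b / N) * f I.null := by
    intro f
    simp only [add_mul, ite_mul, zero_mul, Finset.sum_add_distrib, Finset.sum_ite_eq',
      Finset.mem_univ, if_true, Finset.sum_div]
    congr 1
    exact Finset.sum_congr rfl fun b _ => by ring
  have hx1 : ∑ b, (y b / N + if b = I.null then 1 - ∑ b, y b / N else 0) = 1 := by
    have h := hsum fun _ => 1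
    simp only [mul_one] at h
    rw [h, Finset.sum_div]
    ring
  refine ⟨fun b => y b / N + if b = I.null then 1 - ∑ b, y b / N else 0, fun b => ?_, hx1,
    fun i => ?_, ?_⟩
  · have := hy0 b
    have : 0 ≤ y b / N := by positivity
    dsimp only
    split_ifs <;> linarith
  · by_cases hi : i = I.dummy
    · simp only [hi, meanCons_dummy]
      rw [← Finset.sum_mul, hx1, one_mul]
    · rw [hsum fun b => I.meanCons b i, I.meanCons_null hi, mul_zero, add_zero,
        div_le_div_iff₀ hN0 hT]
      have h := mul_le_mul_of_nonneg_right (I.sum_occupation_mul_meanCons_le π i) hT.le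
      refine h.trans (le_of_eq ?_)
      rw [hN]
      field_simp
  · rw [hsum, I.meanReward_null, mul_zero, add_zero, I.integral_REW π]
    set E := ∑ b, y b * I.meanReward b with hE
    have hET : E ≤ T := by
      refine le_trans (Finset.sum_le_sum fun b _ => ?_) hyT
      exact mul_le_of_le_one_right (hy0 b) (I.meanReward_le_one b)
    have hE0 : 0 ≤ E := Finset.sum_nonneg fun b _ => mul_nonneg (hy0 b) (I.meanReward_nonneg b)
    have h1 : (T : ℝ) * (E / N) = E * (I.B / (I.B + 1)) := by
      rw [hN]; field_simp
    have h2 : E - E * (I.B / (I.B + 1)) = E / (I.B + 1) := by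
      field_simp; ring
    have h3 : E / (I.B + 1) ≤ T / I.B := by
      gcongr
      linarith
    change E ≤ _
    linarith

end policy

lemma nonempty_policy (I : Instance K d T) : Nonempty (Strategy K (ℝ × (Fin d → ℝ))) := by
  classical
  exact ⟨{
    prob := fun _ _ b => if b = I.null then 1 else 0
    measurable_prob := fun _ _ => measurable_const
    prob_nonneg := fun _ _ b => by split_ifs <;> norm_num
    sum_prob := fun _ _ => by simp }⟩

/-- Without regard to the budgets, no policy beats a best arm. -/
lemma exists_OPTDP_le_mul_meanReward : ∃ b, I.OPTDP ≤ T * I.meanReward b := by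
  have := I.nonempty_policy
  have : Nonempty (Fin K) := ⟨I.null⟩
  obtain ⟨b, hb⟩ := Finite.exists_max I.meanReward
  refine ⟨b, ciSup_le fun π => ?_⟩
  rw [I.integral_REW π]
  calc _ ≤ ∑ c, (I.occupation π c).toReal * I.meanReward b :=
        Finset.sum_le_sum fun c _ => mul_le_mul_of_nonneg_left (hb c) ENNReal.toReal_nonneg
    _ ≤ _ := by
        rw [← Finset.sum_mul]
        exact mul_le_mul_of_nonneg_right (I.sum_toReal_occupation_le π) (I.meanReward_nonneg b)

lemma OPTDP_le : I.OPTDP ≤ T := by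
  obtain ⟨b, hb⟩ := I.exists_OPTDP_le_mul_meanReward
  exact hb.trans (mul_le_of_le_one_right (Nat.cast_nonneg T) (I.meanReward_le_one b))

/-- The optimal value is at most, up to `2 * T / B`, the value of the linear program over mixtures
of arms. -/
lemma exists_mixture : ∃ x : Fin K → ℝ, (∀ b, 0 ≤ x b) ∧ ∑ b, x b = 1 ∧
    (∀ i, ∑ b, x b * I.meanCons b i ≤ I.B / T) ∧
    I.OPTDP ≤ T * ∑ b, x b * I.meanReward b + 2 * (T / I.B) := by
  have := I.nonempty_policy
  obtain ⟨π, hπ⟩ := exists_lt_of_lt_ciSup (sub_one_lt I.OPTDP)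
  obtain ⟨x, h0, h1, h2, h3⟩ := I.exists_mixture_of_policy π
  exact ⟨x, h0, h1, h2, by linarith [one_le_div_B I]⟩

end Instance

/-! ### From regret to reward -/

section path

variable {K d T : ℕ} {I : Instance K d T}

lemma integral_mixLagrangian (x : Fin K → ℝ) (hx1 : ∑ b, x b = 1) (i : Fin d) :
    ∫ M, mixLagrangian I.B T x M i ∂I.D =
      ∑ b, x b * I.meanReward b + 1 - T / I.B * ∑ b, x b * I.meanCons b i := by
  have := I.isProb
  have h1 : ∀ b, Integrable (fun M => (M b).1 + 1) I.D := fun b =>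
    (I.integrable_reward b).add (integrable_const 1)
  have h2 : ∀ b, Integrable (fun M => T / I.B * (M b).2 i) I.D := fun b =>
    (I.integrable_cons b i).const_mul _
  have hL : ∀ b, ∫ M, lagrangian I.B T M b i ∂I.D =
      I.meanReward b + 1 - T / I.B * I.meanCons b i := fun b => by
    simp only [lagrangian]
    rw [integral_sub (h1 b) (h2 b), integral_add (I.integrable_reward b) (integrable_const 1),
      integral_const_mul]
    simp [Instance.meanReward, Instance.meanCons]
  have h3 : ∀ b, Integrable (fun M => lagrangian I.B T M b i) I.D := fun b =>
    (h1 b).sub (h2 b)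
  simp only [mixLagrangian]
  rw [integral_finsetSum _ fun b _ => (h3 b).const_mul _]
  simp only [integral_const_mul, hL]
  calc _ = ∑ b, x b * I.meanReward b + ∑ b, x b - T / I.B * ∑ b, x b * I.meanCons b i := by
        rw [Finset.mul_sum, ← Finset.sum_add_distrib, ← Finset.sum_sub_distrib]
        exact Finset.sum_congr rfl fun b _ => by ring
    _ = _ := by rw [hx1]

/-- The deterministic heart of the argument. When the game stops, some resource has been consumed at
least at the rate `B / T` over all `T` rounds (a resource that has run out, or the dummy resource),
and against that resource the payoff of the game is at most the reward minus the number of the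
remaining rounds. On the other hand the primal player earns at least the payoff of the mixture `x`,
which is at least its reward in every round. -/
lemma mul_sum_meanReward_sub_REW_le {x : Fin K → ℝ} (hx : ∀ b, 0 ≤ x b) (hx1 : ∑ b, x b = 1)
    (hcons : ∀ i, ∑ b, x b * I.meanCons b i ≤ I.B / T)
    {M : Fin T → OutcomeMatrix K d} (hM : ∀ t, I.Regular (M t)) {a : Fin T → Fin K}
    {i : Fin T → Fin d} {ρ₁ ρ₂ Z : ℝ}
    (h₁ : ∀ b, ∑ t : Fin T, (if (t : ℕ) < I.stopRound M a then
      lagrangian I.B T (M t) b (i t) - lagrangian I.B T (M t) (a t) (i t) else 0) ≤ ρ₁)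
    (h₂ : ∀ j, ∑ t : Fin T, (if (t : ℕ) < I.stopRound M a then
      lagrangian I.B T (M t) (a t) (i t) - lagrangian I.B T (M t) (a t) j else 0) ≤ ρ₂)
    (h₃ : ∑ t : Fin T, (if (t : ℕ) < I.stopRound M a then
      (∫ M, mixLagrangian I.B T x M (i t) ∂I.D) - mixLagrangian I.B T x (M t) (i t) else 0) ≤ Z) :
    T * ∑ b, x b * I.meanReward b - I.REW M a ≤ ρ₁ + ρ₂ + Z := by
  have hB := I.B_pos
  have hT : (0 : ℝ) < T := hB.trans_le I.B_le
  have hτT := I.stopRound_le M a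
  set τ := I.stopRound M a with hτ
  set r := ∑ b, x b * I.meanReward b with hr
  have hr1 : r ≤ 1 := by
    rw [← hx1]
    exact Finset.sum_le_sum fun b _ => mul_le_of_le_one_right (hx b) (I.meanReward_le_one b)
  have hcount : ∀ c : ℝ, ∑ t : Fin T, (if (t : ℕ) < τ then c else 0) = τ * c := by
    intro c
    rw [sum_fin_ite_lt hτT fun _ => c]
    simp
  have hmix : ∑ t : Fin T, (if (t : ℕ) < τ then mixLagrangian I.B T x (M t) (i t) -
      lagrangian I.B T (M t) (a t) (i t) else 0) ≤ ρ₁ := by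
    calc _ = ∑ b, x b * ∑ t : Fin T, (if (t : ℕ) < τ then
          lagrangian I.B T (M t) b (i t) - lagrangian I.B T (M t) (a t) (i t) else 0) := by
          simp only [Finset.mul_sum]
          rw [Finset.sum_comm]
          refine Finset.sum_congr rfl fun t _ => ?_
          split_ifs
          · simp only [mul_sub, Finset.sum_sub_distrib, ← Finset.sum_mul, hx1, one_mul]
            rfl
          · simp
      _ ≤ ∑ b, x b * ρ₁ := Finset.sum_le_sum fun b _ => mul_le_mul_of_nonneg_left (h₁ b) (hx b)
      _ = ρ₁ := by rw [← Finset.sum_mul, hx1, one_mul]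
  have hmean : τ * r ≤ ∑ t : Fin T,
      (if (t : ℕ) < τ then ∫ M, mixLagrangian I.B T x M (i t) ∂I.D else 0) := by
    rw [← hcount]
    refine Finset.sum_le_sum fun t _ => ?_
    split_ifs
    · rw [integral_mixLagrangian x hx1]
      have h := mul_le_mul_of_nonneg_left (hcons (i t)) (zero_le_one.trans (one_le_div_B I))
      have : T / I.B * (I.B / T) = 1 := by field_simp
      linarith
    · exact le_rfl
  obtain ⟨j, hj⟩ : ∃ j, I.B ≤ ∑ t : Fin T, if (t : ℕ) < τ then (M t (a t)).2 j else 0 := by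
    rcases I.stopRound_eq_or M a with h | ⟨j, hj⟩
    · refine ⟨I.dummy, le_of_eq ?_⟩
      have : ∀ t : Fin T, (t : ℕ) < τ := fun t => by rw [hτ, h]; exact t.isLt
      simp only [this, if_true, (hM _).dummy, Finset.sum_const, Finset.card_univ, Fintype.card_fin,
        nsmul_eq_mul]
      field_simp
    · exact ⟨j, hj.le⟩
  have hj' : (T : ℝ) ≤ T / I.B * ∑ t : Fin T, if (t : ℕ) < τ then (M t (a t)).2 j else 0 := by
    calc (T : ℝ) = T / I.B * I.B := by field_simp
      _ ≤ _ := mul_le_mul_of_nonneg_left hj (zero_le_one.trans (one_le_div_B I))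
  have hpay : ∑ t : Fin T, (if (t : ℕ) < τ then lagrangian I.B T (M t) (a t) j else 0) =
      I.REW M a + τ - T / I.B * ∑ t : Fin T, if (t : ℕ) < τ then (M t (a t)).2 j else 0 := by
    rw [← mul_one (τ : ℝ), ← hcount 1, Instance.REW, Finset.mul_sum, ← Finset.sum_add_distrib,
      ← Finset.sum_sub_distrib]
    refine Finset.sum_congr rfl fun t _ => ?_
    rw [← hτ]
    split_ifs
    · rfl
    · simp
  have hsplit : ∀ f g : Fin T → ℝ, ∑ t : Fin T, (if (t : ℕ) < τ then f t - g t else 0) =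
      ∑ t : Fin T, (if (t : ℕ) < τ then f t else 0) -
        ∑ t : Fin T, (if (t : ℕ) < τ then g t else 0) := by
    intro f g
    rw [← Finset.sum_sub_distrib]
    refine Finset.sum_congr rfl fun t _ => ?_
    split_ifs <;> simp
  have h₂' := h₂ j
  rw [hsplit] at hmix h₂' h₃
  have hτT' : (τ : ℝ) ≤ T := Nat.cast_le.2 hτT
  have hfin : (T - τ : ℝ) * r ≤ T - τ := mul_le_of_le_one_right (by linarith) hr1
  linarith

end path

/-- The reward of LagrangeBwK in terms of the regret of its two players. The failure probabilities
add up over the rounds, since the regret has to be controlled in the random stopping round. The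
constant `c` cannot be enlarged afterwards, as `R₁` and `R₂` are only known to be nonnegative on the
good event. -/
lemma one_sub_le_lagrangeBwKLaw {K d T : ℕ} [NeZero K] [NeZero d] (I : Instance K d T)
    {alg₁ : Strategy K ℝ} {alg₂ : Strategy d (Fin d → ℝ)} {δ δ₁ R₁ R₂ c : ℝ} (hδ : 0 < δ)
    (hδ1 : δ < 1) (hlog : 1 ≤ Real.log (d * T / δ)) (hδ₁ : 0 ≤ δ₁) (hc : 6 ≤ c)
    (hreg₁ : HasRegretBound banditFeedback alg₁ T (1 - T / I.B) 2 δ₁ R₁)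
    (hreg₂ : HasRegretBound fullFeedback alg₂ T (-2) (T / I.B - 1) δ₁ R₂) :
    1 - (2 * (T * δ₁) + δ / T) ≤ (lagrangeBwKLaw I I.B T alg₁ alg₂).real
      {ω | I.OPTDP - I.REW ω.1 ω.2.1 ≤
        T / I.B * (c * (R₁ + R₂ + √(T * Real.log (d * T / δ))))} := by
  have hprob := isProbabilityMeasure_lagrangeBwKLaw I alg₁ alg₂
  have hTpos := I.T_pos
  have hT : (0 : ℝ) < T := Nat.cast_pos.2 hTpos
  have hT1 : (1 : ℝ) ≤ T := Nat.one_le_cast.2 hTpos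
  have hd1 : (1 : ℝ) ≤ d := Nat.one_le_cast.2 (Nat.pos_of_ne_zero (NeZero.ne d))
  have h1B := one_le_div_B I
  set σ := 1 + T / I.B with hσ
  have hσ0 : 0 < σ := by linarith
  obtain ⟨x, hx, hx1, hcons, hopt⟩ := I.exists_mixture
  set Λ := Real.log (d * T / δ) with hΛ
  have hΛ0 : 0 < Λ := zero_lt_one.trans_le hlog
  -- the stake for which the deviation `2 * √(T * Λ)` has probability at most `exp (-(2 * Λ))`
  set s := 2 * √(Λ / T) with hs
  have hs0 : 0 < s := by positivity
  have hs2 : s ^ 2 = 4 * (Λ / T) := by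
    rw [hs, mul_pow, Real.sq_sqrt (by positivity)]; norm_num
  have hsΛ : 4 * Λ = s * (2 * √(T * Λ)) := by
    have : √(Λ / T) * √(T * Λ) = Λ := by
      rw [← Real.sqrt_mul (by positivity), show Λ / T * (T * Λ) = Λ ^ 2 by field_simp,
        Real.sqrt_sq hΛ0.le]
    rw [hs]
    linear_combination (-4) * this
  set E₁ : ℕ → Set ((Fin T → OutcomeMatrix K d) × (Fin T → Fin K) × (Fin T → Fin d)) :=
    fun t₀ => {ω | ∃ b, σ * R₁ < ∑ t : Fin T,
      if (t : ℕ) < t₀ then lagrangian I.B T (ω.1 t) b (ω.2.2 t) -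
        lagrangian I.B T (ω.1 t) (ω.2.1 t) (ω.2.2 t) else 0} with hE₁
  set E₂ : ℕ → Set ((Fin T → OutcomeMatrix K d) × (Fin T → Fin K) × (Fin T → Fin d)) :=
    fun t₀ => {ω | ∃ j, σ * R₂ < ∑ t : Fin T,
      if (t : ℕ) < t₀ then lagrangian I.B T (ω.1 t) (ω.2.1 t) (ω.2.2 t) -
        lagrangian I.B T (ω.1 t) (ω.2.1 t) j else 0} with hE₂
  set E₃ : ℕ → Set ((Fin T → OutcomeMatrix K d) × (Fin T → Fin K) × (Fin T → Fin d)) :=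
    fun t₀ => {ω | 2 * Λ < ∑ t : Fin T, if (t : ℕ) < t₀ then
      s * (((∫ M, mixLagrangian I.B T x M (ω.2.2 t) ∂I.D) -
        mixLagrangian I.B T x (ω.1 t) (ω.2.2 t)) / σ) - s ^ 2 / 2 else 0} with hE₃
  set bad := {ω : (Fin T → OutcomeMatrix K d) × (Fin T → Fin K) × (Fin T → Fin d) |
    ¬ ∀ t, I.Regular (ω.1 t)} ∪ ⋃ t₀ ∈ Finset.Icc 1 T, (E₁ t₀ ∪ E₂ t₀ ∪ E₃ t₀) with hbad
  set μ := lagrangeBwKLaw I I.B T alg₁ alg₂ with hμ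
  have hexp : Real.exp (-(2 * Λ)) ≤ δ / T / T := by
    have e : Real.exp (-(2 * Λ)) = (δ / (d * T)) ^ 2 := by
      rw [show -(2 * Λ) = -Λ + -Λ by ring, Real.exp_add, Real.exp_neg, hΛ,
        Real.exp_log (by positivity), inv_div, sq]
    calc _ = (δ / (d * T)) ^ 2 := e
      _ ≤ (δ / T) ^ 2 := by
          gcongr
          nlinarith
      _ = δ * (δ / T / T) := by ring
      _ ≤ _ := mul_le_of_le_one_left (by positivity) hδ1.le
  have hμbad : μ bad ≤ ENNReal.ofReal (2 * (T * δ₁) + δ / T) := by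
    calc μ bad ≤ μ {ω | ¬ ∀ t, I.Regular (ω.1 t)} +
          μ (⋃ t₀ ∈ Finset.Icc 1 T, (E₁ t₀ ∪ E₂ t₀ ∪ E₃ t₀)) := measure_union_le _ _
      _ = μ (⋃ t₀ ∈ Finset.Icc 1 T, (E₁ t₀ ∪ E₂ t₀ ∪ E₃ t₀)) := by
          have h0 : μ {ω | ¬ ∀ t, I.Regular (ω.1 t)} = 0 :=
            ae_iff.1 (ae_lagrangeBwKLaw I alg₁ alg₂ I.ae_matLaw_regular)
          rw [h0, zero_add]
      _ ≤ ∑ t₀ ∈ Finset.Icc 1 T, μ (E₁ t₀ ∪ E₂ t₀ ∪ E₃ t₀) := measure_biUnion_finset_le _ _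
      _ ≤ ∑ _t₀ ∈ Finset.Icc 1 T, ENNReal.ofReal (δ₁ + δ₁ + δ / T / T) := by
          refine Finset.sum_le_sum fun t₀ ht₀ => ?_
          have hle := (Finset.mem_Icc.1 ht₀).2
          rw [ENNReal.ofReal_add (by positivity) (by positivity), ENNReal.ofReal_add hδ₁ hδ₁]
          refine (measure_union_le _ _).trans (add_le_add ((measure_union_le _ _).trans
            (add_le_add (primal_regret_fail hreg₁ hle) (dual_regret_fail hreg₂ hle))) ?_)
          exact (concentration_fail hx hx1 t₀ s (2 * Λ)).trans (ENNReal.ofReal_le_ofReal hexp)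
      _ = ENNReal.ofReal (2 * (T * δ₁) + δ / T) := by
          rw [Finset.sum_const, Nat.card_Icc, Nat.add_sub_cancel, nsmul_eq_mul,
            ← ENNReal.ofReal_natCast, ← ENNReal.ofReal_mul hT.le]
          congr 1
          field_simp
          ring
  set good := {ω : (Fin T → OutcomeMatrix K d) × (Fin T → Fin K) × (Fin T → Fin d) |
    I.OPTDP - I.REW ω.1 ω.2.1 ≤ T / I.B * (c * (R₁ + R₂ + √(T * Λ)))} with hgood
  have hsub : goodᶜ ⊆ bad := by
    intro ω hω
    by_contra hnb
    refine hω ?_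
    simp only [hbad, Set.mem_union, Set.mem_iUnion, not_or, not_exists, Set.mem_ofPred_eq,
      not_not] at hnb
    obtain ⟨hM, hE⟩ := hnb
    have hn₁ : ∀ t₀ ∈ Finset.Icc 1 T, ∀ b, ∑ t : Fin T, (if (t : ℕ) < t₀ then
        lagrangian I.B T (ω.1 t) b (ω.2.2 t) -
        lagrangian I.B T (ω.1 t) (ω.2.1 t) (ω.2.2 t) else 0) ≤ σ * R₁ := fun t₀ ht₀ b =>
      not_lt.1 fun h => (hE t₀ ht₀).1.1 ⟨b, h⟩
    have hn₂ : ∀ t₀ ∈ Finset.Icc 1 T, ∀ j, ∑ t : Fin T, (if (t : ℕ) < t₀ then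
        lagrangian I.B T (ω.1 t) (ω.2.1 t) (ω.2.2 t) -
        lagrangian I.B T (ω.1 t) (ω.2.1 t) j else 0) ≤ σ * R₂ := fun t₀ ht₀ j =>
      not_lt.1 fun h => (hE t₀ ht₀).1.2 ⟨j, h⟩
    have h1T : 1 ∈ Finset.Icc 1 T := Finset.mem_Icc.2 ⟨le_rfl, hTpos⟩
    have hlt1 : ∀ t : Fin T, ((t : ℕ) < 1) ↔ t = ⟨0, hTpos⟩ := fun t => by
      rw [Nat.lt_one_iff, Fin.ext_iff]
    -- in the first round the chosen action has no regret, so the regret bounds are nonnegative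
    have hR₁ : 0 ≤ R₁ := by
      have h := hn₁ 1 h1T (ω.2.1 ⟨0, hTpos⟩)
      simp only [hlt1, Finset.sum_ite_eq', Finset.mem_univ, if_true, sub_self] at h
      exact nonneg_of_mul_nonneg_right h hσ0
    have hR₂ : 0 ≤ R₂ := by
      have h := hn₂ 1 h1T (ω.2.2 ⟨0, hTpos⟩)
      simp only [hlt1, Finset.sum_ite_eq', Finset.mem_univ, if_true, sub_self] at h
      exact nonneg_of_mul_nonneg_right h hσ0
    have hτ : I.stopRound ω.1 ω.2.1 ∈ Finset.Icc 1 T :=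
      Finset.mem_Icc.2 ⟨I.stopRound_pos _ _, I.stopRound_le _ _⟩
    have hn₃ : ∑ t : Fin T, (if (t : ℕ) < I.stopRound ω.1 ω.2.1 then
      (∫ M, mixLagrangian I.B T x M (ω.2.2 t) ∂I.D) - mixLagrangian I.B T x (ω.1 t) (ω.2.2 t)
        else 0) ≤ σ * (2 * √(T * Λ)) := by
      have h := (hE _ hτ).2
      simp only [hE₃, Set.mem_ofPred_eq, not_lt] at h
      set X : Fin T → ℝ := fun t => if (t : ℕ) < I.stopRound ω.1 ω.2.1 then
        (∫ M, mixLagrangian I.B T x M (ω.2.2 t) ∂I.D) - mixLagrangian I.B T x (ω.1 t) (ω.2.2 t)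
        else 0 with hX
      have h2 : ∑ t : Fin T, (s / σ * X t - s ^ 2 / 2) ≤ 2 * Λ := by
        refine (Finset.sum_le_sum fun t _ => ?_).trans h
        simp only [hX]
        split_ifs
        · exact le_of_eq (by ring)
        · rw [mul_zero, zero_sub, neg_nonpos]
          positivity
      rw [Finset.sum_sub_distrib, ← Finset.mul_sum, Finset.sum_const, Finset.card_univ,
        Fintype.card_fin, nsmul_eq_mul, hs2] at h2
      have h3 : (T : ℝ) * (4 * (Λ / T) / 2) = 2 * Λ := by field_simp; ring
      have h4 : s * (∑ t, X t / σ) ≤ s * (2 * √(T * Λ)) := by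
        rw [← Finset.sum_div, ← hsΛ]
        calc _ = s / σ * ∑ t, X t := by ring
          _ ≤ _ := by linarith
      have h5 := le_of_mul_le_mul_left h4 hs0
      rw [← Finset.sum_div, div_le_iff₀ hσ0] at h5
      linarith
    have hmain := mul_sum_meanReward_sub_REW_le hx hx1 hcons hM (hn₁ _ hτ) (hn₂ _ hτ) hn₃
    have hsq : 1 ≤ √(T * Λ) := Real.one_le_sqrt.2 (by nlinarith)
    have hσ2 : σ * (R₁ + R₂ + 2 * √(T * Λ)) + 2 * (T / I.B) ≤
        T / I.B * (c * (R₁ + R₂ + √(T * Λ))) := by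
      calc _ ≤ (2 * (T / I.B)) * (R₁ + R₂ + 2 * √(T * Λ)) + 2 * (T / I.B) := by
            gcongr
            linarith
        _ = T / I.B * (2 * (R₁ + R₂ + 2 * √(T * Λ)) + 2) := by ring
        _ ≤ _ := by
            gcongr
            nlinarith
    change I.OPTDP - I.REW ω.1 ω.2.1 ≤ _
    linarith
  have h1 : (1 : ℝ) ≤ μ.real good + μ.real goodᶜ := by
    have h := measureReal_union_le (μ := μ) good goodᶜ
    rwa [Set.union_compl_self, probReal_univ] at h
  have h2 : μ.real goodᶜ ≤ 2 * (T * δ₁) + δ / T :=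
    ENNReal.toReal_le_of_le_ofReal (by positivity) ((measure_mono hsub).trans hμbad)
  linarith

/-! ### Trivial ranges of the parameters -/

section trivial_range

variable {K d T : ℕ} (I : Instance K d T)

lemma one_le_lagrangeBwKLaw_of_OPTDP_le (alg₁ : Strategy K ℝ) (alg₂ : Strategy d (Fin d → ℝ))
    {X : ℝ} (hX : I.OPTDP ≤ X) :
    1 ≤ (lagrangeBwKLaw I I.B T alg₁ alg₂).real {ω | I.OPTDP - I.REW ω.1 ω.2.1 ≤ X} := by
  have := isProbabilityMeasure_lagrangeBwKLaw I alg₁ alg₂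
  have h : ∀ᵐ ω ∂lagrangeBwKLaw I I.B T alg₁ alg₂, I.OPTDP - I.REW ω.1 ω.2.1 ≤ X := by
    filter_upwards [ae_lagrangeBwKLaw I alg₁ alg₂ I.ae_matLaw_regular] with ω hω
    linarith [I.REW_nonneg hω ω.2.1]
  have huniv := measure_congr (Filter.eventuallyEq_univ.2 h)
  rw [measureReal_def]
  exact le_of_eq (by rw [huniv, measure_univ, ENNReal.toReal_one])

end trivial_range

/-- A random variable with values in `[0, 1]` exceeds its mean minus `ε` with probability at least
`ε`. -/
lemma le_real_sub_le {Y : Type} [MeasurableSpace Y] {D : Measure Y} [IsProbabilityMeasure D]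
    {X : Y → ℝ} (hX : Measurable X) (hX1 : ∀ᵐ y ∂D, X y ∈ Set.Icc (0 : ℝ) 1) {ε : ℝ}
    (hε : ε ≤ ∫ y, X y ∂D) : ε ≤ D.real {y | ∫ y, X y ∂D - ε ≤ X y} := by
  set p := ∫ y, X y ∂D with hp
  have hm : MeasurableSet {y | p - ε ≤ X y} := measurableSet_le measurable_const hX
  have hint : Integrable X D := Integrable.of_mem_Icc 0 1 hX.aemeasurable hX1
  have hint2 : Integrable ({y | p - ε ≤ X y}.indicator fun _ => (1 : ℝ)) D :=
    (integrable_const 1).indicator hm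
  have h : p ≤ (p - ε) + D.real {y | p - ε ≤ X y} := by
    calc p ≤ ∫ y, ((p - ε) + {y | p - ε ≤ X y}.indicator (fun _ => (1 : ℝ)) y) ∂D := by
          refine integral_mono_ae hint ((integrable_const _).add hint2) ?_
          filter_upwards [hX1] with y hy
          by_cases hy' : p - ε ≤ X y
          · rw [Set.indicator_of_mem (by exact hy')]
            linarith [hy.2]
          · rw [Set.indicator_of_notMem (by exact hy')]
            linarith
      _ = _ := by
          rw [integral_add (integrable_const _) hint2, integral_indicator_const _ hm]
          simp
  linarith

lemma mixProb_const {K : ℕ} [NeZero K] {γ c : ℝ} (hc : c ≠ 0) (j : Fin K) :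
    mixProb γ (fun _ => c) j = 1 / K := by
  have hK : (K : ℝ) ≠ 0 := Nat.cast_ne_zero.2 (NeZero.ne K)
  rw [mixProb, Finset.sum_const, Finset.card_univ, Fintype.card_fin, nsmul_eq_mul]
  field_simp
  ring

/-- The case of a single round and no resource besides the dummy resource. Here the logarithm of
`d * T / δ` may be arbitrarily small, but EXP3.P plays a best arm with probability `1 / K`. -/
lemma single_round {K : ℕ} [NeZero K] (I : Instance K 1 1) {δ lo hi lo' hi' : ℝ} (hδ : 0 < δ)
    (hδ1 : δ < 1) :
    1 - δ ≤ (lagrangeBwKLaw I I.B (1 : ℕ) (exp3pTuned K 1 δ lo hi) (hedgeTuned 1 1 lo' hi')).real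
      {ω | I.OPTDP - I.REW ω.1 ω.2.1 ≤ 1 / I.B * √(K * Real.log (1 / δ))} := by
  set alg₁ := exp3pTuned K 1 δ lo hi with halg₁
  set alg₂ := hedgeTuned 1 1 lo' hi' with halg₂
  have hprob := isProbabilityMeasure_lagrangeBwKLaw I alg₁ alg₂
  have hD := I.isProb
  have hK1 : (1 : ℝ) ≤ K := Nat.one_le_cast.2 (Nat.pos_of_ne_zero (NeZero.ne K))
  have hK : (0 : ℝ) < K := by linarith
  set ε := 1 / I.B * √(K * Real.log (1 / δ)) with hε
  obtain ⟨b, hb⟩ := I.exists_OPTDP_le_mul_meanReward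
  rw [Nat.cast_one, one_mul] at hb
  by_cases hεp : I.OPTDP ≤ ε
  · linarith [one_le_lagrangeBwKLaw_of_OPTDP_le I alg₁ alg₂ hεp]
  rw [not_le] at hεp
  have hε1 : ε ≤ 1 := (hεp.le.trans hb).trans (I.meanReward_le_one b)
  have hlogδ : 1 - δ ≤ Real.log (1 / δ) := by
    rw [one_div, Real.log_inv]
    linarith [Real.log_le_sub_one_of_pos hδ]
  have hεK : K * (1 - δ) ≤ ε := by
    have h1B : 1 ≤ 1 / I.B := by simpa using one_le_div_B I
    have hnn : 0 ≤ K * Real.log (1 / δ) := mul_nonneg hK.le (by linarith)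
    have h1 : √(K * Real.log (1 / δ)) ≤ ε := le_mul_of_one_le_left (Real.sqrt_nonneg _) h1B
    have h2 : K * Real.log (1 / δ) ≤ √(K * Real.log (1 / δ)) := by
      have := Real.sq_sqrt hnn
      nlinarith [Real.sqrt_nonneg (K * Real.log (1 / δ))]
    nlinarith
  set A := {M : OutcomeMatrix K 1 | I.meanReward b - ε ≤ (M b).1} with hA
  have hAm : MeasurableSet A := measurableSet_le measurable_const (measurable_reward b)
  have hDA : ε ≤ I.D.real A :=
    le_real_sub_le (measurable_reward b) (I.reward_mem.mono fun M h => h b) (hεp.le.trans hb)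
  set E : Set ((Fin 1 → OutcomeMatrix K 1) × (Fin 1 → Fin K) × (Fin 1 → Fin 1)) :=
    {ω | ω.1 0 ∈ A ∧ ω.2.1 0 = b} with hE
  have hind : ∀ w, Measurable fun M => E.indicator (fun _ => (1 : ENNReal)) (M, w) := fun w =>
    measurable_const.indicator
      ((hAm.preimage (measurable_pi_apply 0)).inter (MeasurableSet.const (w.1 0 = b)))
  have hEm : MeasurableSet E := (measurable_indicator_const_iff (1 : ENNReal)).1
    (measurable_from_prod_countable_left hind)
  have hdens : ∀ M, lagrangeDensity I alg₁ alg₂ M (fun _ => b) (fun _ => 0) = 1 / K := by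
    intro M
    have h1 : ∀ h, alg₁.prob 0 h b = 1 / K := fun h => mixProb_const (Real.exp_pos _).ne' b
    have h2 : ∀ h, alg₂.prob 0 h 0 = 1 := fun h => by
      have := alg₂.sum_prob 0 h
      simpa using this
    simp only [lagrangeDensity, Strategy.playProb, Finset.univ_unique, Finset.prod_singleton]
    exact (congrArg₂ _ (h1 _) (h2 _)).trans (mul_one _)
  have hlaw := lintegral_lagrangeBwKLaw I alg₁ alg₂ hind
  rw [lintegral_indicator_const hEm, one_mul] at hlaw
  have hE1 : ENNReal.ofReal (1 / K * I.D.real A) ≤ lagrangeBwKLaw I I.B (1 : ℕ) alg₁ alg₂ E := by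
    rw [hlaw]
    calc _ = ∫⁻ M, ENNReal.ofReal (1 / K) *
          ((fun M : Fin 1 → OutcomeMatrix K 1 => M 0) ⁻¹' A).indicator (fun _ => 1) M
            ∂I.matLaw := by
          have hA0 := hAm.preimage (measurable_pi_apply (X := fun _ : Fin 1 => OutcomeMatrix K 1) 0)
          rw [lintegral_const_mul _ (measurable_const.indicator hA0),
            lintegral_indicator_const hA0, one_mul, ENNReal.ofReal_mul (by positivity)]
          congr 1
          have := (measurePreserving_eval (fun _ : Fin 1 => I.D) 0).measure_preimage
            hAm.nullMeasurableSet
          rw [ofReal_measureReal]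
          exact this.symm
      _ ≤ _ := by
          refine lintegral_mono fun M => ?_
          refine le_trans (le_of_eq ?_) (Finset.single_le_sum (fun _ _ => zero_le)
            (Finset.mem_univ ((fun _ => b), (fun _ => 0))))
          rw [hdens]
          congr 1
          by_cases hM : M 0 ∈ A <;> simp [hE, hM]
  have hsub : E ⊆ {ω | I.OPTDP - I.REW ω.1 ω.2.1 ≤ ε} := by
    rintro ω ⟨hω, hωb⟩
    have hrew : I.REW ω.1 ω.2.1 = (ω.1 0 b).1 := by
      have hpos := I.stopRound_pos ω.1 ω.2.1
      simp [Instance.REW, hpos, hωb]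
    have hω' : I.meanReward b - ε ≤ (ω.1 0 b).1 := hω
    change I.OPTDP - I.REW ω.1 ω.2.1 ≤ ε
    rw [hrew]
    linarith
  have h1 : 1 / K * I.D.real A ≤ (lagrangeBwKLaw I I.B (1 : ℕ) alg₁ alg₂).real E :=
    (ENNReal.ofReal_le_iff_le_toReal (measure_ne_top _ _)).1 hE1
  have h2 := measureReal_mono (μ := lagrangeBwKLaw I I.B (1 : ℕ) alg₁ alg₂) hsub
  have h3 : 1 - δ ≤ 1 / K * I.D.real A := by
    rw [one_div, ← div_eq_inv_mul, le_div_iff₀ hK]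
    linarith
  exact h3.trans (h1.trans h2)

/-! ### The two parts of the theorem -/

lemma one_le_log_of_three_le {y : ℝ} (hy : 3 ≤ y) : 1 ≤ Real.log y := by
  rw [Real.le_log_iff_exp_le (by linarith)]
  linarith [Real.exp_one_lt_d9]

section parts

variable {K d T : ℕ} [NeZero K] [NeZero d] (I : Instance K d T) {δ : ℝ}

/-- LagrangeBwK with arbitrary players that satisfy regret bounds. -/
lemma lagrangeBwK_of_hasRegretBound (hδ : 0 < δ) (hδ1 : δ < 1) {alg₁ : Strategy K ℝ}
    {alg₂ : Strategy d (Fin d → ℝ)} {R₁ R₂ c : ℝ} (hc : 6 ≤ c)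
    (hreg₁ : HasRegretBound banditFeedback alg₁ T (1 - T / I.B) 2 (δ / T) R₁)
    (hreg₂ : HasRegretBound fullFeedback alg₂ T (-2) (T / I.B - 1) (δ / T) R₂) :
    1 - 3 * (δ * T) ≤ (lagrangeBwKLaw I I.B T alg₁ alg₂).real
      {ω | I.OPTDP - I.REW ω.1 ω.2.1 ≤
        T / I.B * (c * (R₁ + R₂ + √(T * Real.log (d * T / δ))))} := by
  have hT1 : (1 : ℝ) ≤ T := Nat.one_le_cast.2 I.T_pos
  have hd1 : (1 : ℝ) ≤ d := Nat.one_le_cast.2 (Nat.pos_of_ne_zero (NeZero.ne d))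
  -- the claim is empty unless `δ` is so small that the logarithm is at least `1`
  by_cases htriv : 1 ≤ 3 * (δ * T)
  · exact le_trans (by linarith) measureReal_nonneg
  rw [not_le] at htriv
  have hlog : 1 ≤ Real.log (d * T / δ) := by
    refine one_le_log_of_three_le ?_
    rw [le_div_iff₀ hδ]
    nlinarith
  refine le_trans ?_ (one_sub_le_lagrangeBwKLaw I hδ hδ1 hlog (by positivity) hc hreg₁ hreg₂)
  have h1 : T * (δ / T) = δ := by field_simp
  have h2 : δ / T ≤ δ := div_le_self hδ.le hT1
  rw [h1]
  nlinarith

/-- LagrangeBwK with EXP3.P and Hedge. -/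
lemma lagrangeBwK_exp3p_hedge (hδ : 0 < δ) (hδ1 : δ < 1) :
    1 - δ ≤ (lagrangeBwKLaw I I.B T (exp3pTuned K T δ (1 - T / I.B) 2)
      (hedgeTuned d T (-2) (T / I.B - 1))).real {ω | I.OPTDP - I.REW ω.1 ω.2.1 ≤
        150 * (T / I.B) * √(T * K * Real.log (d * T / δ))} := by
  have hTpos := I.T_pos
  have hT1 : (1 : ℝ) ≤ T := Nat.one_le_cast.2 hTpos
  have hT0 : (0 : ℝ) < T := by linarith
  have hd1 : 1 ≤ d := Nat.pos_of_ne_zero (NeZero.ne d)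
  have hd1' : (1 : ℝ) ≤ d := Nat.one_le_cast.2 hd1
  have hK1 : (1 : ℝ) ≤ K := Nat.one_le_cast.2 (Nat.pos_of_ne_zero (NeZero.ne K))
  have h1B := one_le_div_B I
  set Λ := Real.log (d * T / δ) with hΛ
  set W := √(T * K * Λ) with hW
  -- the bound is trivial once it exceeds the number of rounds
  by_cases htriv : (T : ℝ) ≤ 150 * (T / I.B) * W
  · have := one_le_lagrangeBwKLaw_of_OPTDP_le I (exp3pTuned K T δ (1 - T / I.B) 2)
      (hedgeTuned d T (-2) (T / I.B - 1)) (I.OPTDP_le.trans htriv)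
    exact le_trans (by linarith) this
  rw [not_le] at htriv
  have hWT : 150 * W < T := by
    refine lt_of_le_of_lt ?_ htriv
    have : 0 ≤ W := Real.sqrt_nonneg _
    nlinarith
  -- with fewer than three rounds, the bound exceeds the number of rounds unless `d * T = 1`
  rcases lt_or_ge T 3 with hT3 | hT3
  · by_cases hdT : d * T = 1
    · obtain ⟨rfl, rfl⟩ := mul_eq_one.1 hdT
      refine (single_round I hδ hδ1).trans (measureReal_mono ?_ ?_)
      · intro ω hω
        change I.OPTDP - I.REW ω.1 ω.2.1 ≤ _
        refine le_trans hω ?_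
        simp only [hW, hΛ, Nat.cast_one, one_mul]
        have : 0 ≤ 1 / I.B * √(K * Real.log (1 / δ)) := by
          have := I.B_pos
          positivity
        linarith
      · have := isProbabilityMeasure_lagrangeBwKLaw I (exp3pTuned K 1 δ (1 - (1 : ℕ) / I.B) 2)
          (hedgeTuned 1 1 (-2) ((1 : ℕ) / I.B - 1))
        exact measure_ne_top _ _
    · exfalso
      have h2 : 2 ≤ d * T := by
        have : 0 < d * T := Nat.mul_pos hd1 hTpos
        omega
      have h2' : (2 : ℝ) ≤ d * T := by exact_mod_cast h2
      have hlog : 1 / 2 ≤ Λ := by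
        have : Real.log 2 ≤ Λ := Real.log_le_log (by norm_num) (by
          rw [le_div_iff₀ hδ]
          nlinarith)
        linarith [Real.log_two_gt_d9]
      have hW2 : 1 / 2 ≤ W := by
        refine Real.le_sqrt_of_sq_le ?_
        have : 1 ≤ (T : ℝ) * K := one_le_mul_of_one_le_of_one_le hT1 hK1
        nlinarith
      have hT3' : (T : ℝ) < 3 := by exact_mod_cast hT3
      linarith
  have hT3' : (3 : ℝ) ≤ T := by exact_mod_cast hT3
  have hdT3 : 3 ≤ d * T / δ := by
    rw [le_div_iff₀ hδ]
    nlinarith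
  have hdT1 : 1 ≤ d * T / δ := by linarith
  have hlog : 1 ≤ Λ := one_le_log_of_three_le hdT3
  have hWsq : W ^ 2 = T * K * Λ := Real.sq_sqrt (by positivity)
  have hW0 : 0 ≤ W := Real.sqrt_nonneg _
  have hTKΛ : 22500 * (K * Λ) ≤ T := by
    have h1 : (150 * W) ^ 2 ≤ (T : ℝ) ^ 2 := by gcongr
    rw [mul_pow, hWsq] at h1
    have h2 : (T : ℝ) * (22500 * (K * Λ)) ≤ T * T := by linarith
    exact le_of_mul_le_mul_left h2 hT0
  have hKΛ : (K : ℝ) ≤ K * Λ := le_mul_of_one_le_right (by linarith) hlog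
  have hΛK : Λ ≤ K * Λ := le_mul_of_one_le_left (by linarith) hK1
  have hQ : Real.log (K * T / δ) ≤ 2 * Λ := by
    rw [hΛ, ← Real.log_rpow (by linarith)]
    refine Real.log_le_log (by positivity) ?_
    norm_num
    rw [div_pow, div_le_div_iff₀ hδ (by positivity)]
    have h1 : (K : ℝ) * T ≤ (d * T) ^ 2 := by
      rw [mul_pow]
      nlinarith [mul_le_mul_of_nonneg_left (show (K : ℝ) ≤ T by linarith) hT0.le,
        one_le_pow₀ hd1' (n := 2), sq_nonneg (T : ℝ)]
    have h2 : δ ^ 2 ≤ δ := by nlinarith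
    exact mul_le_mul h1 h2 (by positivity) (by positivity)
  -- as tuned, both algorithms fail with probability at most `δ / (3 * T)`, which leaves room for
  -- the union bound over the rounds
  have hreg₁ := exp3pTuned_hasRegretBound (K := K) (lo := 1 - T / I.B) (hi := 2) hδ hδ1 hTpos
    (by nlinarith) (by linarith)
  have hreg₂ := hedgeTuned_hasRegretBound (n := d) (T := T) (lo := -2) (hi := T / I.B - 1)
    (Q := 2 * Λ) (by linarith) (by linarith)
    ((Real.log_le_log (by linarith) (by
      rw [le_div_iff₀ hδ]
      nlinarith)).trans (by linarith : Λ ≤ 2 * Λ)) (by linarith)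
  have hfail₁ : (δ / T) ^ 2 ≤ δ / (3 * T) := by
    rw [div_pow, div_le_div_iff₀ (by positivity) (by positivity)]
    have h1 : δ ^ 2 ≤ δ := by nlinarith
    have h2 : 3 * (T : ℝ) ≤ T ^ 2 := by nlinarith
    exact mul_le_mul h1 h2 (by positivity) hδ.le
  have hfail₂ : Real.exp (-(2 * Λ)) ≤ δ / (3 * T) := by
    refine le_trans (le_of_eq ?_) (le_trans (?_ : (δ / (d * T)) ^ 2 ≤ (δ / T) ^ 2) hfail₁)
    · rw [show -(2 * Λ) = -Λ + -Λ by ring, Real.exp_add, Real.exp_neg, hΛ,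
        Real.exp_log (by positivity), inv_div, sq]
    · gcongr
      nlinarith
  refine le_trans ?_ ((one_sub_le_lagrangeBwKLaw I hδ hδ1 hlog (by positivity) le_rfl
    (hreg₁.mono _ _ hfail₁) (hreg₂.mono _ _ hfail₂)).trans (measureReal_mono ?_ ?_))
  · have h1 : T * (δ / (3 * T)) = δ / 3 := by field_simp
    have h2 : δ / T ≤ δ / 3 := by gcongr
    rw [h1]
    linarith
  · intro ω hω
    change I.OPTDP - I.REW ω.1 ω.2.1 ≤ _
    refine le_trans hω ?_
    have hsqrt : ∀ {u c : ℝ}, 0 ≤ c → u ≤ c ^ 2 * (T * K * Λ) → √u ≤ c * W := fun {u c} hc hu => by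
      refine (Real.sqrt_le_sqrt hu).trans (le_of_eq ?_)
      rw [Real.sqrt_mul (sq_nonneg c), Real.sqrt_sq hc]
    have hTΛ : T * Λ ≤ T * K * Λ := by
      rw [mul_assoc]
      exact mul_le_mul_of_nonneg_left hΛK hT0.le
    have hTK : (0 : ℝ) ≤ T * K := by positivity
    have hTKΛ0 : 0 ≤ T * K * Λ := by positivity
    have e1 : √(K * T * Real.log (K * T / δ)) ≤ 3 / 2 * W := by
      refine hsqrt (by norm_num) ?_
      have := mul_le_mul_of_nonneg_left hQ hTK
      rw [mul_comm (K : ℝ) (T : ℝ)] at this ⊢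
      nlinarith
    have e2 : √(T * (2 * Λ)) ≤ 3 / 2 * W := hsqrt (by norm_num) (by nlinarith)
    have e3 : √(T * Λ) ≤ 1 * W := hsqrt (by norm_num) (by linarith)
    calc T / I.B * (6 * (10 * √(K * T * Real.log (K * T / δ)) + 5 * √(T * (2 * Λ)) + √(T * Λ)))
        ≤ T / I.B * (150 * W) :=
          mul_le_mul_of_nonneg_left (by linarith) (by linarith)
      _ = _ := by ring
  · have := isProbabilityMeasure_lagrangeBwKLaw I (exp3pTuned K T δ (1 - T / I.B) 2)
      (hedgeTuned d T (-2) (T / I.B - 1))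
    exact measure_ne_top _ _

end parts

end BwK

end

/-- The primal payoffs lie in `[1 - T/B, 2]`; the dual payoffs, being negated costs, lie in
`[-2, T/B - 1]`. The numbers `R₁`, `R₂` are the regret terms at confidence level `δ / T`. -/
theorem theorem4p2 :
    ∃ C : ℝ, 0 < C ∧
      ∀ (K d T : ℕ) [NeZero K] [NeZero d] (I : BwK.Instance K d T) (δ : ℝ), 0 < δ → δ < 1 →
        (1 - δ ≤
          (BwK.lagrangeBwKLaw I I.B T
            (BwK.exp3pTuned K T δ (1 - T / I.B) 2)
            (BwK.hedgeTuned d T (-2) (T / I.B - 1))).real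
            {ω | I.OPTDP - I.REW ω.1 ω.2.1 ≤
              C * (T / I.B) * √(T * K * Real.log (d * T / δ))}) ∧
        ∀ (alg₁ : BwK.Strategy K ℝ) (alg₂ : BwK.Strategy d (Fin d → ℝ)) (R₁ R₂ : ℝ),
          BwK.HasRegretBound BwK.banditFeedback alg₁ T (1 - T / I.B) 2 (δ / T) R₁ →
          BwK.HasRegretBound BwK.fullFeedback alg₂ T (-2) (T / I.B - 1) (δ / T) R₂ →
          1 - C * (δ * T) ≤
            (BwK.lagrangeBwKLaw I I.B T alg₁ alg₂).real
              {ω | I.OPTDP - I.REW ω.1 ω.2.1 ≤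
                C * (T / I.B) *
                  (R₁ + R₂ + √(T * Real.log (d * T / δ)))} := by
  refine ⟨150, by norm_num, fun K d T _ _ I δ hδ hδ1 =>
    ⟨BwK.lagrangeBwK_exp3p_hedge I hδ hδ1, fun alg₁ alg₂ R₁ R₂ h₁ h₂ => ?_⟩⟩
  have h := BwK.lagrangeBwK_of_hasRegretBound I hδ hδ1 (by norm_num : (6 : ℝ) ≤ 150) h₁ h₂
  simp only [← mul_assoc, mul_comm ((T : ℝ) / I.B) 150] at h ⊢
  refine le_trans ?_ h
  have : 0 ≤ δ * T := by positivity
  linarith
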